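/- Let $N\ge 1$, $\Omega=\{x=(x',x_N)\in\mathbb R^N : x_N>0\}$, $s\in(1/2,1)$, $\gamma>0$, $\nu_0>0$. Let $F:\mathbb R^N\to[0,\infty)$ be bounded and radial ($F(v)=\tilde F(|v|^2)$) with $\int_{\mathbb R^N}F\,dv=1$ and, for some constant $C$, $$\Big|F(v)-\frac{\gamma}{|v|^{N+2s}}\Big|\le \frac{C}{|v|^{N+4s}}\qquad\text{for all } |v|\ge 1 .$$ For $\psi(t,\cdot)\in H^2(\Omega)$ define the extension $$\widetilde\psi(t,x,v)=\begin{cases}\psi(t,x) & \text{if } x_N\ge 0,\\ \psi\big(t,x'-\tfrac{x_N}{v_N}v',0\big) & \text{if } x_N<0,\ v_N<0,\\ 0 & \text{if } x_N<0,\ v_N\ge 0,\end{cases}$$ where the values of $\psi(t,\cdot)$ on $\partial\Omega=\{x_N=0\}$ are those of its trace. For $\varepsilon>0$ and $x\in\Omega$ put $$\phi^\varepsilon(t,x,v)=\int_0^\infty e^{-\nu_0 z}\,\nu_0\,\widetilde\psi(t,x+\varepsilon v z,v)\,dz,\qquad \mathcal L^\varepsilon[\psi](t,x)=\varepsilon^{-2s}\int_{\mathbb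 R^N}\nu_0F(v)\,[\phi^\varepsilon(t,x,v)-\psi(t,x)]\,dv,$$ $$\mathcal L[\psi](t,x)=\gamma\,\nu_0^{1-2s}\,\Gamma(2s+1)\ \mathrm{P.V.}\!\int_{\mathbb R^N}\frac{\widetilde\psi(t,y,y-x)-\psi(t,x)}{|y-x|^{N+2s}}\,dy ,$$ where the principal value is the limit as $\delta\to0^+$ of the integrals over $\{|y-x|>\delta\}$. Let $\psi\in L^\infty(0,\infty;H^2(\Omega))$ be such that $\mathcal L[\psi]\in L^2((0,\infty)\times\Omega)$. Then the principal value defining $\mathcal L[\psi](t,x)$ exists, and for every $\varepsilon>0$ the integrals defining $\mathcal L^\varepsilon[\psi](t,x)$ converge absolutely, for almost every $(t,x)\in(0,\infty)\times\Omega$; and for every $T>0$ one has $\mathcal L^\varepsilon[\psi]\in L^2((0,T)\times\Omega)$ for every $\varepsilon>0$ and $$\mathcal L^\varepsilon[\psi]\longrightarrow\mathcal L[\psi]\qquad\text{strongly in } L^2((0,T)\times\Omega)\quad\text{as }\varepsilon\to0^+ .$$ -/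

import Mathlib

open MeasureTheory Filter Set
open scoped Topology ContDiff ENNReal NNReal

namespace FracDiff

/-- The Euclidean space `ℝ^N` with `N = n + 1`; the distinguished last coordinate `x_N` is
`x (Fin.last n)`. -/
abbrev Space (n : ℕ) : Type := EuclideanSpace ℝ (Fin (n + 1))

/-- The upper half space `Ω = {x ∈ ℝ^N : x_N > 0}`. -/
def upperHalf (n : ℕ) : Set (Space n) := {x | 0 < x (Fin.last n)}

/-- The `i`-th vector of the canonical basis of `ℝ^N`. -/
noncomputable def basisVec (n : ℕ) (i : Fin (n + 1)) : Space n := EuclideanSpace.single i 1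

/-- Lebesgue measure on `Ω`. -/
noncomputable def volHalf (n : ℕ) : Measure (Space n) := volume.restrict (upperHalf n)

/-- Lebesgue measure on `I × Ω`, for a set of times `I`. -/
noncomputable def volTime (n : ℕ) (I : Set ℝ) : Measure (ℝ × Space n) :=
  (volume.restrict I).prod (volHalf n)

/-! ### The Sobolev space `H²(Ω)` and `L^∞(0,∞;H²(Ω))` -/

/-- `g` is the weak partial derivative `∂_i u` on `Ω`, tested against `C_c^∞(Ω)`. -/
def HasWeakPartial {n : ℕ} (i : Fin (n + 1)) (u g : Space n → ℝ) : Prop :=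
  ∀ φ : Space n → ℝ, ContDiff ℝ ∞ φ → HasCompactSupport φ → tsupport φ ⊆ upperHalf n →
    ∫ x, u x * fderiv ℝ φ x (basisVec n i) ∂(volHalf n) = -∫ x, g x * φ x ∂(volHalf n)

/-- `u ∈ H²(Ω)`, with weak first derivatives `G i = ∂_i u` and weak second derivatives
`H i j = ∂_j ∂_i u`, all in `L²(Ω)`. -/
structure IsH2 {n : ℕ} (u : Space n → ℝ) (G : Fin (n + 1) → Space n → ℝ)
    (H : Fin (n + 1) → Fin (n + 1) → Space n → ℝ) : Prop where
  memLp : MemLp u 2 (volHalf n)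
  memLp_fst : ∀ i, MemLp (G i) 2 (volHalf n)
  memLp_snd : ∀ i j, MemLp (H i j) 2 (volHalf n)
  weak_fst : ∀ i, HasWeakPartial i u (G i)
  weak_snd : ∀ i j, HasWeakPartial j (G i) (H i j)

/-- `u ∈ H²(Ω)` with `‖u‖_{H²(Ω)} ≤ C` (weak derivatives are unique almost everywhere). -/
def H2NormLE {n : ℕ} (u : Space n → ℝ) (C : ℝ≥0) : Prop :=
  ∃ G H, IsH2 u G H ∧
    eLpNorm u 2 (volHalf n) ^ 2 + ∑ i, eLpNorm (G i) 2 (volHalf n) ^ 2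
      + ∑ i, ∑ j, eLpNorm (H i j) 2 (volHalf n) ^ 2 ≤ (C : ℝ≥0∞) ^ 2

/-- `ψ ∈ L^∞(0,∞;H²(Ω))`. As `H²(Ω)` is separable, strong measurability of `t ↦ ψ(t)` amounts
to joint measurability of `(t, x) ↦ ψ(t, x)`. -/
def MemLinftyH2 {n : ℕ} (ψ : ℝ → Space n → ℝ) : Prop :=
  AEStronglyMeasurable (fun p : ℝ × Space n => ψ p.1 p.2) (volTime n (Ioi 0)) ∧
    ∃ C : ℝ≥0, ∀ᵐ t ∂(volume.restrict (Ioi (0 : ℝ))), H2NormLE (ψ t) C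

/-! ### Trace and extension along characteristics -/

/-- The trace of `u` at the boundary point `x ∈ ∂Ω`, as the limit of averages of `u` along the
inward normal. For `u ∈ H¹(Ω)`, which is absolutely continuous on almost every normal line, the
limit exists for almost every `x ∈ ∂Ω`, depends only on the class of `u`, and is the usual trace
of `u`. -/
noncomputable def trace {n : ℕ} (u : Space n → ℝ) (x : Space n) : ℝ :=
  limUnder (𝓝[>] (0 : ℝ)) fun h => h⁻¹ * ∫ τ in (0 : ℝ)..h, u (x + τ • basisVec n (Fin.last n))

open Classical in
/-- The extension `ũ(x, v)`: it equals `u(x)` in `Ω` and the trace of `u` on `∂Ω`; outside `Ω`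
it is constant along the lines `τ ↦ x + τ v`, with the value of (the trace of) `u` at the
boundary point `(x' - (x_N / v_N) v', 0)` if `v_N < 0`, and it is zero if `v_N ≥ 0`. -/
noncomputable def ext {n : ℕ} (u : Space n → ℝ) (x v : Space n) : ℝ :=
  if 0 < x (Fin.last n) then u x
  else if x (Fin.last n) = 0 ∨ v (Fin.last n) < 0 then
    trace u (x - (x (Fin.last n) / v (Fin.last n)) • v)
  else 0

/-! ### The approximate operators -/

/-- The integrand `e^{-ν₀ z} ν₀ ũ(x + ε z v, v)` of `φ^ε`. -/
noncomputable def phiIntegrand {n : ℕ} (ν₀ ε : ℝ) (u : Space n → ℝ) (x v : Space n) (z : ℝ) : ℝ :=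
  Real.exp (-ν₀ * z) * ν₀ * ext u (x + (ε * z) • v) v

/-- `φ^ε(x, v) = ∫_0^∞ e^{-ν₀ z} ν₀ ũ(x + ε z v, v) dz`. -/
noncomputable def phiEps {n : ℕ} (ν₀ ε : ℝ) (u : Space n → ℝ) (x v : Space n) : ℝ :=
  ∫ z in Ioi (0 : ℝ), phiIntegrand ν₀ ε u x v z

/-- `𝓛^ε[u](x) = ε^{-2s} ∫ ν₀ F(v) [φ^ε(x, v) - u(x)] dv`. -/
noncomputable def opEps {n : ℕ} (s ν₀ : ℝ) (F : Space n → ℝ) (ε : ℝ) (u : Space n → ℝ)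
    (x : Space n) : ℝ :=
  ε ^ (-2 * s) * ∫ v, ν₀ * F v * (phiEps ν₀ ε u x v - u x)

/-! ### The limiting operator -/

/-- The integral of `f` outside the ball of radius `δ` around `x`. -/
noncomputable def truncIntegral {n : ℕ} (f : Space n → ℝ) (x : Space n) (δ : ℝ) : ℝ :=
  ∫ y in (Metric.closedBall x δ)ᶜ, f y

/-- The principal value `P.V. ∫ f(y) dy` at the singularity `x`. -/
noncomputable def principalValue {n : ℕ} (f : Space n → ℝ) (x : Space n) : ℝ :=
  limUnder (𝓝[>] (0 : ℝ)) (truncIntegral f x)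

/-- The principal value of `f` at `x` exists: `f` is integrable away from `x` and the truncated
integrals converge. -/
def HasPrincipalValue {n : ℕ} (f : Space n → ℝ) (x : Space n) : Prop :=
  (∀ δ : ℝ, 0 < δ → IntegrableOn f (Metric.closedBall x δ)ᶜ) ∧
    Tendsto (truncIntegral f x) (𝓝[>] (0 : ℝ)) (𝓝 (principalValue f x))

/-- The integrand `[ũ(y, y - x) - u(x)] / |y - x|^{N+2s}` of the limiting operator. -/
noncomputable def limKernel {n : ℕ} (s : ℝ) (u : Space n → ℝ) (x y : Space n) : ℝ :=
  (ext u y (y - x) - u x) / ‖y - x‖ ^ ((n : ℝ) + 1 + 2 * s)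

/-- `𝓛[u](x) = γ ν₀^{1-2s} Γ(2s+1) P.V. ∫ [ũ(y, y - x) - u(x)] / |y - x|^{N+2s} dy`. -/
noncomputable def opLim {n : ℕ} (s γ ν₀ : ℝ) (u : Space n → ℝ) (x : Space n) : ℝ :=
  γ * ν₀ ^ (1 - 2 * s) * Real.Gamma (2 * s + 1) * principalValue (limKernel s u x) x

/-! ### The equilibrium -/

/-- `F` is a bounded, nonnegative, radial, normalized equilibrium with heavy tail
`|F(v) - γ / |v|^{N+2s}| ≤ C / |v|^{N+4s}` for `|v| ≥ 1`. -/
structure IsEquilibrium {n : ℕ} (s γ : ℝ) (F : Space n → ℝ) : Prop where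
  nonneg : ∀ v, 0 ≤ F v
  radial : ∃ f : ℝ → ℝ, ∀ v, F v = f (‖v‖ ^ 2)
  bounded : MemLp F ∞ volume
  integrable : Integrable F
  integral_eq_one : ∫ v, F v = 1
  tail : ∃ C : ℝ, ∀ v, 1 ≤ ‖v‖ →
    |F v - γ / ‖v‖ ^ ((n : ℝ) + 1 + 2 * s)| ≤ C / ‖v‖ ^ ((n : ℝ) + 1 + 4 * s)

end FracDiff

namespace FracDiff

/-! Let `g` be the gradient of `ψ(t,·)`, extended by zero outside `Ω`. The extension is constant
along characteristics after they leave `Ω`, so its increment from `x` in direction `w` is `lineInt g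
(t,x) w = ∫₀¹ w · g(t, x + σw) dσ`, for almost every `(t,x)` and almost every `w`
(`IsGradRep.ext_sub_ae`). The geometry of the boundary then enters only through the zero extension
of `g`. The substitution `w = εzv` turns `𝓛^ε[ψ](x)` into the integral of these increments against a
kernel `epsKer`, while `𝓛[ψ]` is the limit of the same integrals against truncations of
`κ|w|^{-N-2s}`, with `κ = γ ν₀^{1-2s} Γ(2s+1)`. By homogeneity `epsKer ≤ const · |w|^{-N-2s}`
uniformly in `ε` (`epsKer_le`), and the tail of `F` gives `epsKer → κ|w|^{-N-2s}` pointwise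
(`tendsto_epsKer`).

For `|w| ≤ 1`, subtract from the increment the part obtained by freezing `g` at `x` on the portion
of the segment inside `Ω`. The remainder has `L²` norm at most a constant times `min(|w|, |w|²)`:
two derivatives serve for small `w`, one for large `w`. This weight is integrable against
`|w|^{-N-2s}` because `1/2 < s < 1`, so Minkowski's inequality and dominated convergence settle the
remainder (`IsGradRep.eLpNorm_remPart_le`, `tendsto_lintegral_epsKer_sub`).

The frozen part integrates, by symmetry of the kernel `K`, to `∂_Nψ(x) b_K(x_N)` with `b_K(h) =
∫_{|w|≤1} K(w) (-h-w_N)₊ dw` (`IsRadialKernel.integral_linPart`). For the homogeneous kernel `b` is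
of order `h^{1-2s}` near the boundary, which is not square integrable once `s ≥ 3/4`. Here the
hypothesis `𝓛[ψ] ∈ L²` is used: subtracting the remainder, which is in `L²`, shows that `∂_Nψ · b`
is in `L²((0,T)×Ω)` (`IsGradRep.memLp_bdPart_homKer`). It dominates the boundary terms of all `𝓛^ε`,
because all kernels and `(-h-w_N)₊` are nonnegative, and dominated convergence concludes. -/

/-! ### Sobolev functions along the lines of a measure-preserving flow -/

/-- The homeomorphism `y ↦ y + σ X(y)` for a field `X` that is constant along its own lines. -/
def lineFlow {n : ℕ} (X : Space n → Space n) (hX : Continuous X)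
    (hXX : ∀ (σ : ℝ) y, X (y + σ • X y) = X y) (σ : ℝ) : Space n ≃ₜ Space n where
  toFun y := y + σ • X y
  invFun y := y - σ • X y
  left_inv y := by
    change y + σ • X y - σ • X (y + σ • X y) = y
    rw [hXX]; abel
  right_inv y := by
    have h := hXX (-σ) y
    change y - σ • X y + σ • X (y - σ • X y) = y
    rw [show y - σ • X y = y + (-σ) • X y by rw [neg_smul]; abel, h]
    rw [neg_smul]; abel
  continuous_toFun := by fun_prop
  continuous_invFun := by fun_prop

theorem integral_comp_lineFlow {n : ℕ} {F : Type*} [NormedAddCommGroup F] [NormedSpace ℝ F]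
    {X : Space n → Space n} (hX : Continuous X)
    (hXX : ∀ (σ : ℝ) y, X (y + σ • X y) = X y)
    (hmp : ∀ σ : ℝ, MeasurePreserving (fun y => y + σ • X y) volume volume)
    (σ : ℝ) (f : Space n → F) :
    ∫ y, f (y + σ • X y) = ∫ y, f y :=
  (hmp σ).integral_comp (lineFlow X hX hXX σ).measurableEmbedding f

theorem memLp_comp_lineFlow {n : ℕ} {F : Type*} [NormedAddCommGroup F]
    {X : Space n → Space n} (hX : Continuous X)
    (hmp : ∀ σ : ℝ, MeasurePreserving (fun y => y + σ • X y) volume volume)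
    (μ : Measure ℝ) [IsFiniteMeasure μ] {c : ℝ} {f : Space n → F} (hf : MemLp f 2 volume) :
    MemLp (fun p : Space n × ℝ => f (p.1 + (c * p.2) • X p.1)) 2 (volume.prod μ) := by
  have h1 : MeasurePreserving (fun p : ℝ × Space n => (p.1, p.2 + (c * p.1) • X p.2))
      (μ.prod volume) (μ.prod volume) :=
    (MeasurePreserving.id μ).skew_product (g := fun σ y => y + (c * σ) • X y)
      (by
        have : Continuous (Function.uncurry fun (σ : ℝ) y => y + (c * σ) • X y) := by
          unfold Function.uncurry; fun_prop
        exact this.measurable)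
      (ae_of_all _ fun σ => (hmp (c * σ)).map_eq)
  have h2 := (hf.comp_snd μ).comp_measurePreserving h1
  exact h2.comp_measurePreserving (Measure.measurePreserving_swap (μ := volume) (ν := μ))

/-- Against a test function, the flow can be moved from `u` to `φ` by measure preservation; the
fundamental theorem of calculus for the smooth `φ` and the weak formulation `hweak` then produce the
line integral of `g`. Treating translations and shears at once is the reason for a general field
`X`. -/
theorem lineFlow_identity {n : ℕ} {u : Space n → ℝ} {g : Space n → Space n}
    (hu : MemLp u 2 volume) (hg : MemLp g 2 volume)
    {X : Space n → Space n} (hX : ContDiff ℝ ∞ X)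
    (hXX : ∀ (σ : ℝ) y, X (y + σ • X y) = X y)
    (hmp : ∀ σ : ℝ, MeasurePreserving (fun y => y + σ • X y) volume volume)
    {V : Set (Space n)} (hV : IsOpen V)
    (hweak : ∀ σ ∈ Icc (0 : ℝ) 1, ∀ φ : Space n → ℝ, ContDiff ℝ ∞ φ → HasCompactSupport φ →
      tsupport φ ⊆ V →
      ∫ y, u y * fderiv ℝ φ (y - σ • X y) (X y) = -∫ y, inner ℝ (X y) (g y) * φ (y - σ • X y)) :
    ∀ᵐ y, y ∈ V → u (y + X y) - u y = ∫ σ in (0 : ℝ)..1, inner ℝ (X y) (g (y + σ • X y)) := by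
  have hXc := hX.continuous
  have hXn : ∀ (σ : ℝ) y, X (y - σ • X y) = X y := fun σ y => by
    have := hXX (-σ) y; rwa [neg_smul, ← sub_eq_add_neg] at this
  have hmpn : ∀ σ : ℝ, MeasurePreserving (fun y => y - σ • X y) volume volume := fun σ => by
    have := hmp (-σ); simpa only [neg_smul, ← sub_eq_add_neg] using this
  set I : Measure ℝ := volume.restrict (Ioc (0 : ℝ) 1) with hI
  have : IsFiniteMeasure I := by rw [hI]; infer_instance
  have hgp := memLp_comp_lineFlow hXc hmp I (c := 1) hg
  simp only [one_mul] at hgp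
  have hup : MemLp (fun y => u (y + X y)) 2 volume := by
    have := hu.comp_measurePreserving (hmp 1)
    simpa [Function.comp_def] using this
  -- integrability of the line integral against compactly supported functions
  have hint : ∀ c : Space n → ℝ, Continuous c → HasCompactSupport c →
      Integrable (fun p : Space n × ℝ => c p.1 * inner ℝ (X p.1) (g (p.1 + p.2 • X p.1)))
        (volume.prod I) := by
    intro c hc hcs
    have h1 : MemLp (fun y => c y • X y) 2 volume :=
      (by fun_prop : Continuous fun y => c y • X y).memLp_of_hasCompactSupport
        (hcs.smul_right)
    have h2 := h1.comp_fst I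
    have h3 := h2.norm.integrable_mul hgp.norm (p := 2) (q := 2)
    refine h3.mono' ?_ (ae_of_all _ fun p => ?_)
    · have : (fun p : Space n × ℝ => c p.1 * inner ℝ (X p.1) (g (p.1 + p.2 • X p.1)))
        = fun p => inner ℝ (c p.1 • X p.1) (g (p.1 + p.2 • X p.1)) := by
        ext p; rw [real_inner_smul_left]
      rw [this]
      exact h2.1.inner hgp.1
    · rw [← real_inner_smul_left]
      exact (norm_inner_le_norm _ _)
  have hloc : LocallyIntegrable (fun y => u (y + X y) - u y
      - ∫ σ in (0 : ℝ)..1, inner ℝ (X y) (g (y + σ • X y))) volume := by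
    refine ((hup.locallyIntegrable (by norm_num)).sub (hu.locallyIntegrable (by norm_num))).sub ?_
    rw [locallyIntegrable_iff]
    intro K hK
    obtain ⟨c, hc, hcs, hcK⟩ : ∃ c : Space n → ℝ, Continuous c ∧ HasCompactSupport c ∧
        ∀ y ∈ K, c y = 1 := by
      obtain ⟨c, hc1, -, hcs, -⟩ := exists_continuous_one_zero_of_isCompact hK
        (isClosed_empty (X := Space n)) (disjoint_empty _)
      exact ⟨c, c.continuous, hcs, fun y hy => hc1 hy⟩
    have h1 := (hint c hc hcs).integral_prod_left
    refine (h1.integrableOn (s := K)).congr_fun (fun y hy => ?_) hK.measurableSet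
    simp only [hcK y hy, one_mul]
    rw [intervalIntegral.integral_of_le zero_le_one]
  have key := hV.ae_eq_zero_of_integral_contDiff_smul_eq_zero (μ := volume)
    (hloc.locallyIntegrableOn V) (fun φ hφ hφc hφV => ?_)
  · filter_upwards [key] with y hy hyV
    have := hy hyV
    linarith
  have hφcont := hφ.continuous
  have hφ2 : MemLp φ 2 volume := hφcont.memLp_of_hasCompactSupport hφc
  have hdiff : Continuous fun y => fderiv ℝ φ y (X y) :=
    (hφ.continuous_fderiv (by simp)).clm_apply hXc
  set χ : Space n → ℝ := fun y => fderiv ℝ φ y (X y) with hχ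
  have hχc : HasCompactSupport χ := by
    refine (hφc.fderiv (𝕜 := ℝ)).mono ?_
    intro y hy
    simp only [Function.mem_support, hχ] at hy ⊢
    intro h0; rw [h0] at hy; simp at hy
  have hχ2 : MemLp χ 2 volume := hdiff.memLp_of_hasCompactSupport hχc
  -- translation of the first term
  have e1 : ∫ y, φ y * u (y + X y) = ∫ y, φ (y - X y) * u y := by
    have := integral_comp_lineFlow hXc hXX hmp 1 (fun y => φ (y - X y) * u y)
    rw [← this]
    refine integral_congr_ae (ae_of_all _ fun y => ?_)
    have h := hXX 1 y
    simp only [one_smul] at h ⊢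
    rw [h, add_sub_cancel_right]
  have e2 : ∀ y, φ (y - X y) - φ y = -∫ σ in (0 : ℝ)..1, χ (y - σ • X y) := by
    intro y
    have hd : ∀ σ : ℝ, HasDerivAt (fun σ : ℝ => φ (y - σ • X y)) (-χ (y - σ • X y)) σ := by
      intro σ
      have h1 : HasDerivAt (fun σ : ℝ => y - σ • X y) (-X y) σ := by
        simpa using ((hasDerivAt_id σ).smul_const (X y)).const_sub y
      have h2 := (hφ.differentiable (by simp) (y - σ • X y)).hasFDerivAt.comp_hasDerivAt σ h1
      simp only [map_neg] at h2
      simp only [hχ, hXn]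
      exact h2
    have h3 := intervalIntegral.integral_eq_sub_of_hasDerivAt (a := 0) (b := 1)
      (fun σ _ => hd σ) (by
        apply Continuous.intervalIntegrable
        have : Continuous fun σ : ℝ => χ (y - σ • X y) := hdiff.comp (by fun_prop)
        exact this.neg)
    simp only [intervalIntegral.integral_neg, one_smul, zero_smul, sub_zero] at h3
    rw [h3]
  have hχp : MemLp (fun p : Space n × ℝ => χ (p.1 - p.2 • X p.1)) 2 (volume.prod I) := by
    have := memLp_comp_lineFlow hXc hmp I (c := -1) hχ2
    simpa only [neg_mul, one_mul, neg_smul, ← sub_eq_add_neg] using this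
  have iA : Integrable (fun p : Space n × ℝ => u p.1 * χ (p.1 - p.2 • X p.1)) (volume.prod I) :=
    (hu.comp_fst I).integrable_mul hχp (p := 2) (q := 2)
  have iφup : Integrable (fun y => φ y * u (y + X y)) := hφ2.integrable_mul hup (p := 2) (q := 2)
  have iφu : Integrable (fun y => φ y * u y) := hφ2.integrable_mul hu (p := 2) (q := 2)
  have iφn : Integrable (fun y => φ (y - X y) * u y) := by
    have h := hφ2.comp_measurePreserving (hmpn 1)
    have h' : MemLp (fun y => φ (y - X y)) 2 volume := by simpa [Function.comp_def] using h
    exact h'.integrable_mul hu (p := 2) (q := 2)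
  have e3 : (∫ y, φ y * u (y + X y)) - ∫ y, φ y * u y
      = ∫ y, φ y * ∫ σ in (0 : ℝ)..1, inner ℝ (X y) (g (y + σ • X y)) := by
    calc _ = ∫ y, (φ (y - X y) - φ y) * u y := by
          rw [e1, ← integral_sub iφn iφu]; simp only [sub_mul]
      _ = -∫ y, ∫ σ, u y * χ (y - σ • X y) ∂I := by
          rw [← integral_neg]
          refine integral_congr_ae (ae_of_all _ fun y => ?_)
          simp only
          rw [e2, intervalIntegral.integral_of_le zero_le_one, integral_const_mul]
          ring
      _ = -∫ σ, (∫ y, u y * χ (y - σ • X y)) ∂I := by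
          rw [integral_integral_swap iA]
      _ = ∫ σ, (∫ y, φ y * inner ℝ (X y) (g (y + σ • X y))) ∂I := by
          rw [← integral_neg]
          refine setIntegral_congr_fun measurableSet_Ioc (fun σ hσ => ?_)
          have h1 := hweak σ ⟨hσ.1.le, hσ.2⟩ φ hφ hφc hφV
          have h2 := integral_comp_lineFlow hXc hXX hmp σ
            (fun y => inner ℝ (X y) (g y) * φ (y - σ • X y))
          simp only [hχ, hXn]
          rw [h1, neg_neg, ← h2]
          refine integral_congr_ae (ae_of_all _ fun y => ?_)
          simp only [hXX, add_sub_cancel_right]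
          ring
      _ = ∫ y, ∫ σ, φ y * inner ℝ (X y) (g (y + σ • X y)) ∂I := by
          rw [integral_integral_swap]
          exact (hint φ hφcont hφc).swap
      _ = _ := by
          refine integral_congr_ae (ae_of_all _ fun y => ?_)
          simp only
          rw [integral_const_mul, intervalIntegral.integral_of_le zero_le_one]
  have iL : Integrable (fun y => φ y * ∫ σ in (0 : ℝ)..1, inner ℝ (X y) (g (y + σ • X y))) := by
    have h1 := (hint φ hφcont hφc).integral_prod_left
    refine h1.congr (ae_of_all _ fun y => ?_)
    simp only
    rw [integral_const_mul, intervalIntegral.integral_of_le zero_le_one]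
  simp only [smul_eq_mul, mul_sub]
  have e4 := integral_sub (iφup.sub iφu) iL
  simp only [Pi.sub_apply] at e4
  rw [e4, integral_sub iφup iφu, e3, sub_self]

/-- `u ∈ H¹(Ω)` with weak gradient `g`, both extended by zero outside `Ω`. -/
structure IsWeakGrad {n : ℕ} (u : Space n → ℝ) (g : Space n → Space n) : Prop where
  memLp : MemLp u 2 volume
  memLp_grad : MemLp g 2 volume
  zero : ∀ x ∉ upperHalf n, u x = 0
  grad_zero : ∀ x ∉ upperHalf n, g x = 0
  weak : ∀ i, HasWeakPartial i u (fun x => g x i)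

theorem continuous_coord {n : ℕ} (i : Fin (n + 1)) : Continuous fun x : Space n => x i := by
  fun_prop

/-- The last coordinate, as a continuous linear form. -/
noncomputable def lastCoord (n : ℕ) : Space n →L[ℝ] ℝ := EuclideanSpace.proj (Fin.last n)

theorem isOpen_upperHalf (n : ℕ) : IsOpen (upperHalf n) :=
  isOpen_lt continuous_const (continuous_coord _)

theorem measurableSet_upperHalf (n : ℕ) : MeasurableSet (upperHalf n) :=
  (isOpen_upperHalf n).measurableSet

theorem sum_smul_basisVec {n : ℕ} (w : Space n) : ∑ i, w i • basisVec n i = w := by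
  have := (EuclideanSpace.basisFun (Fin (n + 1)) ℝ).sum_repr w
  simpa [basisVec] using this

theorem integral_volHalf_eq {n : ℕ} {f : Space n → ℝ} (h : ∀ x ∉ upperHalf n, f x = 0) :
    ∫ x, f x ∂(volHalf n) = ∫ x, f x := by
  rw [volHalf]
  exact setIntegral_eq_integral_of_forall_compl_eq_zero h

theorem IsWeakGrad.integral_fderiv {n : ℕ} {u : Space n → ℝ} {g : Space n → Space n}
    (h : IsWeakGrad u g) (w : Space n) {φ : Space n → ℝ} (hφ : ContDiff ℝ ∞ φ)
    (hφc : HasCompactSupport φ) (hφs : tsupport φ ⊆ upperHalf n) :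
    ∫ y, u y * fderiv ℝ φ y w = -∫ y, inner ℝ w (g y) * φ y := by
  have hφ2 : MemLp φ 2 volume := hφ.continuous.memLp_of_hasCompactSupport hφc
  have hc : ∀ i, MemLp (fun y => fderiv ℝ φ y (basisVec n i)) 2 volume := fun i =>
    ((hφ.continuous_fderiv (by simp)).clm_apply continuous_const).memLp_of_hasCompactSupport
      (hφc.fderiv_apply ℝ _)
  have hw : ∀ i, ∫ y, u y * fderiv ℝ φ y (basisVec n i) = -∫ y, g y i * φ y := fun i => by
    have := h.weak i φ hφ hφc hφs
    rwa [integral_volHalf_eq (fun x hx => by rw [h.zero x hx, zero_mul]),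
      integral_volHalf_eq (fun x hx => by simp [h.grad_zero x hx])] at this
  have hg : ∀ i, MemLp (fun y => g y i) 2 volume := fun i => by
    refine h.memLp_grad.norm.mono ?_ (ae_of_all _ fun y => ?_)
    · exact (continuous_coord i).comp_aestronglyMeasurable h.memLp_grad.1
    · simpa using PiLp.norm_apply_le (g y) i
  calc ∫ y, u y * fderiv ℝ φ y w
      = ∫ y, ∑ i, w i * (u y * fderiv ℝ φ y (basisVec n i)) := by
        refine integral_congr_ae (ae_of_all _ fun y => ?_)
        simp only
        conv_lhs => rw [← sum_smul_basisVec w]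
        simp only [map_sum, map_smul, smul_eq_mul, Finset.mul_sum]
        exact Finset.sum_congr rfl fun i _ => by ring
    _ = ∑ i, w i * ∫ y, u y * fderiv ℝ φ y (basisVec n i) := by
        rw [integral_finsetSum]
        · simp only [integral_const_mul]
        · exact fun i _ => (h.memLp.integrable_mul (hc i)).const_mul (w i)
    _ = -∑ i, w i * ∫ y, g y i * φ y := by
        simp only [hw, mul_neg, Finset.sum_neg_distrib]
    _ = -∫ y, ∑ i, w i * (g y i * φ y) := by
        rw [integral_finsetSum]
        · simp only [integral_const_mul]
        · exact fun i _ => ((hg i).integrable_mul hφ2).const_mul (w i)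
    _ = _ := by
        congr 1
        refine integral_congr_ae (ae_of_all _ fun y => ?_)
        simp only [PiLp.inner_apply, RCLike.inner_apply, conj_trivial, Finset.sum_mul]
        exact Finset.sum_congr rfl fun i _ => by ring

/-- A Sobolev function is the integral of its gradient along almost every line of direction `w`. -/
theorem IsWeakGrad.translate {n : ℕ} {u : Space n → ℝ} {g : Space n → Space n}
    (h : IsWeakGrad u g) (w : Space n) :
    ∀ᵐ y, y ∈ upperHalf n → y + w ∈ upperHalf n →
      u (y + w) - u y = ∫ σ in (0 : ℝ)..1, inner ℝ w (g (y + σ • w)) := by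
  have hV : IsOpen (upperHalf n ∩ (fun y => y + w) ⁻¹' upperHalf n) :=
    (isOpen_upperHalf n).inter ((isOpen_upperHalf n).preimage (by fun_prop))
  have := lineFlow_identity h.memLp h.memLp_grad (X := fun _ => w) contDiff_const
    (fun _ _ => rfl) (fun σ => measurePreserving_add_right volume (σ • w)) hV ?_
  · filter_upwards [this] with y hy h1 h2 using hy ⟨h1, h2⟩
  intro σ hσ φ hφ hφc hφs
  have h1 := h.integral_fderiv w (φ := fun y => φ (y - σ • w)) (by fun_prop)
    (hφc.comp_homeomorph (Homeomorph.subRight (σ • w))) ?_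
  · rw [← h1]
    refine integral_congr_ae (ae_of_all _ fun y => ?_)
    simp only
    rw [fderiv_comp_sub]
  · intro y hy
    have h2 : y - σ • w ∈ tsupport φ :=
      tsupport_comp_subset_preimage φ (f := fun y => y - σ • w) (by fun_prop) hy
    obtain ⟨h3, h4⟩ := hφs h2
    simp only [mem_preimage, upperHalf, mem_ofPred_eq, PiLp.sub_apply, PiLp.smul_apply,
      PiLp.add_apply, smul_eq_mul] at h3 h4 ⊢
    -- With `z = y - σw`, both `z` and `z + w` have positive height, hence so does `y`, which lies
    -- on the segment between them.
    rcases le_total 0 (w (Fin.last n)) with hw | hw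
    · nlinarith [mul_nonneg hσ.1 hw]
    · nlinarith [mul_nonneg (sub_nonneg.2 hσ.2) (neg_nonneg.2 hw)]

/-- The map is a transvection, of determinant `1` because `ζ` is tangential. -/
theorem measurePreserving_shear {n : ℕ} {ζ : Space n} (hζ : ζ (Fin.last n) = 0) (σ : ℝ) :
    MeasurePreserving (fun y : Space n => y + σ • (y (Fin.last n) • ζ)) volume volume := by
  have hd := LinearMap.transvection.det
    (lastCoord n).toLinearMap (σ • ζ)
  have h0 : (lastCoord n).toLinearMap (σ • ζ) = 0 := by
    simp [lastCoord, hζ]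
  rw [h0, add_zero] at hd
  refine ⟨by fun_prop, ?_⟩
  have h1 := Measure.map_linearMap_addHaar_eq_smul_addHaar (volume : Measure (Space n))
    (f := LinearMap.transvection _ (σ • ζ)) (by rw [hd]; exact one_ne_zero)
  rw [hd] at h1
  simp only [inv_one, abs_one, ENNReal.ofReal_one, one_smul] at h1
  convert h1 using 2
  ext y
  simp [lastCoord, LinearMap.transvection.apply, smul_smul, mul_comm]

/-- The analogue of `IsWeakGrad.translate` along the tangential shear `y ↦ y + y_N ζ`. -/
theorem IsWeakGrad.shear {n : ℕ} {u : Space n → ℝ} {g : Space n → Space n}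
    (h : IsWeakGrad u g) {ζ : Space n} (hζ : ζ (Fin.last n) = 0) :
    ∀ᵐ y, y ∈ upperHalf n →
      u (y + y (Fin.last n) • ζ) - u y
        = ∫ σ in (0 : ℝ)..1, inner ℝ (y (Fin.last n) • ζ) (g (y + σ • (y (Fin.last n) • ζ))) := by
  refine lineFlow_identity h.memLp h.memLp_grad (X := fun y => y (Fin.last n) • ζ) (by fun_prop)
    (fun σ y => by simp [hζ]) (measurePreserving_shear hζ) (isOpen_upperHalf n) ?_
  intro σ _ φ hφ hφc hφs
  have hs : ContDiff ℝ ∞ fun y : Space n => φ (y - σ • (y (Fin.last n) • ζ)) := by fun_prop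
  set ψ : Space n → ℝ := fun y => φ (y - σ • (y (Fin.last n) • ζ)) with hψ
  have hcs : HasCompactSupport ψ := by
    have := hφc.comp_homeomorph (lineFlow (n := n) (fun y => y (Fin.last n) • ζ) (by fun_prop)
      (fun σ y => by simp [hζ]) σ).symm
    exact this
  -- The coefficient `y_N` of the field is put into the test function; it is constant in the
  -- direction `ζ`, and so is the transport `σ y_N ζ`, so the derivative falls on `φ` alone.
  have h1 := h.integral_fderiv ζ (φ := fun y => y (Fin.last n) * ψ y) (by fun_prop)
    hcs.mul_left ?_
  · have e1 : ∀ y, fderiv ℝ (fun y : Space n => y (Fin.last n) * ψ y) y ζ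
        = fderiv ℝ φ (y - σ • (y (Fin.last n) • ζ)) (y (Fin.last n) • ζ) := by
      intro y
      have hp : HasFDerivAt (fun y : Space n => y (Fin.last n))
          (lastCoord n) y :=
        (lastCoord n).hasFDerivAt
      have h2 : HasFDerivAt (fun y : Space n => y - σ • (y (Fin.last n) • ζ)) _ y :=
        (hasFDerivAt_id y).sub ((hp.smul_const ζ).const_smul σ)
      have h3 := (hφ.differentiable (by simp)
        (y - σ • (y (Fin.last n) • ζ))).hasFDerivAt.comp y h2
      have h4 := (hp.mul h3).fderiv
      rw [show (fun y : Space n => y (Fin.last n) * ψ y) = (fun y : Space n => y (Fin.last n)) *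
        (φ ∘ fun y : Space n => y - σ • (y (Fin.last n) • ζ)) from rfl, h4]
      simp [lastCoord, hζ]
    simp only [e1] at h1
    rw [h1]
    congr 1
    refine integral_congr_ae (ae_of_all _ fun y => ?_)
    simp only [hψ]
    rw [real_inner_smul_left]; ring
  · intro y hy
    have h2 : y ∈ tsupport ψ := closure_mono (Function.support_mul_subset_right _ _) hy
    have h3 : y - σ • (y (Fin.last n) • ζ) ∈ tsupport φ :=
      tsupport_comp_subset_preimage φ (f := fun y : Space n => y - σ • (y (Fin.last n) • ζ))
        (by fun_prop) h2
    have h4 := hφs h3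
    simpa [upperHalf, hζ] using h4

/-! ### Square-integral inequalities -/

theorem eLpNorm_two_sq {α F : Type*} [MeasurableSpace α] [NormedAddCommGroup F] (f : α → F)
    (μ : Measure α) : eLpNorm f 2 μ ^ 2 = ∫⁻ x, ‖f x‖ₑ ^ 2 ∂μ := by
  have := eLpNorm_nnreal_pow_eq_lintegral (f := f) (μ := μ) (p := 2) (by norm_num)
  simpa using this

theorem lintegral_mul_sq_le {α : Type*} [MeasurableSpace α] (μ : Measure α) {f g : α → ℝ≥0∞}
    (hf : AEMeasurable f μ) (hg : AEMeasurable g μ) {a b : ℝ≥0∞}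
    (ha : ∫⁻ x, f x ^ 2 ∂μ ≤ a ^ 2) (hb : ∫⁻ x, g x ^ 2 ∂μ ≤ b ^ 2) :
    ∫⁻ x, f x * g x ∂μ ≤ a * b := by
  have h := ENNReal.lintegral_mul_le_Lp_mul_Lq μ Real.HolderConjugate.two_two hf hg
  have hr : ∀ c : ℝ≥0∞, (c ^ 2) ^ (1 / 2 : ℝ) = c := fun c => by
    rw [← ENNReal.rpow_natCast, ← ENNReal.rpow_mul]; norm_num
  refine h.trans ?_
  simp only [ENNReal.rpow_ofNat]
  refine mul_le_mul' ?_ ?_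
  · exact (ENNReal.rpow_le_rpow ha (by norm_num)).trans (hr a).le
  · exact (ENNReal.rpow_le_rpow hb (by norm_num)).trans (hr b).le

/-- Minkowski's integral inequality in `L²`. -/
theorem lintegral_lintegral_sq_le {α β : Type*} [MeasurableSpace α] [MeasurableSpace β]
    (μ : Measure α) (ν : Measure β) [SFinite μ] [SFinite ν] {f : α → β → ℝ≥0∞}
    (hf : Measurable (Function.uncurry f)) {m : β → ℝ≥0∞} (hm : Measurable m) {M : ℝ≥0∞}
    (h : ∀ᵐ w ∂ν, ∫⁻ x, f x w ^ 2 ∂μ ≤ (m w * M) ^ 2) :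
    ∫⁻ x, (∫⁻ w, f x w ∂ν) ^ 2 ∂μ ≤ ((∫⁻ w, m w ∂ν) * M) ^ 2 := by
  have hf1 : ∀ x, Measurable (f x) := fun x => hf.comp measurable_prodMk_left
  have hf2 : ∀ w, Measurable fun x => f x w := fun w => hf.comp measurable_prodMk_right
  -- Expand the square as a double integral over `w, w'`, integrate in `x` first, and apply
  -- Cauchy–Schwarz to each product.
  calc ∫⁻ x, (∫⁻ w, f x w ∂ν) ^ 2 ∂μ
      = ∫⁻ x, ∫⁻ w, ∫⁻ w', f x w * f x w' ∂ν ∂ν ∂μ := by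
        refine lintegral_congr fun x => ?_
        rw [sq, ← lintegral_mul_const _ (hf1 x)]
        exact lintegral_congr fun w => (lintegral_const_mul _ (hf1 x)).symm
    _ = ∫⁻ w, ∫⁻ x, ∫⁻ w', f x w * f x w' ∂ν ∂μ ∂ν := by
        refine lintegral_lintegral_swap (Measurable.aemeasurable ?_)
        refine Measurable.lintegral_prod_right'
          (f := fun q : (α × β) × β => f q.1.1 q.1.2 * f q.1.1 q.2) ?_
        exact (hf.comp (by fun_prop : Measurable fun q : (α × β) × β => (q.1.1, q.1.2))).mul
          (hf.comp (by fun_prop : Measurable fun q : (α × β) × β => (q.1.1, q.2)))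
    _ = ∫⁻ w, ∫⁻ w', ∫⁻ x, f x w * f x w' ∂μ ∂ν ∂ν := by
        refine lintegral_congr fun w => ?_
        refine lintegral_lintegral_swap (Measurable.aemeasurable ?_)
        exact ((hf2 w).comp measurable_fst).mul hf
    _ ≤ ∫⁻ w, ∫⁻ w', (m w * M) * (m w' * M) ∂ν ∂ν := by
        refine lintegral_mono_ae ?_
        filter_upwards [h] with w hw
        refine lintegral_mono_ae ?_
        filter_upwards [h] with w' hw'
        exact lintegral_mul_sq_le μ (hf2 w).aemeasurable (hf2 w').aemeasurable hw hw'
    _ = _ := by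
        simp only [lintegral_const_mul _ (hm.mul_const M), lintegral_mul_const _ hm,
          lintegral_mul_const _ (hm.mul_const M), sq]

theorem enorm_integral_sq_le {α F : Type*} [MeasurableSpace α] [NormedAddCommGroup F]
    [NormedSpace ℝ F] (μ : Measure α) [IsProbabilityMeasure μ] {f : α → F}
    (hf : AEStronglyMeasurable f μ) :
    ‖∫ x, f x ∂μ‖ₑ ^ 2 ≤ ∫⁻ x, ‖f x‖ₑ ^ 2 ∂μ := by
  rw [← eLpNorm_two_sq]
  refine pow_le_pow_left' ((enorm_integral_le_lintegral_enorm f).trans ?_) 2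
  rw [← eLpNorm_one_eq_lintegral_enorm]
  exact eLpNorm_le_eLpNorm_of_exponent_le (by norm_num) hf

theorem isProbabilityMeasure_unit : IsProbabilityMeasure (volume.restrict (Ioc (0 : ℝ) 1)) :=
  ⟨by simp⟩

theorem enorm_unitIntegral_inner_sq_le {n : ℕ} (w : Space n) {f : ℝ → Space n}
    (hf : Measurable f) :
    ‖∫ σ in (0 : ℝ)..1, inner ℝ w (f σ)‖ₑ ^ 2
      ≤ ‖w‖ₑ ^ 2 * ∫⁻ σ in Ioc (0 : ℝ) 1, ‖f σ‖ₑ ^ 2 := by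
  have := isProbabilityMeasure_unit
  rw [intervalIntegral.integral_of_le zero_le_one]
  refine (enorm_integral_sq_le _
    (measurable_const.inner hf).aestronglyMeasurable).trans ?_
  rw [← lintegral_const_mul _ (by fun_prop)]
  refine lintegral_mono fun σ => ?_
  rw [← mul_pow]
  refine pow_le_pow_left' ?_ 2
  rw [← enorm_norm w, ← enorm_norm (f σ), ← enorm_mul]
  exact enorm_le_iff_norm_le.2 (by simpa using norm_inner_le_norm (𝕜 := ℝ) w (f σ))

/-! ### A jointly measurable gradient -/

theorem abs_coord_le_norm {n : ℕ} (x : Space n) (i : Fin (n + 1)) : |x i| ≤ ‖x‖ :=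
  PiLp.norm_apply_le x i

/-- The bump centred at `x` is an admissible test function as soon as its radius is below the height
of `x`. -/
theorem IsWeakGrad.integral_bump {n : ℕ} {u : Space n → ℝ} {g : Space n → Space n}
    (h : IsWeakGrad u g) (b : ContDiffBump (0 : Space n)) {x : Space n}
    (hx : b.rOut < x (Fin.last n)) (i : Fin (n + 1)) :
    ∫ y, u y * fderiv ℝ (b.normed volume) (x - y) (basisVec n i)
      = convolution (b.normed volume) (fun y => g y i)
        (ContinuousLinearMap.lsmul ℝ ℝ) volume x := by
  have hb : ContDiff ℝ ∞ (b.normed volume) := b.contDiff_normed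
  have h1 := h.integral_fderiv (basisVec n i) (φ := fun y => b.normed volume (x - y))
    (by fun_prop) (b.hasCompactSupport_normed.comp_homeomorph (Homeomorph.subLeft x)) ?_
  · have hd : ∀ y, fderiv ℝ (fun y => b.normed volume (x - y)) y (basisVec n i)
        = -fderiv ℝ (b.normed volume) (x - y) (basisVec n i) := fun y => by
      have h2 := (hb.differentiable (by simp) (x - y)).hasFDerivAt.comp y
        ((hasFDerivAt_id y).const_sub x)
      have h3 := h2.fderiv
      rw [show (fun y => b.normed volume (x - y)) = b.normed volume ∘ HSub.hSub x from rfl, h3]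
      simp
    rw [convolution_eq_swap]
    simp only [hd, mul_neg, integral_neg, neg_inj] at h1
    rw [h1]
    refine integral_congr_ae (ae_of_all _ fun y => ?_)
    simp only [basisVec, EuclideanSpace.inner_single_left, ContinuousLinearMap.lsmul_apply,
      smul_eq_mul, map_one, one_mul]
    ring
  · intro y hy
    have h2 := tsupport_comp_subset_preimage (b.normed volume) (f := fun y => x - y)
      (by fun_prop) hy
    rw [mem_preimage, b.tsupport_normed_eq, mem_closedBall_zero_iff] at h2
    have h3 := (abs_le.1 ((abs_coord_le_norm (x - y) (Fin.last n)).trans h2)).2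
    simp only [PiLp.sub_apply] at h3
    change 0 < y (Fin.last n)
    linarith

/-- A sequence of mollifiers on `Space n` shrinking to the origin. -/
noncomputable def shrinkingBump (n k : ℕ) : ContDiffBump (0 : Space n) where
  rIn := 1 / (2 * (k + 1))
  rOut := 1 / (k + 1)
  rIn_pos := by positivity
  rIn_lt_rOut := by
    have : (0 : ℝ) < k + 1 := by positivity
    exact one_div_lt_one_div_of_lt this (by linarith)

open Classical in
/-- The pointwise gradient in `x` of a function of `(t, x)`, as a limit of mollifications. -/
noncomputable def mollifiedGrad {n : ℕ} (U : ℝ × Space n → ℝ) (p : ℝ × Space n) : Space n :=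
  if p.2 ∈ upperHalf n then
    WithLp.toLp 2 fun i => limsup (fun k => ∫ y, U (p.1, y) *
      fderiv ℝ ((shrinkingBump n k).normed volume) (p.2 - y) (basisVec n i)) atTop
  else 0

theorem measurable_mollifiedGrad {n : ℕ} {U : ℝ × Space n → ℝ} (hU : Measurable U) :
    Measurable (mollifiedGrad U) := by
  unfold mollifiedGrad
  refine Measurable.ite ((measurableSet_upperHalf n).preimage measurable_snd) ?_ measurable_const
  refine (WithLp.measurable_toLp 2 _).comp (measurable_pi_lambda _ fun i => ?_)
  refine Measurable.limsup fun k => ?_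
  have hc : Continuous (fderiv ℝ ((shrinkingBump n k).normed (volume : Measure (Space n)))) :=
    ((shrinkingBump n k).contDiff_normed (n := 1)).continuous_fderiv (by simp)
  refine (StronglyMeasurable.integral_prod_right'
    (f := fun q : (ℝ × Space n) × Space n => U (q.1.1, q.2) *
      fderiv ℝ ((shrinkingBump n k).normed volume) (q.1.2 - q.2) (basisVec n i)) ?_).measurable
  refine Measurable.stronglyMeasurable (Measurable.mul ?_ ?_)
  · exact hU.comp (by fun_prop)
  · have : Continuous fun q : (ℝ × Space n) × Space n =>
        fderiv ℝ ((shrinkingBump n k).normed volume) (q.1.2 - q.2) (basisVec n i) :=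
      (hc.comp (by fun_prop)).clm_apply continuous_const
    exact this.measurable

/-- The mollifications of `g` converge to `g` almost everywhere by Lebesgue differentiation, and at
a point of `Ω` they eventually coincide with integrals of `U` alone. This recovers the gradient by a
formula that is measurable in `(t, x)`. -/
theorem IsWeakGrad.mollifiedGrad_eq {n : ℕ} {U : ℝ × Space n → ℝ} {t : ℝ}
    {g : Space n → Space n} (h : IsWeakGrad (fun x => U (t, x)) g) :
    ∀ᵐ x, mollifiedGrad U (t, x) = g x := by
  have hr : Tendsto (fun k => (shrinkingBump n k).rOut) atTop (𝓝 0) :=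
    tendsto_one_div_add_atTop_nhds_zero_nat
  have h1 : ∀ i, ∀ᵐ x, Tendsto (fun k => convolution ((shrinkingBump n k).normed volume)
      (fun y => g y i) (ContinuousLinearMap.lsmul ℝ ℝ) volume x) atTop (𝓝 (g x i)) := fun i => by
    refine ContDiffBump.ae_convolution_tendsto_right_of_locallyIntegrable (K := 2) hr
      (Eventually.of_forall fun k => ?_) ?_
    · simp only [shrinkingBump]
      have : (0 : ℝ) < k + 1 := by positivity
      apply le_of_eq; field_simp
    · refine MemLp.locallyIntegrable (p := 2) (h.memLp_grad.norm.mono ?_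
        (ae_of_all _ fun y => ?_)) (by norm_num)
      · exact (continuous_coord i).comp_aestronglyMeasurable h.memLp_grad.1
      · simpa using PiLp.norm_apply_le (g y) i
  filter_upwards [ae_all_iff.2 h1] with x hx
  unfold mollifiedGrad
  split_ifs with hxΩ
  · ext i
    refine Tendsto.limsup_eq ((hx i).congr' ?_)
    filter_upwards [hr.eventually_lt_const (show (0 : ℝ) < x (Fin.last n) from hxΩ)] with k hk
    exact (h.integral_bump _ hk i).symm
  · exact (h.grad_zero x hxΩ).symm

theorem HasWeakPartial.congr {n : ℕ} {i : Fin (n + 1)} {u u' v v' : Space n → ℝ}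
    (h : HasWeakPartial i u v) (hu : u' =ᵐ[volHalf n] u) (hv : v' =ᵐ[volHalf n] v) :
    HasWeakPartial i u' v' := by
  intro φ h1 h2 h3
  have := h φ h1 h2 h3
  rw [integral_congr_ae (g := fun x => u x * fderiv ℝ φ x (basisVec n i))
      (hu.mono fun x hx => by simp only [hx]),
    integral_congr_ae (f := fun x => v' x * φ x) (g := fun x => v x * φ x) (hv.mono fun x hx => by simp only [hx])]
  exact this

/-- A vector field with components in `L²(Ω)`, extended by zero. -/
noncomputable def zeroExtField {n : ℕ} (G : Fin (n + 1) → Space n → ℝ) (x : Space n) : Space n :=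
  (upperHalf n).indicator (fun x => WithLp.toLp 2 fun i => G i x) x

theorem measurable_zeroExtField {n : ℕ} {G : Fin (n + 1) → Space n → ℝ}
    (hG : ∀ i, Measurable (G i)) : Measurable (zeroExtField G) :=
  ((WithLp.measurable_toLp 2 _).comp (measurable_pi_lambda _ hG)).indicator
    (measurableSet_upperHalf n)

theorem zeroExtField_ae {n : ℕ} (G : Fin (n + 1) → Space n → ℝ) (i : Fin (n + 1)) :
    (fun x => zeroExtField G x i) =ᵐ[volHalf n] G i := by
  filter_upwards [ae_restrict_mem (measurableSet_upperHalf n)] with x hx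
  simp [zeroExtField, indicator_of_mem hx]

theorem enorm_sq_eq_sum {n : ℕ} (x : Space n) : ‖x‖ₑ ^ 2 = ∑ i, ‖x i‖ₑ ^ 2 := by
  have h := EuclideanSpace.norm_sq_eq x
  have e : ∀ {F : Type} [NormedAddCommGroup F] (z : F), ‖z‖ₑ ^ 2 = ENNReal.ofReal (‖z‖ ^ 2) :=
    fun z => by rw [← ofReal_norm, ENNReal.ofReal_pow (norm_nonneg _)]
  rw [e, h, ENNReal.ofReal_sum_of_nonneg (fun i _ => by positivity)]
  exact Finset.sum_congr rfl fun i _ => (e _).symm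

theorem memLp_zeroExtField {n : ℕ} {G : Fin (n + 1) → Space n → ℝ}
    (hG : ∀ i, MemLp (G i) 2 (volHalf n)) : MemLp (zeroExtField G) 2 volume := by
  have : MemLp (fun x => WithLp.toLp 2 fun i => G i x : Space n → Space n) 2 (volHalf n) := by
    rw [memLp_piLp_iff]
    exact hG
  exact (memLp_indicator_iff_restrict (measurableSet_upperHalf n)).2 this

theorem lintegral_zeroExtField_sq {n : ℕ} {G : Fin (n + 1) → Space n → ℝ}
    (hG : ∀ i, MemLp (G i) 2 (volHalf n)) :
    ∫⁻ x, ‖zeroExtField G x‖ₑ ^ 2 = ∑ i, eLpNorm (G i) 2 (volHalf n) ^ 2 := by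
  have h1 : ∀ x, ‖zeroExtField G x‖ₑ ^ 2
      = (upperHalf n).indicator (fun x => ∑ i, ‖G i x‖ₑ ^ 2) x := fun x => by
    by_cases hx : x ∈ upperHalf n
    · rw [zeroExtField, indicator_of_mem hx, indicator_of_mem hx, enorm_sq_eq_sum]
    · simp [zeroExtField, indicator_of_notMem hx]
  simp only [h1, eLpNorm_two_sq]
  rw [lintegral_indicator (measurableSet_upperHalf n),
    lintegral_finsetSum' _ fun i _ => ?_]
  · rfl
  · exact (hG i).1.enorm.pow_const 2

instance sFinite_volHalf (n : ℕ) : SFinite (volHalf n) := by unfold volHalf; infer_instance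

/-- A jointly measurable representative of `ψ ∈ L^∞(0,∞;H²(Ω))`, with its gradient. -/
structure IsGradRep {n : ℕ} (ψ : ℝ → Space n → ℝ) (U : ℝ × Space n → ℝ)
    (g : ℝ × Space n → Space n) (C : ℝ≥0) : Prop where
  meas : Measurable U
  meas_grad : Measurable g
  grad_zero : ∀ p : ℝ × Space n, p.2 ∉ upperHalf n → g p = 0
  ae_eq : ∀ᵐ p ∂(volTime n (Ioi 0)), ψ p.1 p.2 = U p
  weak : ∀ᵐ t ∂(volume.restrict (Ioi (0 : ℝ))),
    IsWeakGrad (fun x => U (t, x)) (fun x => g (t, x))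
  bound : ∀ᵐ t ∂(volume.restrict (Ioi (0 : ℝ))), ∫⁻ x, ‖g (t, x)‖ₑ ^ 2 ≤ (C : ℝ≥0∞) ^ 2
  -- Second derivatives enter only through bounds at fixed `t`, so they may be chosen separately for
  -- each `t`.
  second : ∀ᵐ t ∂(volume.restrict (Ioi (0 : ℝ))), ∃ h : Fin (n + 1) → Space n → Space n,
    (∀ i, Measurable (h i)) ∧ (∀ i, IsWeakGrad (fun x => g (t, x) i) (h i)) ∧
      ∑ i, ∫⁻ x, ‖h i x‖ₑ ^ 2 ≤ (C : ℝ≥0∞) ^ 2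

/-- The hypothesis supplies derivatives time by time, with no measurability in `t`; `mollifiedGrad`
of a measurable representative repairs this for the first derivatives. -/
theorem exists_isGradRep {n : ℕ} {ψ : ℝ → Space n → ℝ} (hψ : MemLinftyH2 ψ) :
    ∃ U g C, IsGradRep ψ U g C := by
  obtain ⟨hm, C, hC⟩ := hψ
  set U : ℝ × Space n → ℝ := (Prod.snd ⁻¹' upperHalf n).indicator (hm.mk _) with hUdef
  have hΩ := measurableSet_upperHalf n
  have hUm : Measurable U := hm.measurable_mk.indicator (hΩ.preimage measurable_snd)
  have hzero : ∀ p : ℝ × Space n, p.2 ∉ upperHalf n → U p = 0 := fun p hp =>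
    indicator_of_notMem (by simpa using hp) _
  have hmem : ∀ᵐ p ∂(volTime n (Ioi 0)), p.2 ∈ upperHalf n := by
    unfold volTime volHalf
    rw [← Measure.restrict_univ (μ := volume.restrict (Ioi (0 : ℝ))), Measure.prod_restrict]
    filter_upwards [ae_restrict_mem (MeasurableSet.univ.prod hΩ)] with p hp using hp.2
  have hae : ∀ᵐ p ∂(volTime n (Ioi 0)), ψ p.1 p.2 = U p := by
    filter_upwards [hm.ae_eq_mk, hmem] with p hp hp2
    rw [hp, hUdef, indicator_of_mem (by simpa using hp2)]
  have hae' : ∀ᵐ t ∂(volume.restrict (Ioi (0 : ℝ))), ∀ᵐ x ∂(volHalf n), U (t, x) = ψ t x := by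
    have := Measure.ae_ae_of_ae_prod hae
    filter_upwards [this] with t ht
    filter_upwards [ht] with x hx using hx.symm
  have main : ∀ᵐ t ∂(volume.restrict (Ioi (0 : ℝ))),
      IsWeakGrad (fun x => U (t, x)) (fun x => mollifiedGrad U (t, x)) ∧
      ∫⁻ x, ‖mollifiedGrad U (t, x)‖ₑ ^ 2 ≤ (C : ℝ≥0∞) ^ 2 ∧
      ∃ h : Fin (n + 1) → Space n → Space n,
        (∀ i, Measurable (h i)) ∧ (∀ i, IsWeakGrad (fun x => mollifiedGrad U (t, x) i) (h i)) ∧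
        ∑ i, ∫⁻ x, ‖h i x‖ₑ ^ 2 ≤ (C : ℝ≥0∞) ^ 2 := by
    filter_upwards [hC, hae'] with t ht htU
    obtain ⟨G, H, hH2, hbound⟩ := ht
    have hu2 : MemLp (fun x => U (t, x)) 2 volume := by
      have h1 : MemLp (fun x => U (t, x)) 2 (volHalf n) := hH2.memLp.ae_eq
        (by filter_upwards [htU] with x hx using hx.symm)
      have h2 := (memLp_indicator_iff_restrict hΩ).2 h1
      refine h2.ae_eq (ae_of_all _ fun x => ?_)
      by_cases hx : x ∈ upperHalf n
      · rw [indicator_of_mem hx]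
      · rw [indicator_of_notMem hx]; exact (hzero _ hx).symm
    have hw : IsWeakGrad (fun x => U (t, x)) (zeroExtField G) :=
      { memLp := hu2
        memLp_grad := memLp_zeroExtField hH2.memLp_fst
        zero := fun x hx => hzero _ hx
        grad_zero := fun x hx => indicator_of_notMem hx _
        weak := fun i => (hH2.weak_fst i).congr htU (zeroExtField_ae G i) }
    have hg := hw.mollifiedGrad_eq
    have hgz : ∀ x ∉ upperHalf n, mollifiedGrad U (t, x) = 0 := fun x hx => if_neg hx
    have hgm : Measurable fun x => mollifiedGrad U (t, x) :=
      (measurable_mollifiedGrad hUm).comp measurable_prodMk_left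
    have hgG : ∀ i, (fun x => mollifiedGrad U (t, x) i) =ᵐ[volHalf n] G i := fun i => by
      filter_upwards [ae_restrict_of_ae hg, zeroExtField_ae G i] with x h1 h2
      rw [h1, ← h2]
    refine ⟨{ hw with memLp_grad := ?_, grad_zero := hgz, weak := ?_ }, ?_, ?_⟩
    · exact hw.memLp_grad.ae_eq (by filter_upwards [hg] with x hx using hx.symm)
    · exact fun i => (hH2.weak_fst i).congr htU (hgG i)
    · have : ∫⁻ x, ‖mollifiedGrad U (t, x)‖ₑ ^ 2 = ∫⁻ x, ‖zeroExtField G x‖ₑ ^ 2 :=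
        lintegral_congr_ae (hg.mono fun x hx => by simp only [hx])
      rw [this, lintegral_zeroExtField_sq hH2.memLp_fst]
      refine le_trans ?_ hbound
      exact le_add_right (le_add_left le_rfl)
    · have hHm : ∀ i j, H i j =ᵐ[volHalf n] (hH2.memLp_snd i j).1.mk (H i j) := fun i j =>
        (hH2.memLp_snd i j).1.ae_eq_mk
      set H' : Fin (n + 1) → Fin (n + 1) → Space n → ℝ :=
        fun i j => (hH2.memLp_snd i j).1.mk (H i j) with hH'
      have hH'2 : ∀ i j, MemLp (H' i j) 2 (volHalf n) := fun i j =>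
        (hH2.memLp_snd i j).ae_eq (hHm i j)
      refine ⟨fun i => zeroExtField (H' i), fun i => ?_, fun i => ?_, ?_⟩
      · exact measurable_zeroExtField fun j => (hH2.memLp_snd i j).1.measurable_mk
      · exact
        { memLp := by
            have h2 := (memLp_indicator_iff_restrict hΩ).2 ((hH2.memLp_fst i).ae_eq (hgG i).symm)
            refine h2.ae_eq (ae_of_all _ fun x => ?_)
            by_cases hx : x ∈ upperHalf n
            · rw [indicator_of_mem hx]
            · rw [indicator_of_notMem hx]; simp [hgz _ hx]
          memLp_grad := memLp_zeroExtField (hH'2 i)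
          zero := fun x hx => by simp [hgz x hx]
          grad_zero := fun x hx => indicator_of_notMem hx _
          weak := fun j => (hH2.weak_snd i j).congr (hgG i)
            ((zeroExtField_ae (H' i) j).trans (hHm i j).symm) }
      · simp only [lintegral_zeroExtField_sq (hH'2 _)]
        simp only [hH', ← eLpNorm_congr_ae (hHm _ _)]
        exact le_trans (le_add_left le_rfl) hbound
  exact ⟨U, mollifiedGrad U, C, hUm, measurable_mollifiedGrad hUm, fun p hp => if_neg hp,
    hae, main.mono fun t h => h.1, main.mono fun t h => h.2.1, main.mono fun t h => h.2.2⟩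

/-! ### The trace, and the extension as a line integral -/

theorem tendsto_primitive_zero {f : ℝ → ℝ} {a : ℝ} (ha : 0 < a)
    (hf : IntervalIntegrable f volume 0 a) :
    Tendsto (fun h => ∫ τ in (0 : ℝ)..h, f τ) (𝓝[>] 0) (𝓝 0) := by
  have h1 := intervalIntegral.continuousOn_primitive_interval
    ((intervalIntegrable_iff_integrableOn_Icc_of_le ha.le (by simp)).1 hf |>.mono_set
      (by rw [uIcc_of_le ha.le]))
  have h2 : ContinuousWithinAt (fun h => ∫ τ in (0 : ℝ)..h, f τ) (uIcc 0 a) 0 :=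
    h1 0 left_mem_uIcc
  have h3 : Tendsto (fun h => ∫ τ in (0 : ℝ)..h, f τ) (𝓝[uIcc 0 a] 0) (𝓝 0) := by
    simpa [ContinuousWithinAt] using h2
  refine h3.mono_left ?_
  rw [uIcc_of_le ha.le, ← nhdsWithin_Ioo_eq_nhdsGT ha]
  exact nhdsWithin_mono _ Ioo_subset_Icc_self

/-- The two correction terms are those met when the boundary point is approached along an oblique
line (primitive of `f`) followed by a tangential displacement of length proportional to `r` (the
term `r * e r`). Both average to zero, even though `e` is merely integrable. -/
theorem trace_eq_of_normal_line {n : ℕ} {u : Space n → ℝ} {b : Space n} {a c : ℝ} (ha : 0 < a)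
    {f e : ℝ → ℝ} (hf : IntervalIntegrable f volume 0 a) (he : IntervalIntegrable e volume 0 a)
    (h : ∀ᵐ r, r ∈ Ioo 0 a →
      u (b + r • basisVec n (Fin.last n)) = c + (∫ s in (0 : ℝ)..r, f s) + r * e r) :
    trace u b = c := by
  refine Tendsto.limUnder_eq ?_
  rw [tendsto_iff_norm_sub_tendsto_zero]
  have hlim := (tendsto_primitive_zero ha hf.norm).add (tendsto_primitive_zero ha he.norm)
  rw [add_zero] at hlim
  refine squeeze_zero' (Eventually.of_forall fun _ => norm_nonneg _) ?_ hlim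
  filter_upwards [Ioo_mem_nhdsGT ha] with r hr
  have hf' : IntervalIntegrable f volume 0 r :=
    hf.mono_set (by rw [uIcc_of_le hr.1.le, uIcc_of_le ha.le]; exact Icc_subset_Icc_right hr.2.le)
  have he' : IntervalIntegrable e volume 0 r :=
    he.mono_set (by rw [uIcc_of_le hr.1.le, uIcc_of_le ha.le]; exact Icc_subset_Icc_right hr.2.le)
  have hsub : ∀ τ ∈ Ioc 0 r, τ ∈ Ioo 0 a := fun τ hτ => ⟨hτ.1, hτ.2.trans_lt hr.2⟩
  set F : ℝ → ℝ := fun τ => (∫ s in (0 : ℝ)..τ, f s) + τ * e τ with hF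
  have hFi : IntervalIntegrable F volume 0 r := by
    refine IntervalIntegrable.add ?_ (he'.continuousOn_mul continuousOn_id)
    refine ContinuousOn.intervalIntegrable ?_
    refine intervalIntegral.continuousOn_primitive_interval ?_
    rw [uIcc_of_le hr.1.le]
    exact (intervalIntegrable_iff_integrableOn_Icc_of_le hr.1.le (by simp)).1 hf'
  have h1 : ∫ τ in (0 : ℝ)..r, u (b + τ • basisVec n (Fin.last n))
      = r * c + ∫ τ in (0 : ℝ)..r, F τ := by
    rw [intervalIntegral.integral_congr_ae (g := fun τ => c + F τ),
      intervalIntegral.integral_add intervalIntegrable_const hFi]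
    · simp
    · filter_upwards [h] with τ hτ hτr
      rw [uIoc_of_le hr.1.le] at hτr
      rw [hτ (hsub τ hτr), hF, add_assoc]
  -- Bounding `τ` by `r` in `τ e(τ)` provides the factor that cancels `r⁻¹` and leaves a small
  -- primitive of `|e|`.
  have h2 : ‖∫ τ in (0 : ℝ)..r, F τ‖
      ≤ ∫ τ in (0 : ℝ)..r, ((∫ s in (0 : ℝ)..r, ‖f s‖) + r * ‖e τ‖) := by
    refine intervalIntegral.norm_integral_le_of_norm_le hr.1.le ?_
      (intervalIntegrable_const.add (he'.norm.const_mul r))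
    refine ae_of_all _ fun τ hτ => ?_
    refine (norm_add_le _ _).trans (add_le_add ?_ ?_)
    · refine (intervalIntegral.norm_integral_le_integral_norm hτ.1.le).trans ?_
      refine intervalIntegral.integral_mono_interval le_rfl hτ.1.le hτ.2
        (ae_of_all _ fun _ => norm_nonneg _) hf'.norm
    · rw [norm_mul, Real.norm_of_nonneg hτ.1.le]
      exact mul_le_mul_of_nonneg_right hτ.2 (norm_nonneg _)
  rw [intervalIntegral.integral_add intervalIntegrable_const (he'.norm.const_mul r),
    intervalIntegral.integral_const, intervalIntegral.integral_const_mul, smul_eq_mul, sub_zero,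
    ← mul_add] at h2
  have hr0 : r ≠ 0 := hr.1.ne'
  rw [h1, show r⁻¹ * (r * c + ∫ τ in (0 : ℝ)..r, F τ) - c = r⁻¹ * ∫ τ in (0 : ℝ)..r, F τ by
    field_simp; ring, norm_mul, norm_inv, Real.norm_of_nonneg hr.1.le, inv_mul_le_iff₀ hr.1]
  exact h2

/-- The integral of the gradient along the segment from `p.2` to `p.2 + z`. -/
noncomputable def lineInt {n : ℕ} (g : ℝ × Space n → Space n) (p : ℝ × Space n)
    (z : Space n) : ℝ :=
  ∫ σ in (0 : ℝ)..1, inner ℝ z (g (p.1, p.2 + σ • z))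

theorem measurable_unitIntegral {α : Type*} [MeasurableSpace α] {f : α → ℝ → ℝ}
    (hf : Measurable (Function.uncurry f)) : Measurable fun a => ∫ σ in (0 : ℝ)..1, f a σ := by
  simp only [intervalIntegral.integral_of_le zero_le_one]
  exact (hf.stronglyMeasurable.integral_prod_right'
    (ν := volume.restrict (Ioc (0 : ℝ) 1))).measurable

theorem measurable_lineInt {n : ℕ} {g : ℝ × Space n → Space n} (hg : Measurable g)
    {α : Type*} [MeasurableSpace α] {p : α → ℝ × Space n} {z : α → Space n}
    (hp : Measurable p) (hz : Measurable z) :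
    Measurable fun a => lineInt g (p a) (z a) := by
  refine measurable_unitIntegral (f := fun (a : α) (σ : ℝ) =>
    inner ℝ (z a) (g ((p a).1, (p a).2 + σ • z a))) ?_
  unfold Function.uncurry
  exact Measurable.inner (by fun_prop) (hg.comp (by fun_prop))

/-- Line integrals of the gradient from the boundary point below `x` in direction `η`. -/
theorem lineInt_eq_primitive {n : ℕ} (g : ℝ × Space n → Space n) (t : ℝ) (x η : Space n)
    (c : ℝ) :
    lineInt g (t, x) (c • η) = ∫ s in x (Fin.last n)..(x (Fin.last n) + c),
      inner ℝ η (g (t, x - x (Fin.last n) • η + s • η)) := by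
  have h := intervalIntegral.smul_integral_comp_add_mul (a := 0) (b := 1)
    (fun s => inner ℝ η (g (t, x - x (Fin.last n) • η + s • η))) c (x (Fin.last n))
  simp only [mul_zero, add_zero, mul_one] at h
  rw [← h, lineInt, ← intervalIntegral.integral_smul]
  refine intervalIntegral.integral_congr fun σ _ => ?_
  simp only [real_inner_smul_left, smul_eq_mul]
  congr 4
  module

/-- The direction of `w`, normalised to have last coordinate `1`. -/
noncomputable def normDir {n : ℕ} (w : Space n) : Space n := (w (Fin.last n))⁻¹ • w

/-- The tangential vector joining `normDir w` to the inward normal. -/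
noncomputable def tangDir {n : ℕ} (w : Space n) : Space n := basisVec n (Fin.last n) - normDir w

open Classical in
-- If the segment leaves `Ω`, the extension is the trace at the exit point `b`. The trace is defined
-- along the normal through `b`, while the gradient is integrated along the characteristic; the
-- tangential shear `b + r η ↦ b + r e_N` connects the two lines.
theorem ext_sub_eq_lineInt {n : ℕ} {u : Space n → ℝ} {U : ℝ × Space n → ℝ}
    {g : ℝ × Space n → Space n} (hg0 : ∀ p : ℝ × Space n, p.2 ∉ upperHalf n → g p = 0)
    {t : ℝ} {x w : Space n} (hx : x ∈ upperHalf n) (hux : u x = U (t, x))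
    (hint : x + w ∈ upperHalf n → u (x + w) - u x = lineInt g (t, x) w)
    (hbd : w (Fin.last n) < 0 →
      (∀ᵐ τ : ℝ, x + τ • normDir w ∈ upperHalf n →
        U (t, x + τ • normDir w) - U (t, x) = lineInt g (t, x) (τ • normDir w) ∧
        u (x + τ • normDir w + (x + τ • normDir w) (Fin.last n) • tangDir w) - U (t, x + τ • normDir w)
          = lineInt g (t, x + τ • normDir w) ((x + τ • normDir w) (Fin.last n) • tangDir w)) ∧
      IntervalIntegrable (fun s => inner ℝ (normDir w) (g (t, x - x (Fin.last n) • normDir w + s • normDir w))) volume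
        0 (x (Fin.last n)) ∧
      IntervalIntegrable (fun s => ∫ σ in (0 : ℝ)..1,
          inner ℝ (tangDir w) (g (t, x - x (Fin.last n) • normDir w + s • normDir w + (σ * s) • tangDir w))) volume
        0 (x (Fin.last n))) :
    ext u (x + w) w - u x = lineInt g (t, x) w := by
  have hx0 : 0 < x (Fin.last n) := hx
  by_cases hxw : x + w ∈ upperHalf n
  · rw [← hint hxw, ext, if_pos (show 0 < (x + w) (Fin.last n) from hxw)]
  have hxw' : x (Fin.last n) + w (Fin.last n) ≤ 0 := by
    have : ¬ 0 < (x + w) (Fin.last n) := hxw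
    simpa using this
  have hw : w (Fin.last n) < 0 := by linarith
  obtain ⟨h1, hf, he⟩ := hbd hw
  set a := x (Fin.last n) with ha
  set η := normDir w with hη
  set ζ := tangDir w with hζ
  set b := x - a • η with hb
  set f : ℝ → ℝ := fun s => inner ℝ η (g (t, b + s • η)) with hfdef
  have hηN : η (Fin.last n) = 1 := by simp [hη, normDir, hw.ne]
  have hbN : b (Fin.last n) = 0 := by simp [hb, hηN, ha]
  have hwη : w = w (Fin.last n) • η := by simp [hη, normDir, hw.ne, smul_smul]
  have htr : trace u b = U (t, x) - ∫ s in (0 : ℝ)..a, f s := by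
    refine trace_eq_of_normal_line hx0 hf he ?_
    -- Since `η` has last coordinate `1`, the parameter `τ = r - a` on the characteristic
    -- corresponds to height `r`.
    have hmp : Measure.QuasiMeasurePreserving (fun r : ℝ => r - a) volume volume :=
      (measurePreserving_sub_right volume a).quasiMeasurePreserving
    filter_upwards [hmp.ae h1] with r hr hra
    have hy : x + (r - a) • η = b + r • η := by rw [hb]; module
    have hyN : (b + r • η) (Fin.last n) = r := by simp [hbN, hηN]
    rw [hy, hyN] at hr
    obtain ⟨h2, h3⟩ := hr (by change 0 < (b + r • η) (Fin.last n); rw [hyN]; exact hra.1)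
    rw [lineInt_eq_primitive, add_sub_cancel] at h2
    have hb' : b + r • η + r • ζ = b + r • basisVec n (Fin.last n) := by rw [hζ, tangDir]; module
    rw [hb'] at h3
    have h4 : lineInt g (t, b + r • η) (r • ζ)
        = r * ∫ σ in (0 : ℝ)..1, inner ℝ ζ (g (t, b + r • η + (σ * r) • ζ)) := by
      rw [lineInt, ← intervalIntegral.integral_const_mul]
      refine intervalIntegral.integral_congr fun σ _ => ?_
      simp only [real_inner_smul_left, smul_smul]
    have h5 : ∫ s in a..r, f s = (∫ s in (0 : ℝ)..r, f s) - ∫ s in (0 : ℝ)..a, f s := by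
      rw [intervalIntegral.integral_interval_sub_left]
      · exact hf.mono_set (by
          rw [uIcc_of_le hra.1.le, uIcc_of_le hx0.le]; exact Icc_subset_Icc_right hra.2.le)
      · exact hf
    rw [h4] at h3
    change U (t, b + r • η) - U (t, x) = ∫ s in a..r, f s at h2
    linarith
  have hz : ∀ s ≤ 0, f s = 0 := fun s hs => by
    have : g (t, b + s • η) = 0 := hg0 _ (by
      change ¬ 0 < (b + s • η) (Fin.last n)
      simp [hbN, hηN, hs])
    simp [hfdef, this]
  -- Beyond the boundary the zero extension of `g` contributes nothing, so the integral stops at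
  -- height `0`.
  have hline : lineInt g (t, x) w = -∫ s in (0 : ℝ)..a, f s := by
    conv_lhs => rw [hwη]
    rw [lineInt_eq_primitive]
    change ∫ s in a..(a + w (Fin.last n)), f s = _
    have h6 : ∫ s in (0 : ℝ)..(a + w (Fin.last n)), f s = 0 := by
      rw [intervalIntegral.integral_congr (g := fun _ => 0)]
      · simp
      · intro s hs
        rw [uIcc_of_ge hxw'] at hs
        exact hz s hs.2
    have h7 : IntervalIntegrable f volume 0 (a + w (Fin.last n)) := by
      refine IntervalIntegrable.congr (f := fun _ => 0) ?_ intervalIntegrable_const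
      intro s hs
      rw [uIoc_of_ge hxw'] at hs
      exact (hz s hs.2).symm
    rw [← intervalIntegral.integral_interval_sub_left h7 hf, h6, zero_sub]
  have hb2 : x + w - ((x + w) (Fin.last n) / w (Fin.last n)) • w = b := by
    rw [hb, hη, normDir, smul_smul, PiLp.add_apply, add_div, div_self hw.ne, ← div_eq_mul_inv]
    module
  rw [ext, if_neg (show ¬ 0 < (x + w) (Fin.last n) from hxw), if_pos (Or.inr hw), hb2, htr, hline,
    hux]
  ring

/-- Each `T z` preserves the `L²` norm of `f`, so Minkowski bounds the `L²` norm in `x` of the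
`z`-integral. -/
theorem ae_lintegral_comp_lt_top {n : ℕ} {Z : Type*} [MeasurableSpace Z] (ν : Measure Z)
    [IsFiniteMeasure ν] {T : Z → Space n → Space n}
    (hT : Measurable fun q : Space n × Z => T q.2 q.1)
    (hmp : ∀ z, MeasurePreserving (T z) volume volume) {f : Space n → Space n}
    (hf : Measurable f) (hf2 : ∫⁻ x, ‖f x‖ₑ ^ 2 ≠ ⊤) :
    ∀ᵐ x, ∫⁻ z, ‖f (T z x)‖ₑ ∂ν < ⊤ := by
  have hm : Measurable (Function.uncurry fun x z => ‖f (T z x)‖ₑ) := (hf.comp hT).enorm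
  have h := lintegral_lintegral_sq_le volume ν (f := fun x z => ‖f (T z x)‖ₑ) hm
    (m := fun _ => 1) measurable_const (M := eLpNorm f 2 volume) (ae_of_all _ fun z => by
      rw [one_mul, eLpNorm_two_sq, (hmp z).lintegral_comp (f := fun x => ‖f x‖ₑ ^ 2)
        (hf.enorm.pow_const 2)])
  have hfin : ∫⁻ x, (∫⁻ z, ‖f (T z x)‖ₑ ∂ν) ^ 2 ≠ ⊤ := by
    refine ne_top_of_le_ne_top ?_ h
    rw [mul_pow, eLpNorm_two_sq]
    refine ENNReal.mul_ne_top (ENNReal.pow_ne_top ?_) hf2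
    simp
  have := ae_lt_top (hm.lintegral_prod_right'.pow_const 2) hfin
  filter_upwards [this] with x hx
  exact (ENNReal.pow_lt_top_iff.1 hx).resolve_right (by norm_num)

theorem measurable_shear_translate {n : ℕ} {η ζ : Space n} :
    Measurable fun q : Space n × (ℝ × ℝ) =>
      q.1 + q.2.1 • η + (q.2.2 * (q.1 + q.2.1 • η) (Fin.last n)) • ζ := by fun_prop

theorem measurePreserving_shear_translate {n : ℕ} {η ζ : Space n} (hζ : ζ (Fin.last n) = 0)
    (z : ℝ × ℝ) :
    MeasurePreserving (fun x : Space n =>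
      x + z.1 • η + (z.2 * (x + z.1 • η) (Fin.last n)) • ζ) volume volume := by
  have h1 : MeasurePreserving (fun x : Space n => x + z.1 • η) volume volume :=
    measurePreserving_add_right volume _
  have := (measurePreserving_shear hζ z.2).comp h1
  simpa only [Function.comp_def, smul_smul] using this

theorem ae_lintegral_shear_lt_top {n : ℕ} {η ζ : Space n} (hζ : ζ (Fin.last n) = 0)
    {f : Space n → Space n} (hf : Measurable f) (hf2 : ∫⁻ x, ‖f x‖ₑ ^ 2 ≠ ⊤) (μ ν : Measure ℝ)
    [IsFiniteMeasure μ] [IsFiniteMeasure ν] :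
    ∀ᵐ x : Space n, ∫⁻ z, ‖f (x + z.1 • η +
      (z.2 * (x + z.1 • η) (Fin.last n)) • ζ)‖ₑ ∂(μ.prod ν) < ⊤ :=
  ae_lintegral_comp_lt_top (μ.prod ν) measurable_shear_translate
    (measurePreserving_shear_translate hζ) hf hf2

/-! ### Generic positions and Fubini -/

theorem measurable_normDir (n : ℕ) : Measurable (normDir (n := n)) := by
  unfold normDir; fun_prop

theorem measurable_tangDir (n : ℕ) : Measurable (tangDir (n := n)) := by
  unfold tangDir; exact measurable_const.sub (measurable_normDir n)

theorem tangDir_last {n : ℕ} {w : Space n} (hw : w (Fin.last n) < 0) :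
    tangDir w (Fin.last n) = 0 := by
  simp [tangDir, normDir, basisVec, hw.ne]

/-- The generic position of `(t, x), (w, τ)` under which the extension of `ψ` at `x + w` is
controlled by the gradient. -/
def IsGeneric {n : ℕ} (U : ℝ × Space n → ℝ) (g : ℝ × Space n → Space n) (Z : Set (ℝ × Space n))
    (p : ℝ × Space n) (q : Space n × ℝ) : Prop :=
  (p.2 + q.1 ∈ upperHalf n → U (p.1, p.2 + q.1) - U p = lineInt g p q.1 ∧ (p.1, p.2 + q.1) ∉ Z) ∧
  (q.1 (Fin.last n) < 0 →
    (p.2 + q.2 • normDir q.1 ∈ upperHalf n →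
      U (p.1, p.2 + q.2 • normDir q.1) - U p = lineInt g p (q.2 • normDir q.1) ∧
      U (p.1, p.2 + q.2 • normDir q.1 +
          (p.2 + q.2 • normDir q.1) (Fin.last n) • tangDir q.1) - U (p.1, p.2 + q.2 • normDir q.1)
        = lineInt g (p.1, p.2 + q.2 • normDir q.1)
          ((p.2 + q.2 • normDir q.1) (Fin.last n) • tangDir q.1) ∧
      (p.1, p.2 + q.2 • normDir q.1 +
        (p.2 + q.2 • normDir q.1) (Fin.last n) • tangDir q.1) ∉ Z) ∧
    ∀ R : ℕ, ∫⁻ τ in Ioc (-(R : ℝ)) 0, ‖g (p.1, p.2 + τ • normDir q.1)‖ₑ < ⊤ ∧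
      ∫⁻ z, ‖g (p.1, p.2 + z.1 • normDir q.1 +
        (z.2 * (p.2 + z.1 • normDir q.1) (Fin.last n)) • tangDir q.1)‖ₑ
        ∂((volume.restrict (Ioc (-(R : ℝ)) 0)).prod (volume.restrict (Ioc (0 : ℝ) 1))) < ⊤)

/-- The line identities are known for each fixed direction off a null set depending on it; joint
measurability permits exchanging the quantifiers. -/
theorem measurableSet_isGeneric {n : ℕ} {U : ℝ × Space n → ℝ} {g : ℝ × Space n → Space n}
    (hU : Measurable U) (hg : Measurable g) {Z : Set (ℝ × Space n)} (hZ : MeasurableSet Z) :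
    MeasurableSet {q : (ℝ × Space n) × (Space n × ℝ) | IsGeneric U g Z q.1 q.2} := by
  have hη := measurable_normDir n
  have hζ := measurable_tangDir n
  have hΩ := measurableSet_upperHalf n
  unfold IsGeneric
  rw [measurableSet_setOfPred]
  have hZ' : Measurable fun p : ℝ × Space n => p ∉ Z := measurableSet_setOfPred.1 hZ.compl
  have hΩ' : Measurable fun x : Space n => x ∈ upperHalf n := measurableSet_setOfPred.1 hΩ
  have hy : Measurable fun q : (ℝ × Space n) × (Space n × ℝ) => q.1.2 + q.2.2 • normDir q.2.1 := by
    fun_prop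
  have hy2 : Measurable fun q : (ℝ × Space n) × (Space n × ℝ) =>
      (q.1.2 + q.2.2 • normDir q.2.1) (Fin.last n) • tangDir q.2.1 := by
    fun_prop
  have ht : Measurable fun q : (ℝ × Space n) × (Space n × ℝ) => q.1.1 := by fun_prop
  refine Measurable.and (Measurable.imp ?_ (Measurable.and ?_ ?_))
    (Measurable.imp ?_ (Measurable.and (Measurable.imp ?_ (Measurable.and ?_
      (Measurable.and ?_ ?_))) (Measurable.forall fun R => Measurable.and ?_ ?_)))
  · exact hΩ'.comp (by fun_prop)
  · refine measurableSet_setOfPred.1 (measurableSet_eq_fun ?_ ?_)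
    · exact (hU.comp (by fun_prop)).sub (hU.comp (by fun_prop))
    · exact measurable_lineInt hg (by fun_prop) (by fun_prop)
  · exact hZ'.comp (by fun_prop : Measurable fun q : (ℝ × Space n) × (Space n × ℝ) =>
        (q.1.1, q.1.2 + q.2.1))
  · exact measurableSet_setOfPred.1 (measurableSet_lt (by fun_prop) measurable_const)
  · exact hΩ'.comp hy
  · refine measurableSet_setOfPred.1 (measurableSet_eq_fun ?_ ?_)
    · exact (hU.comp (ht.prodMk hy)).sub (hU.comp (by fun_prop))
    · exact measurable_lineInt hg (by fun_prop) (by fun_prop)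
  · refine measurableSet_setOfPred.1 (measurableSet_eq_fun ?_ ?_)
    · exact (hU.comp (ht.prodMk (hy.add hy2))).sub (hU.comp (ht.prodMk hy))
    · exact measurable_lineInt hg (ht.prodMk hy) hy2
  · exact hZ'.comp (ht.prodMk (hy.add hy2))
  · refine measurableSet_setOfPred.1 (measurableSet_lt ?_ measurable_const)
    refine Measurable.lintegral_prod_right' (f := fun q : ((ℝ × Space n) × (Space n × ℝ)) × ℝ =>
      ‖g (q.1.1.1, q.1.1.2 + q.2 • normDir q.1.2.1)‖ₑ) ?_
    exact (hg.comp (by fun_prop)).enorm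
  · refine measurableSet_setOfPred.1 (measurableSet_lt ?_ measurable_const)
    refine Measurable.lintegral_prod_right'
      (f := fun q : ((ℝ × Space n) × (Space n × ℝ)) × (ℝ × ℝ) =>
      ‖g (q.1.1.1, q.1.1.2 + q.2.1 • normDir q.1.2.1 +
        (q.2.2 * (q.1.1.2 + q.2.1 • normDir q.1.2.1) (Fin.last n)) • tangDir q.1.2.1)‖ₑ) ?_
    exact (hg.comp (by fun_prop)).enorm

theorem IsGradRep.ae_isGeneric {n : ℕ} {ψ : ℝ → Space n → ℝ} {U : ℝ × Space n → ℝ}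
    {g : ℝ × Space n → Space n} {C : ℝ≥0} (h : IsGradRep ψ U g C) {Z : Set (ℝ × Space n)}
    (hZ : MeasurableSet Z) (hZ0 : volTime n (Ioi 0) Z = 0) (q : Space n × ℝ) :
    ∀ᵐ p ∂(volTime n (Ioi 0)), IsGeneric U g Z p q := by
  have hm := measurable_prodMk_right (y := q) (measurableSet_isGeneric h.meas h.meas_grad hZ)
  unfold volTime
  refine (Measure.ae_prod_iff_ae_ae hm).2 ?_
  have hZt : ∀ᵐ t ∂(volume.restrict (Ioi (0 : ℝ))), ∀ᵐ x ∂(volHalf n), (t, x) ∉ Z := by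
    have : ∀ᵐ p ∂(volTime n (Ioi 0)), p ∉ Z := measure_eq_zero_iff_ae_notMem.1 hZ0
    exact Measure.ae_ae_of_ae_prod this
  filter_upwards [h.weak, h.bound, hZt] with t ht hb hZ1
  have hgm : Measurable fun x => g (t, x) := h.meas_grad.comp measurable_prodMk_left
  have hfin : ∫⁻ x, ‖g (t, x)‖ₑ ^ 2 ≠ ⊤ :=
    ne_top_of_le_ne_top (ENNReal.pow_ne_top ENNReal.coe_ne_top) hb
  rw [volHalf, ae_restrict_iff' (measurableSet_upperHalf n)] at hZ1
  have htr : ∀ z : Space n, MeasurePreserving (fun x : Space n => x + z) volume volume :=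
    fun z => measurePreserving_add_right volume z
  refine ae_restrict_of_ae_restrict_of_subset (subset_refl _) ?_
  rw [ae_restrict_iff' (measurableSet_upperHalf n)]
  have hA : ∀ᵐ x : Space n, x ∈ upperHalf n → (x + q.1 ∈ upperHalf n →
      U (t, x + q.1) - U (t, x) = lineInt g (t, x) q.1 ∧ (t, x + q.1) ∉ Z) := by
    filter_upwards [ht.translate q.1, (htr q.1).quasiMeasurePreserving.ae hZ1] with x h1 h2 hx hxw
    exact ⟨h1 hx hxw, h2 hxw⟩
  by_cases hq : q.1 (Fin.last n) < 0
  swap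
  · filter_upwards [hA] with x hx hxΩ
    exact ⟨hx hxΩ, fun h => absurd h hq⟩
  have hζ := tangDir_last hq
  have hI : ∀ᵐ x : Space n, ∀ R : ℕ,
      ∫⁻ τ in Ioc (-(R : ℝ)) 0, ‖g (t, x + τ • normDir q.1)‖ₑ < ⊤ ∧
      ∫⁻ z, ‖g (t, x + z.1 • normDir q.1 +
        (z.2 * (x + z.1 • normDir q.1) (Fin.last n)) • tangDir q.1)‖ₑ
        ∂((volume.restrict (Ioc (-(R : ℝ)) 0)).prod (volume.restrict (Ioc (0 : ℝ) 1))) < ⊤ := by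
    rw [ae_all_iff]
    intro R
    refine Eventually.and ?_ ?_
    · exact ae_lintegral_comp_lt_top (volume.restrict (Ioc (-(R : ℝ)) 0))
        (f := fun x => g (t, x)) (T := fun τ x => x + τ • normDir q.1) (by fun_prop) (fun τ => htr _) hgm hfin
    · exact ae_lintegral_shear_lt_top hζ hgm hfin _ _
  have hη := htr (q.2 • normDir q.1)
  have hsh := measurePreserving_shear hζ 1
  simp only [one_smul] at hsh
  -- The point on the normal line is the image of `x` under a translation followed by a shear, so it
  -- avoids the null set `Z` for almost every `x`.
  have h3 := hη.quasiMeasurePreserving.ae (hsh.quasiMeasurePreserving.ae hZ1)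
  have h2 := hη.quasiMeasurePreserving.ae (ht.shear hζ)
  filter_upwards [hA, hI, ht.translate (q.2 • normDir q.1), h2, h3] with x hx1 hx2 hx3 hx4 hx5 hxΩ
  refine ⟨hx1 hxΩ, fun _ => ⟨fun hy => ⟨hx3 hxΩ hy, hx4 hy, hx5 ?_⟩, hx2⟩⟩
  have hy' : 0 < (x + q.2 • normDir q.1) (Fin.last n) := hy
  change 0 < (_ : Space n) (Fin.last n)
  simpa [hζ] using hy'

/-- Almost everywhere, the extension of `ψ` is the integral of the gradient along segments. -/
theorem IsGradRep.ext_sub_ae {n : ℕ} {ψ : ℝ → Space n → ℝ} {U : ℝ × Space n → ℝ}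
    {g : ℝ × Space n → Space n} {C : ℝ≥0} (h : IsGradRep ψ U g C) :
    ∀ᵐ p ∂(volTime n (Ioi 0)), ∀ᵐ w : Space n,
      ext (ψ p.1) (p.2 + w) w - ψ p.1 p.2 = lineInt g p w := by
  have hnull : volTime n (Ioi 0) {p | ¬ ψ p.1 p.2 = U p} = 0 := h.ae_eq
  -- The trace is taken of `ψ` itself, not of its representative `U`; off `Z` the two may be
  -- interchanged.
  obtain ⟨Z, hZs, hZ, hZ0⟩ := exists_measurable_superset_of_null hnull
  have hZU : ∀ p : ℝ × Space n, p ∉ Z → ψ p.1 p.2 = U p := fun p hp => by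
    by_contra hne; exact hp (hZs hne)
  have hgen : ∀ᵐ p ∂(volTime n (Ioi 0)), ∀ᵐ w : Space n, ∀ᵐ τ : ℝ, IsGeneric U g Z p (w, τ) := by
    have : SFinite (volTime n (Ioi 0)) := by unfold volTime; infer_instance
    have h1 : ∀ᵐ p ∂(volTime n (Ioi 0)), ∀ᵐ q ∂((volume : Measure (Space n)).prod
        (volume : Measure ℝ)), IsGeneric U g Z p q := by
      rw [Measure.ae_ae_comm (measurableSet_isGeneric h.meas h.meas_grad hZ)]
      exact ae_of_all _ fun q => h.ae_isGeneric hZ hZ0 q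
    filter_upwards [h1] with p hp using Measure.ae_ae_of_ae_prod hp
  have hmem : ∀ᵐ p ∂(volTime n (Ioi 0)), p.2 ∈ upperHalf n := by
    unfold volTime volHalf
    rw [← Measure.restrict_univ (μ := volume.restrict (Ioi (0 : ℝ))), Measure.prod_restrict]
    filter_upwards [ae_restrict_mem (MeasurableSet.univ.prod (measurableSet_upperHalf n))]
      with p hp using hp.2
  filter_upwards [hgen, hmem, h.ae_eq] with p hp hpΩ hpU
  obtain ⟨t, x⟩ := p
  filter_upwards [hp] with w hw
  -- The clauses of `IsGeneric` that do not involve `τ` follow from any single generic value.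
  obtain ⟨τ₀, hτ₀⟩ := hw.exists
  have hgt : Measurable fun x => g (t, x) := h.meas_grad.comp measurable_prodMk_left
  refine ext_sub_eq_lineInt h.grad_zero hpΩ hpU (fun hxw => ?_) (fun hwN => ⟨?_, ?_, ?_⟩)
  · obtain ⟨h1, h2⟩ := hτ₀.1 hxw
    rw [← h1, ← hpU, hZU _ h2]
  · filter_upwards [hw] with τ hτ hy
    obtain ⟨h1, h2, h3⟩ := (hτ.2 hwN).1 hy
    exact ⟨h1, by rw [← hZU _ h3] at h2; exact h2⟩
  · have hx0 : 0 < x (Fin.last n) := hpΩ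
    obtain ⟨R, hR⟩ := exists_nat_ge (x (Fin.last n))
    have h1 := ((hτ₀.2 hwN).2 R).1
    have h2 : IntegrableOn (fun τ => inner ℝ (normDir w) (g (t, x + τ • normDir w)))
        (Ioc (-(R : ℝ)) 0) := by
      have hi : IntegrableOn (fun τ => g (t, x + τ • normDir w)) (Ioc (-(R : ℝ)) 0) :=
        ⟨(hgt.comp (by fun_prop)).aestronglyMeasurable, h1⟩
      exact hi.const_inner _
    have h3 : IntervalIntegrable (fun τ => inner ℝ (normDir w) (g (t, x + τ • normDir w))) volume
        (-x (Fin.last n)) 0 := by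
      rw [intervalIntegrable_iff_integrableOn_Ioc_of_le (by linarith)]
      exact h2.mono_set (Ioc_subset_Ioc_left (by linarith))
    have h4 := h3.comp_sub_right (x (Fin.last n))
    rw [neg_add_cancel, zero_add] at h4
    have hy : ∀ s : ℝ, x + (s - x (Fin.last n)) • normDir w
        = x - x (Fin.last n) • normDir w + s • normDir w := fun s => by module
    simpa only [hy] using h4
  · have hx0 : 0 < x (Fin.last n) := hpΩ
    obtain ⟨R, hR⟩ := exists_nat_ge (x (Fin.last n))
    have h1 := ((hτ₀.2 hwN).2 R).2
    have h2 : Integrable (fun z : ℝ × ℝ => inner ℝ (tangDir w) (g (t, x + z.1 • normDir w +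
        (z.2 * (x + z.1 • normDir w) (Fin.last n)) • tangDir w)))
        ((volume.restrict (Ioc (-(R : ℝ)) 0)).prod (volume.restrict (Ioc (0 : ℝ) 1))) := by
      have hi : Integrable (fun z : ℝ × ℝ => g (t, x + z.1 • normDir w +
        (z.2 * (x + z.1 • normDir w) (Fin.last n)) • tangDir w))
        ((volume.restrict (Ioc (-(R : ℝ)) 0)).prod (volume.restrict (Ioc (0 : ℝ) 1))) :=
        ⟨(hgt.comp (by fun_prop)).aestronglyMeasurable, h1⟩
      exact hi.const_inner _
    have h3 : IntervalIntegrable (fun τ => ∫ σ in (0 : ℝ)..1, inner ℝ (tangDir w)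
        (g (t, x + τ • normDir w + (σ * (x + τ • normDir w) (Fin.last n)) • tangDir w))) volume
        (-x (Fin.last n)) 0 := by
      rw [intervalIntegrable_iff_integrableOn_Ioc_of_le (by linarith)]
      have h5 := h2.integral_prod_left
      simp only [intervalIntegral.integral_of_le zero_le_one]
      exact IntegrableOn.mono_set h5 (Ioc_subset_Ioc_left (by linarith))
    have h4 := h3.comp_sub_right (x (Fin.last n))
    rw [neg_add_cancel, zero_add] at h4
    have hy : ∀ s : ℝ, x + (s - x (Fin.last n)) • normDir w
        = x - x (Fin.last n) • normDir w + s • normDir w := fun s => by module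
    have hyN : ∀ s : ℝ,
        (x - x (Fin.last n) • normDir w + s • normDir w) (Fin.last n) = s := fun s => by
      simp [normDir, hwN.ne]
    simpa only [hy, hyN] using h4

/-! ### Increments: the frozen linear part and the remainder -/

theorem lintegral_lineInt_sq_le {n : ℕ} {g : ℝ × Space n → Space n} (hg : Measurable g) {t : ℝ}
    {C : ℝ≥0} (hb : ∫⁻ x, ‖g (t, x)‖ₑ ^ 2 ≤ (C : ℝ≥0∞) ^ 2) (w : Space n) :
    ∫⁻ x, ‖lineInt g (t, x) w‖ₑ ^ 2 ≤ (‖w‖ₑ * C) ^ 2 := by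
  have hgt : Measurable fun x => g (t, x) := hg.comp measurable_prodMk_left
  have hg2 : Measurable fun q : Space n × ℝ => ‖g (t, q.1 + q.2 • w)‖ₑ ^ 2 :=
    (hg.comp (by fun_prop)).enorm.pow_const 2
  calc ∫⁻ x, ‖lineInt g (t, x) w‖ₑ ^ 2
      ≤ ∫⁻ x, ‖w‖ₑ ^ 2 * ∫⁻ σ in Ioc (0 : ℝ) 1, ‖g (t, x + σ • w)‖ₑ ^ 2 :=
        lintegral_mono fun x => enorm_unitIntegral_inner_sq_le w (hgt.comp (by fun_prop))
    _ = ‖w‖ₑ ^ 2 * ∫⁻ σ in Ioc (0 : ℝ) 1, ∫⁻ x, ‖g (t, x + σ • w)‖ₑ ^ 2 := by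
        rw [lintegral_const_mul _ hg2.lintegral_prod_right', lintegral_lintegral_swap
          hg2.aemeasurable]
    _ = ‖w‖ₑ ^ 2 * ∫⁻ _ in Ioc (0 : ℝ) 1, ∫⁻ x, ‖g (t, x)‖ₑ ^ 2 := by
        congr 1
        refine lintegral_congr fun σ => ?_
        exact lintegral_add_right_eq_self (fun x => ‖g (t, x)‖ₑ ^ 2) (σ • w)
    _ ≤ _ := by
        rw [setLIntegral_const, Real.volume_Ioc, sub_zero, ENNReal.ofReal_one, mul_one, mul_pow]
        gcongr

theorem IsWeakGrad.lintegral_translate_sq_le {n : ℕ} {f : Space n → ℝ} {h : Space n → Space n}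
    (hf : IsWeakGrad f h) (hh : Measurable h) (z : Space n) :
    ∫⁻ x in upperHalf n, ((fun x => x + z) ⁻¹' (upperHalf n)).indicator
      (fun x => ‖f (x + z) - f x‖ₑ ^ 2) x ≤ ‖z‖ₑ ^ 2 * ∫⁻ x, ‖h x‖ₑ ^ 2 := by
  have hg2 : Measurable fun q : Space n × ℝ => ‖h (q.1 + q.2 • z)‖ₑ ^ 2 :=
    (hh.comp (by fun_prop)).enorm.pow_const 2
  calc _ ≤ ∫⁻ x in upperHalf n, ‖z‖ₑ ^ 2 * ∫⁻ σ in Ioc (0 : ℝ) 1, ‖h (x + σ • z)‖ₑ ^ 2 := by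
        refine lintegral_mono_ae ?_
        rw [ae_restrict_iff' (measurableSet_upperHalf n)]
        filter_upwards [hf.translate z] with x hx hxΩ
        by_cases hz : x + z ∈ upperHalf n
        · rw [indicator_of_mem (by exact hz), hx hxΩ hz]
          exact enorm_unitIntegral_inner_sq_le z (hh.comp (by fun_prop))
        · rw [indicator_of_notMem (by exact hz)]
          exact zero_le
    _ ≤ ∫⁻ x, ‖z‖ₑ ^ 2 * ∫⁻ σ in Ioc (0 : ℝ) 1, ‖h (x + σ • z)‖ₑ ^ 2 :=
        setLIntegral_le_lintegral _ _
    _ = ‖z‖ₑ ^ 2 * ∫⁻ σ in Ioc (0 : ℝ) 1, ∫⁻ x, ‖h (x + σ • z)‖ₑ ^ 2 := by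
        rw [lintegral_const_mul _ hg2.lintegral_prod_right', lintegral_lintegral_swap
          hg2.aemeasurable]
    _ = ‖z‖ₑ ^ 2 * ∫⁻ _ in Ioc (0 : ℝ) 1, ∫⁻ x, ‖h x‖ₑ ^ 2 := by
        congr 1
        refine lintegral_congr fun σ => ?_
        exact lintegral_add_right_eq_self (fun x => ‖h x‖ₑ ^ 2) (σ • z)
    _ = _ := by
        rw [setLIntegral_const, Real.volume_Ioc, sub_zero, ENNReal.ofReal_one, mul_one]

open Classical in
/-- The fraction of the segment from height `h` to height `h + a` lying in the half line. -/
noncomputable def insideFrac (h a : ℝ) : ℝ :=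
  ∫ τ in (0 : ℝ)..1, if 0 < h + τ * a then 1 else 0

/-- The product is the change of height accumulated inside the half line: all of `a` if the segment
stays in, and exactly `-h` if it crosses the boundary. -/
theorem insideFrac_mul {h : ℝ} (hh : 0 < h) (a : ℝ) :
    insideFrac h a * a = a + max 0 (-h - a) := by
  rcases le_or_gt 0 (h + a) with ha | ha
  · have h1 : insideFrac h a = 1 := by
      rw [insideFrac, intervalIntegral.integral_of_le zero_le_one, integral_Ioc_eq_integral_Ioo,
        setIntegral_congr_fun (g := fun _ => (1 : ℝ)) measurableSet_Ioo]
      · simp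
      · intro τ hτ
        refine if_pos ?_
        nlinarith [hτ.1, hτ.2, mul_pos hh (sub_pos.2 hτ.2), mul_nonneg hτ.1.le ha]
    rw [h1, max_eq_left (by linarith)]; ring
  · have ha0 : a < 0 := by linarith
    have h1 : insideFrac h a = h / -a := by
      have hpos : 0 < h / -a := div_pos hh (by linarith)
      have hlt : h / -a < 1 := by rw [div_lt_one (by linarith)]; linarith
      have hiff : ∀ τ : ℝ, 0 < h + τ * a ↔ τ < h / -a := fun τ => by
        rw [lt_div_iff₀ (by linarith)]; constructor <;> intro h <;> linarith
      rw [insideFrac, intervalIntegral.integral_of_le zero_le_one]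
      have : (fun τ : ℝ => if 0 < h + τ * a then (1 : ℝ) else 0)
          = (Iio (h / -a)).indicator fun _ => 1 := by
        ext τ; simp only [hiff, indicator, mem_Iio]
      rw [this, setIntegral_indicator measurableSet_Iio]
      have hs : Ioc (0 : ℝ) 1 ∩ Iio (h / -a) = Ioo 0 (h / -a) := by
        ext τ; simp only [mem_inter_iff, mem_Ioc, mem_Iio, mem_Ioo]
        exact ⟨fun h => ⟨h.1.1, h.2⟩, fun h => ⟨⟨h.1, by linarith [h.2]⟩, h.2⟩⟩
      rw [hs]
      simp [hpos.le]
    rw [h1, max_eq_right (by linarith), div_mul_eq_mul_div, div_eq_iff (by linarith)]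
    ring

theorem insideFrac_mem {h a : ℝ} : insideFrac h a ∈ Icc (0 : ℝ) 1 := by
  have := isProbabilityMeasure_unit
  rw [insideFrac, intervalIntegral.integral_of_le zero_le_one]
  constructor
  · exact integral_nonneg fun τ => by positivity
  · refine (integral_mono_of_nonneg (ae_of_all _ fun τ => by positivity)
      (integrable_const (1 : ℝ)) (ae_of_all _ fun τ => ?_)).trans (by simp)
    simp only; split_ifs <;> norm_num

theorem measurable_insideFrac {α : Type*} [MeasurableSpace α] {h a : α → ℝ} (hh : Measurable h)
    (ha : Measurable a) : Measurable fun x => insideFrac (h x) (a x) := by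
  refine measurable_unitIntegral (f := fun x τ => if 0 < h x + τ * a x then 1 else 0) ?_
  unfold Function.uncurry
  exact Measurable.ite (measurableSet_lt measurable_const (by fun_prop)) measurable_const
    measurable_const

/-- The modulus `|w|²` for `|w| ≤ 1`, `|w|` for `|w| > 1`. -/
noncomputable def growth {n : ℕ} (w : Space n) : ℝ := min ‖w‖ (‖w‖ ^ 2)

open Classical in
/-- The part of the increment `lineInt g p w` that is linear in the gradient at `p`. -/
noncomputable def linPart {n : ℕ} (g : ℝ × Space n → Space n) (p : ℝ × Space n)
    (w : Space n) : ℝ :=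
  if ‖w‖ ≤ 1 then insideFrac (p.2 (Fin.last n)) (w (Fin.last n)) * inner ℝ w (g p) else 0

/-- The increment without its linear part. -/
noncomputable def lineRem {n : ℕ} (g : ℝ × Space n → Space n) (p : ℝ × Space n)
    (w : Space n) : ℝ :=
  lineInt g p w - linPart g p w

theorem measurable_linPart {n : ℕ} {g : ℝ × Space n → Space n} (hg : Measurable g) :
    Measurable fun q : (ℝ × Space n) × Space n => linPart g q.1 q.2 := by
  unfold linPart
  refine Measurable.ite (measurableSet_le (by fun_prop) measurable_const) ?_ measurable_const
  exact (measurable_insideFrac (by fun_prop) (by fun_prop)).mul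
    (Measurable.inner (by fun_prop) (hg.comp (by fun_prop)))

theorem measurable_lineRem {n : ℕ} {g : ℝ × Space n → Space n} (hg : Measurable g) :
    Measurable fun q : (ℝ × Space n) × Space n => lineRem g q.1 q.2 :=
  (measurable_lineInt hg measurable_fst measurable_snd).sub (measurable_linPart hg)

open Classical in
-- `insideFrac` is the measure of the `σ` with `x + σw` in `Ω`, so the frozen gradient is subtracted
-- exactly where `g` need not vanish. No jump of the zero extension across the boundary is ever
-- differentiated.
theorem lineRem_eq {n : ℕ} {g : ℝ × Space n → Space n}
    (hg0 : ∀ p : ℝ × Space n, p.2 ∉ upperHalf n → g p = 0) {t : ℝ} {x w : Space n}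
    (hw : ‖w‖ ≤ 1) (hi : IntervalIntegrable (fun σ => inner ℝ w (g (t, x + σ • w))) volume 0 1) :
    lineRem g (t, x) w = ∫ σ in (0 : ℝ)..1, inner ℝ w
      (if x + σ • w ∈ upperHalf n then g (t, x + σ • w) - g (t, x) else 0) := by
  have hm : ∀ σ : ℝ, x + σ • w ∈ upperHalf n ↔ 0 < x (Fin.last n) + σ * w (Fin.last n) :=
    fun σ => by simp [upperHalf]
  rw [lineRem, linPart, if_pos hw, insideFrac, ← intervalIntegral.integral_mul_const, lineInt,
    ← intervalIntegral.integral_sub hi]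
  · refine intervalIntegral.integral_congr fun σ _ => ?_
    simp only [hm]
    split_ifs with hσ
    · rw [inner_sub_right, one_mul]
    · rw [hg0 _ (by rw [hm]; exact hσ)]; simp
  · refine IntervalIntegrable.mul_const ?_ _
    rw [intervalIntegrable_iff]
    refine Measure.integrableOn_of_bounded (M := 1) (by simp) ?_ (ae_of_all _ fun τ => ?_)
    · exact (Measurable.ite (measurableSet_lt measurable_const (by fun_prop)) measurable_const
        measurable_const).aestronglyMeasurable
    · split_ifs <;> simp

theorem growth_nonneg {n : ℕ} (w : Space n) : 0 ≤ growth w :=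
  le_min (norm_nonneg _) (by positivity)

theorem growth_of_le {n : ℕ} {w : Space n} (hw : ‖w‖ ≤ 1) : growth w = ‖w‖ ^ 2 :=
  min_eq_right (by nlinarith [norm_nonneg w])

theorem growth_of_gt {n : ℕ} {w : Space n} (hw : 1 < ‖w‖) : growth w = ‖w‖ :=
  min_eq_left (by nlinarith)

/-- For `‖w‖ ≤ 1`, one factor `‖w‖` comes from the line integral and another from differences of
`g`, controlled by second derivatives; for `‖w‖ > 1` nothing is subtracted and the first derivatives
suffice. -/
theorem lintegral_lineRem_sq_le {n : ℕ} {g : ℝ × Space n → Space n} (hg : Measurable g)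
    (hg0 : ∀ p : ℝ × Space n, p.2 ∉ upperHalf n → g p = 0) {t : ℝ} {C : ℝ≥0}
    (hb : ∫⁻ x, ‖g (t, x)‖ₑ ^ 2 ≤ (C : ℝ≥0∞) ^ 2) {h : Fin (n + 1) → Space n → Space n}
    (hh : ∀ i, Measurable (h i)) (hw : ∀ i, IsWeakGrad (fun x => g (t, x) i) (h i))
    (hs : ∑ i, ∫⁻ x, ‖h i x‖ₑ ^ 2 ≤ (C : ℝ≥0∞) ^ 2) (w : Space n) :
    ∫⁻ x in upperHalf n, ‖lineRem g (t, x) w‖ₑ ^ 2 ≤ (ENNReal.ofReal (growth w) * C) ^ 2 := by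
  classical
  have hgt : Measurable fun x => g (t, x) := hg.comp measurable_prodMk_left
  rcases le_or_gt ‖w‖ 1 with hw1 | hw1
  swap
  · have : ∀ x, lineRem g (t, x) w = lineInt g (t, x) w := fun x => by
      rw [lineRem, linPart, if_neg (not_le.2 hw1), sub_zero]
    simp only [this, growth_of_gt hw1, ofReal_norm]
    exact (setLIntegral_le_lintegral _ _).trans (lintegral_lineInt_sq_le hg hb w)
  rw [growth_of_le hw1, ENNReal.ofReal_pow (norm_nonneg _), ofReal_norm]
  have hfin : ∀ᵐ x, ∫⁻ σ in Ioc (0 : ℝ) 1, ‖g (t, x + σ • w)‖ₑ < ⊤ :=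
    ae_lintegral_comp_lt_top (volume.restrict (Ioc (0 : ℝ) 1)) (f := fun x => g (t, x))
      (T := fun σ x => x + σ • w) (by fun_prop)
      (fun σ => measurePreserving_add_right volume _) hgt
      (ne_top_of_le_ne_top (ENNReal.pow_ne_top ENNReal.coe_ne_top) hb)
  set D : Space n → ℝ → Space n := fun x σ =>
    if x + σ • w ∈ upperHalf n then g (t, x + σ • w) - g (t, x) else 0 with hD
  have hDm : Measurable (Function.uncurry D) := by
    unfold Function.uncurry
    refine Measurable.ite ((measurableSet_upperHalf n).preimage
      (f := fun q : Space n × ℝ => q.1 + q.2 • w) (by fun_prop)) ?_ measurable_const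
    exact (hgt.comp (by fun_prop)).sub (hgt.comp measurable_fst)
  -- Componentwise, the translation estimate for the `H¹` function `g_i` on the points whose
  -- translate stays in `Ω`.
  have hDσ : ∀ σ ∈ Ioc (0 : ℝ) 1,
      ∫⁻ x in upperHalf n, ‖D x σ‖ₑ ^ 2 ≤ ‖w‖ₑ ^ 2 * (C : ℝ≥0∞) ^ 2 := by
    intro σ hσ
    have hσw : ‖σ • w‖ₑ ≤ ‖w‖ₑ := by
      rw [enorm_le_iff_norm_le, norm_smul, Real.norm_of_nonneg hσ.1.le]
      exact mul_le_of_le_one_left (norm_nonneg _) hσ.2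
    calc ∫⁻ x in upperHalf n, ‖D x σ‖ₑ ^ 2
        = ∫⁻ x in upperHalf n, ∑ i, ((fun x => x + σ • w) ⁻¹' (upperHalf n)).indicator
          (fun x => ‖g (t, x + σ • w) i - g (t, x) i‖ₑ ^ 2) x := by
          refine lintegral_congr fun x => ?_
          by_cases hx : x + σ • w ∈ upperHalf n
          · simp only [hD, if_pos hx]
            rw [enorm_sq_eq_sum]
            refine Finset.sum_congr rfl fun i _ => ?_
            rw [indicator_of_mem (by exact hx)]
            simp
          · simp only [hD, if_neg hx]
            rw [Finset.sum_eq_zero fun i _ => indicator_of_notMem (by exact hx) _]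
            simp
      _ = ∑ i, ∫⁻ x in upperHalf n, ((fun x => x + σ • w) ⁻¹' (upperHalf n)).indicator
          (fun x => ‖g (t, x + σ • w) i - g (t, x) i‖ₑ ^ 2) x := by
          refine lintegral_finsetSum _ fun i _ => ?_
          refine Measurable.indicator ?_ ((measurableSet_upperHalf n).preimage (by fun_prop))
          have h1 : Measurable fun x => g (t, x) i := (continuous_coord i).measurable.comp hgt
          exact ((h1.comp (by fun_prop)).sub h1).enorm.pow_const 2
      _ ≤ ∑ i, ‖w‖ₑ ^ 2 * ∫⁻ x, ‖h i x‖ₑ ^ 2 := by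
          refine Finset.sum_le_sum fun i _ => ?_
          refine ((hw i).lintegral_translate_sq_le (hh i) (σ • w)).trans ?_
          gcongr
      _ ≤ _ := by
          rw [← Finset.mul_sum]
          gcongr
  calc ∫⁻ x in upperHalf n, ‖lineRem g (t, x) w‖ₑ ^ 2
      ≤ ∫⁻ x in upperHalf n, ‖w‖ₑ ^ 2 * ∫⁻ σ in Ioc (0 : ℝ) 1, ‖D x σ‖ₑ ^ 2 := by
        refine lintegral_mono_ae (ae_restrict_of_ae ?_)
        filter_upwards [hfin] with x hx
        rw [lineRem_eq hg0 hw1 ?_]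
        · exact enorm_unitIntegral_inner_sq_le w (f := D x) (hDm.comp measurable_prodMk_left)
        · rw [intervalIntegrable_iff_integrableOn_Ioc_of_le zero_le_one]
          have hi : IntegrableOn (fun σ => g (t, x + σ • w)) (Ioc (0 : ℝ) 1) :=
            ⟨(hgt.comp (by fun_prop)).aestronglyMeasurable, hx⟩
          exact hi.const_inner _
    _ = ‖w‖ₑ ^ 2 * ∫⁻ σ in Ioc (0 : ℝ) 1, ∫⁻ x in upperHalf n, ‖D x σ‖ₑ ^ 2 := by
        have hm2 : Measurable fun q : Space n × ℝ => ‖D q.1 q.2‖ₑ ^ 2 := hDm.enorm.pow_const 2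
        rw [lintegral_const_mul _ hm2.lintegral_prod_right', lintegral_lintegral_swap
          hm2.aemeasurable]
    _ ≤ ‖w‖ₑ ^ 2 * ∫⁻ _ in Ioc (0 : ℝ) 1, ‖w‖ₑ ^ 2 * (C : ℝ≥0∞) ^ 2 := by
        gcongr 1
        exact setLIntegral_mono' measurableSet_Ioc hDσ
    _ = _ := by
        rw [setLIntegral_const, Real.volume_Ioc, sub_zero, ENNReal.ofReal_one, mul_one]
        ring

theorem lintegral_volTime_le {n : ℕ} {T : ℝ} (hT : 0 < T) {f : ℝ × Space n → ℝ≥0∞}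
    (hf : Measurable f) {a : ℝ≥0∞}
    (h : ∀ᵐ t ∂(volume.restrict (Ioi (0 : ℝ))), ∫⁻ x in upperHalf n, f (t, x) ≤ a ^ 2) :
    ∫⁻ p, f p ∂(volTime n (Ioo 0 T)) ≤ (a * ENNReal.ofReal √T) ^ 2 := by
  unfold volTime
  rw [lintegral_prod _ hf.aemeasurable]
  calc _ ≤ ∫⁻ _ in Ioo 0 T, a ^ 2 :=
        lintegral_mono_ae (ae_restrict_of_ae_restrict_of_subset Ioo_subset_Ioi_self h)
    _ = _ := by
        rw [setLIntegral_const, Real.volume_Ioo, sub_zero, mul_pow, ← ENNReal.ofReal_pow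
          (Real.sqrt_nonneg _), Real.sq_sqrt hT.le]

theorem IsGradRep.lintegral_lineRem_sq_le {n : ℕ} {ψ : ℝ → Space n → ℝ} {U : ℝ × Space n → ℝ}
    {g : ℝ × Space n → Space n} {C : ℝ≥0} (h : IsGradRep ψ U g C) {T : ℝ} (hT : 0 < T)
    (w : Space n) :
    ∫⁻ p, ‖lineRem g p w‖ₑ ^ 2 ∂(volTime n (Ioo 0 T))
      ≤ (ENNReal.ofReal (growth w) * (C * ENNReal.ofReal √T)) ^ 2 := by
  rw [← mul_assoc]
  refine lintegral_volTime_le hT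
    (((measurable_lineRem h.meas_grad).comp measurable_prodMk_right).enorm.pow_const 2) ?_
  filter_upwards [h.bound, h.second] with t ht1 ht2
  obtain ⟨d, hd1, hd2, hd3⟩ := ht2
  exact FracDiff.lintegral_lineRem_sq_le h.meas_grad h.grad_zero ht1 hd1 hd2 hd3 w

/-! ### Radial kernels and the boundary coefficient -/

/-- A nonnegative kernel, invariant under linear isometries, whose first moment near the origin
is finite. -/
structure IsRadialKernel {n : ℕ} (K : Space n → ℝ) : Prop where
  meas : Measurable K
  nonneg : ∀ w, 0 ≤ K w
  symm : ∀ e : Space n ≃ₗᵢ[ℝ] Space n, ∀ᵐ w, K (e w) = K w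
  moment : IntegrableOn (fun w => K w * ‖w‖) {w | ‖w‖ ≤ 1}

/-- The coefficient of the normal derivative, at distance `h` from the boundary, in the integral
of the extension against `K`. -/
noncomputable def bdCoeff {n : ℕ} (K : Space n → ℝ) (h : ℝ) : ℝ :=
  ∫ w in {w : Space n | ‖w‖ ≤ 1}, K w * max 0 (-h - w (Fin.last n))

theorem measurableSet_unitBall (n : ℕ) : MeasurableSet {w : Space n | ‖w‖ ≤ 1} :=
  measurableSet_le measurable_norm measurable_const

/-- The reflection fixing the normal direction. -/
noncomputable def tangRefl (n : ℕ) : Space n ≃ₗᵢ[ℝ] Space n :=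
  (Submodule.span ℝ {basisVec n (Fin.last n)}).reflection

theorem tangRefl_apply {n : ℕ} (w : Space n) :
    tangRefl n w = (2 * w (Fin.last n)) • basisVec n (Fin.last n) - w := by
  rw [tangRefl, Submodule.reflection_apply, Submodule.starProjection_unit_singleton]
  · simp [basisVec, EuclideanSpace.inner_single_left, mul_smul, two_smul]
  · simp [basisVec]

theorem IsRadialKernel.integrableOn_mul {n : ℕ} {K : Space n → ℝ} (hK : IsRadialKernel K)
    {f : Space n → ℝ} (hf : Measurable f) {c : ℝ} (hfc : ∀ w, ‖w‖ ≤ 1 → |f w| ≤ c * ‖w‖) :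
    IntegrableOn (fun w => K w * f w) {w | ‖w‖ ≤ 1} := by
  refine Integrable.mono' (hK.moment.const_mul c) (hK.meas.mul hf).aestronglyMeasurable ?_
  rw [ae_restrict_iff' (measurableSet_unitBall n)]
  refine ae_of_all _ fun w hw => ?_
  rw [norm_mul, Real.norm_of_nonneg (hK.nonneg w), Real.norm_eq_abs]
  calc K w * |f w| ≤ K w * (c * ‖w‖) := mul_le_mul_of_nonneg_left (hfc w hw) (hK.nonneg w)
    _ = c * (K w * ‖w‖) := by ring

theorem IsRadialKernel.setIntegral_comp {n : ℕ} {K : Space n → ℝ} (hK : IsRadialKernel K)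
    (e : Space n ≃ₗᵢ[ℝ] Space n) (f : Space n → ℝ) :
    ∫ w in {w : Space n | ‖w‖ ≤ 1}, K w * f (e w) = ∫ w in {w : Space n | ‖w‖ ≤ 1}, K w * f w := by
  have h1 := (e.measurePreserving).setIntegral_preimage_emb
    e.toHomeomorph.measurableEmbedding (fun w => K w * f w) {w | ‖w‖ ≤ 1}
  have h2 : e ⁻¹' {w : Space n | ‖w‖ ≤ 1} = {w | ‖w‖ ≤ 1} := by ext w; simp
  rw [h2] at h1
  rw [← h1]
  refine integral_congr_ae (ae_restrict_of_ae ?_)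
  filter_upwards [hK.symm e] with w hw
  rw [hw]

theorem abs_max_sub_le {n : ℕ} {h : ℝ} (hh : 0 < h) (w : Space n) :
    |max 0 (-h - w (Fin.last n))| ≤ 1 * ‖w‖ := by
  rw [abs_of_nonneg (le_max_left _ _), one_mul]
  refine max_le (norm_nonneg _) ?_
  have := abs_le.1 (abs_coord_le_norm w (Fin.last n))
  linarith

/-- Averaging over the reflection that fixes the normal kills the tangential part of `w`, since
`insideFrac` depends on `w_N` only. What is left is `insideFrac · w_N = w_N + (-h-w_N)₊`, whose
first term is odd. -/
theorem IsRadialKernel.integral_linPart {n : ℕ} {K : Space n → ℝ} (hK : IsRadialKernel K)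
    {g : ℝ × Space n → Space n} {p : ℝ × Space n} (hp : p.2 ∈ upperHalf n) :
    Integrable (fun w => K w * linPart g p w) ∧
      ∫ w, K w * linPart g p w = g p (Fin.last n) * bdCoeff K (p.2 (Fin.last n)) := by
  set h := p.2 (Fin.last n) with hh
  have hh0 : 0 < h := hp
  set G := g p with hG
  have hB := measurableSet_unitBall n
  have hind : (fun w => K w * linPart g p w) = indicator {w : Space n | ‖w‖ ≤ 1}
      (fun w => K w * (insideFrac h (w (Fin.last n)) * inner ℝ w G)) := by
    ext w
    by_cases hw : ‖w‖ ≤ 1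
    · rw [indicator_of_mem (by exact hw), linPart, if_pos hw]
    · rw [indicator_of_notMem (by exact hw), linPart, if_neg hw, mul_zero]
  have hfm : Measurable fun w : Space n => insideFrac h (w (Fin.last n)) :=
    measurable_insideFrac measurable_const (by fun_prop)
  have habs : ∀ a, |insideFrac h a| ≤ 1 := fun a => by
    have := @insideFrac_mem h a
    rw [abs_of_nonneg this.1]; exact this.2
  have i1 : IntegrableOn (fun w => K w * (insideFrac h (w (Fin.last n)) * inner ℝ w G))
      {w | ‖w‖ ≤ 1} := by
    refine hK.integrableOn_mul (c := ‖G‖) (hfm.mul (by fun_prop)) fun w _ => ?_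
    rw [abs_mul]
    calc _ ≤ 1 * (‖w‖ * ‖G‖) := mul_le_mul (habs _) (abs_real_inner_le_norm w G) (abs_nonneg _)
          zero_le_one
      _ = _ := by ring
  have i2 : IntegrableOn (fun w => K w *
      (insideFrac h (w (Fin.last n)) * inner ℝ (tangRefl n w) G)) {w | ‖w‖ ≤ 1} := by
    refine hK.integrableOn_mul (c := ‖G‖) (hfm.mul
      (((tangRefl n).continuous.inner continuous_const).measurable)) fun w _ => ?_
    rw [abs_mul]
    calc _ ≤ 1 * (‖tangRefl n w‖ * ‖G‖) :=
          mul_le_mul (habs _) (abs_real_inner_le_norm _ G) (abs_nonneg _) zero_le_one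
      _ = _ := by rw [LinearIsometryEquiv.norm_map]; ring
  have i3 : IntegrableOn (fun w : Space n => K w * w (Fin.last n)) {w | ‖w‖ ≤ 1} :=
    hK.integrableOn_mul (c := 1) (by fun_prop) fun w _ => by
      rw [one_mul]; exact abs_coord_le_norm w _
  have i4 : IntegrableOn (fun w : Space n => K w * max 0 (-h - w (Fin.last n))) {w | ‖w‖ ≤ 1} :=
    hK.integrableOn_mul (c := 1) (by fun_prop) fun w _ => abs_max_sub_le hh0 w
  have e1 : ∫ w in {w : Space n | ‖w‖ ≤ 1}, K w * w (Fin.last n) = 0 := by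
    have := hK.setIntegral_comp (LinearIsometryEquiv.neg ℝ) (fun w => w (Fin.last n))
    simp only [LinearIsometryEquiv.coe_neg, PiLp.neg_apply, mul_neg, integral_neg] at this
    linarith
  have e2 := hK.setIntegral_comp (tangRefl n)
    (fun w => insideFrac h (w (Fin.last n)) * inner ℝ w G)
  have e3 : ∀ w : Space n, (tangRefl n w) (Fin.last n) = w (Fin.last n) := fun w => by
    rw [tangRefl_apply]; simp [basisVec]; ring
  simp only [e3] at e2
  have e4 : (∫ w in {w : Space n | ‖w‖ ≤ 1},
        K w * (insideFrac h (w (Fin.last n)) * inner ℝ (tangRefl n w) G)) +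
      ∫ w in {w : Space n | ‖w‖ ≤ 1}, K w * (insideFrac h (w (Fin.last n)) * inner ℝ w G)
      = 2 * (G (Fin.last n) * bdCoeff K h) := by
    rw [← integral_add i2 i1]
    have e5 : ∀ w : Space n, K w * (insideFrac h (w (Fin.last n)) * inner ℝ (tangRefl n w) G) +
        K w * (insideFrac h (w (Fin.last n)) * inner ℝ w G)
        = (2 * G (Fin.last n)) * (K w * w (Fin.last n) + K w * max 0 (-h - w (Fin.last n))) := by
      intro w
      have h1 : inner ℝ (tangRefl n w) G + inner ℝ w G = 2 * w (Fin.last n) * G (Fin.last n) := by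
        rw [← inner_add_left, tangRefl_apply, sub_add_cancel, real_inner_smul_left, basisVec,
          EuclideanSpace.inner_single_left]
        simp
      rw [← mul_add, ← mul_add, ← mul_add, h1, ← insideFrac_mul hh0]
      ring
    simp only [e5]
    rw [integral_const_mul, integral_add i3 i4, e1, bdCoeff]
    ring
  rw [hind]
  refine ⟨i1.integrable_indicator hB, ?_⟩
  rw [integral_indicator hB]
  linarith

/-- The integral of the increments against a radial kernel. -/
theorem IsRadialKernel.integral_lineInt {n : ℕ} {K : Space n → ℝ} (hK : IsRadialKernel K)
    {g : ℝ × Space n → Space n} {p : ℝ × Space n} (hp : p.2 ∈ upperHalf n)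
    (hr : Integrable fun w => K w * lineRem g p w) :
    Integrable (fun w => K w * lineInt g p w) ∧
      ∫ w, K w * lineInt g p w = (∫ w, K w * lineRem g p w)
        + g p (Fin.last n) * bdCoeff K (p.2 (Fin.last n)) := by
  obtain ⟨h1, h2⟩ := hK.integral_linPart (g := g) hp
  have e : (fun w => K w * lineInt g p w)
      = fun w => K w * lineRem g p w + K w * linPart g p w := by
    ext w; rw [lineRem]; ring
  rw [e]
  exact ⟨hr.add h1, by rw [integral_add hr h1, h2]⟩

/-! ### The homogeneous kernel and the kernel of `𝓛^ε` -/

/-- The homogeneous kernel `|w|^{-(N+2s)}`. -/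
noncomputable def homKer {n : ℕ} (s : ℝ) (w : Space n) : ℝ :=
  (‖w‖ ^ ((n : ℝ) + 1 + 2 * s))⁻¹

theorem homKer_nonneg {n : ℕ} (s : ℝ) (w : Space n) : 0 ≤ homKer s w := by
  unfold homKer; positivity

theorem measurable_homKer {n : ℕ} (s : ℝ) : Measurable (homKer (n := n) s) := by
  unfold homKer; fun_prop

theorem homKer_inv_smul {n : ℕ} {s r : ℝ} (hr : 0 < r) (w : Space n) :
    homKer s (r⁻¹ • w) = r ^ (n + 1) * r ^ (2 * s) * homKer s w := by
  unfold homKer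
  rw [norm_smul, norm_inv, Real.norm_of_nonneg hr.le, Real.mul_rpow (by positivity)
    (norm_nonneg _), mul_inv, Real.inv_rpow hr.le, inv_inv, Real.rpow_add hr]
  congr 2
  exact_mod_cast Real.rpow_natCast r (n + 1)

/-- In polar coordinates the radial density is `r^{1-2s}` on `(0,1]`, integrable as `s < 1`, and
`r^{-2s}` beyond, integrable as `s > 1/2`. -/
theorem integrable_homKer_mul_growth {n : ℕ} {s : ℝ} (hs : 1 / 2 < s) (hs' : s < 1) :
    Integrable fun w : Space n => homKer s w * growth w := by
  have h := (integrable_fun_norm_addHaar (volume : Measure (Space n))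
    (f := fun y : ℝ => (y ^ ((n : ℝ) + 1 + 2 * s))⁻¹ * min y (y ^ 2))).2 ?_
  · exact h
  rw [← Ioc_union_Ioi_eq_Ioi zero_le_one]
  have hdim : Module.finrank ℝ (Space n) - 1 = n := by simp
  rw [hdim]
  refine IntegrableOn.union ?_ ?_
  · have h1 : IntegrableOn (fun y : ℝ => y ^ (1 - 2 * s)) (Ioc 0 1) := by
      rw [integrableOn_Ioc_iff_integrableOn_Ioo]
      exact (intervalIntegral.integrableOn_Ioo_rpow_iff one_pos).2 (by linarith)
    refine h1.congr_fun (fun y hy => ?_) measurableSet_Ioc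
    simp only [smul_eq_mul]
    rw [min_eq_right (by nlinarith [hy.1, hy.2]), ← Real.rpow_neg hy.1.le, ← Real.rpow_natCast y n,
      ← Real.rpow_natCast y 2, ← Real.rpow_add hy.1, ← Real.rpow_add hy.1]
    congr 1
    push_cast; ring
  · have h1 : IntegrableOn (fun y : ℝ => y ^ (-2 * s)) (Ioi 1) :=
      integrableOn_Ioi_rpow_of_lt (by linarith) one_pos
    refine h1.congr_fun (fun y hy => ?_) measurableSet_Ioi
    have hy0 : (0 : ℝ) < y := one_pos.trans hy
    have hy1 : (1 : ℝ) < y := hy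
    simp only [smul_eq_mul]
    rw [min_eq_left (by nlinarith), ← Real.rpow_neg hy0.le, ← Real.rpow_natCast y n]
    nth_rewrite 4 [← Real.rpow_one y]
    rw [← Real.rpow_add hy0, ← Real.rpow_add hy0]
    congr 1
    ring

/-- A velocity weight dominated by the homogeneous kernel. -/
structure IsWeight {n : ℕ} (s c : ℝ) (F : Space n → ℝ) : Prop where
  meas : Measurable F
  nonneg : ∀ v, 0 ≤ F v
  le : ∀ v, F v ≤ c * homKer s v
  integrable : Integrable F
  symm : ∀ e : Space n ≃ₗᵢ[ℝ] Space n, ∀ᵐ v, F (e v) = F v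

/-- The density in `(w, z)` of the kernel of `𝓛^ε`. -/
noncomputable def epsDensity {n : ℕ} (s ν₀ : ℝ) (F : Space n → ℝ) (ε : ℝ) (w : Space n)
    (z : ℝ) : ℝ :=
  ν₀ ^ 2 * Real.exp (-ν₀ * z) * (ε ^ (-2 * s) * ((ε * z) ^ (n + 1))⁻¹ * F ((ε * z)⁻¹ • w))

/-- The kernel of `𝓛^ε` after the change of variables `w = ε z v`. -/
noncomputable def epsKer {n : ℕ} (s ν₀ : ℝ) (F : Space n → ℝ) (ε : ℝ) (w : Space n) : ℝ :=
  ∫ z in Ioi (0 : ℝ), epsDensity s ν₀ F ε w z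

section kernel

variable {n : ℕ} {s c ν₀ ε : ℝ} {F : Space n → ℝ}

theorem measurable_epsDensity (hF : IsWeight s c F) :
    Measurable (Function.uncurry (epsDensity s ν₀ F ε)) := by
  have h1 : Measurable fun q : Space n × ℝ => F ((ε * q.2)⁻¹ • q.1) := hF.meas.comp (by fun_prop)
  have h2 : Measurable fun q : Space n × ℝ => ν₀ ^ 2 * Real.exp (-ν₀ * q.2) *
      (ε ^ (-2 * s) * ((ε * q.2) ^ (n + 1))⁻¹ * F ((ε * q.2)⁻¹ • q.1)) :=
    Measurable.mul (by fun_prop) (Measurable.mul (by fun_prop) h1)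
  exact h2

theorem epsDensity_nonneg (hF : IsWeight s c F) (hε : 0 < ε) {z : ℝ} (hz : 0 < z) (w : Space n) :
    0 ≤ epsDensity s ν₀ F ε w z := by
  have := hF.nonneg ((ε * z)⁻¹ • w)
  unfold epsDensity; positivity

/-- The normalisation `ε^{-2s}` is the one for which all powers of `ε` cancel; this makes the kernel
bounds uniform in `ε`. -/
theorem scaling_identity (hε : 0 < ε) {z : ℝ} (hz : 0 < z) (w : Space n) :
    ε ^ (-2 * s) * ((ε * z) ^ (n + 1))⁻¹ * homKer s ((ε * z)⁻¹ • w)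
      = z ^ (2 * s) * homKer s w := by
  have hεz := mul_pos hε hz
  rw [homKer_inv_smul hεz, Real.mul_rpow hε.le hz.le, neg_mul, Real.rpow_neg hε.le]
  have h1 : ε ^ (2 * s) ≠ 0 := (Real.rpow_pos_of_pos hε _).ne'
  field_simp

theorem epsDensity_le (hF : IsWeight s c F) (hε : 0 < ε) {z : ℝ} (hz : 0 < z)
    (w : Space n) :
    epsDensity s ν₀ F ε w z
      ≤ c * ν₀ ^ 2 * homKer s w * (z ^ (2 * s) * Real.exp (-ν₀ * z)) := by
  unfold epsDensity
  have h1 := mul_le_mul_of_nonneg_left (hF.le ((ε * z)⁻¹ • w))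
    (show 0 ≤ ε ^ (-2 * s) * ((ε * z) ^ (n + 1))⁻¹ by positivity)
  calc _ ≤ ν₀ ^ 2 * Real.exp (-ν₀ * z) *
        (ε ^ (-2 * s) * ((ε * z) ^ (n + 1))⁻¹ * (c * homKer s ((ε * z)⁻¹ • w))) :=
        mul_le_mul_of_nonneg_left h1 (by positivity)
    _ = ν₀ ^ 2 * Real.exp (-ν₀ * z) * (c * (ε ^ (-2 * s) * ((ε * z) ^ (n + 1))⁻¹ *
          homKer s ((ε * z)⁻¹ • w))) := by ring
    _ = _ := by rw [scaling_identity hε hz]; ring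

theorem integrableOn_rpow_mul_exp (hν : 0 < ν₀) {a : ℝ} (ha : 0 ≤ a) :
    IntegrableOn (fun z : ℝ => z ^ a * Real.exp (-ν₀ * z)) (Ioi 0) := by
  have := integrableOn_rpow_mul_exp_neg_mul_rpow (p := 1) (s := a) (b := ν₀) (by linarith)
    one_pos hν
  simpa only [Real.rpow_one] using this

theorem integral_rpow_mul_exp (hν : 0 < ν₀) (hs : 0 < s) :
    ∫ z in Ioi (0 : ℝ), z ^ (2 * s) * Real.exp (-ν₀ * z)
      = ν₀ ^ (-1 - 2 * s) * Real.Gamma (2 * s + 1) := by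
  have := Real.integral_rpow_mul_exp_neg_mul_Ioi (a := 2 * s + 1) (by linarith) hν
  simp only [add_sub_cancel_right, ← neg_mul] at this
  rw [this, one_div, Real.inv_rpow hν.le, ← Real.rpow_neg hν.le]
  congr 2; ring

theorem integrableOn_epsDensity (hF : IsWeight s c F) (hs : 0 < s) (hν : 0 < ν₀) (hε : 0 < ε)
    (w : Space n) : IntegrableOn (epsDensity s ν₀ F ε w) (Ioi 0) := by
  refine Integrable.mono' ((integrableOn_rpow_mul_exp hν (by linarith : 0 ≤ 2 * s)).const_mul
    (c * ν₀ ^ 2 * homKer s w)) ((measurable_epsDensity hF).comp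
      measurable_prodMk_left).aestronglyMeasurable ?_
  filter_upwards [ae_restrict_mem measurableSet_Ioi] with z hz
  rw [Real.norm_of_nonneg (epsDensity_nonneg hF hε hz w)]
  exact epsDensity_le hF hε hz w

theorem measurable_epsKer (hF : IsWeight s c F) : Measurable (epsKer s ν₀ F ε) :=
  ((measurable_epsDensity hF).stronglyMeasurable.integral_prod_right'
    (ν := volume.restrict (Ioi (0 : ℝ)))).measurable

theorem epsKer_nonneg (hF : IsWeight s c F) (hε : 0 < ε) (w : Space n) :
    0 ≤ epsKer s ν₀ F ε w :=
  setIntegral_nonneg measurableSet_Ioi fun _ hz => epsDensity_nonneg hF hε hz w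

theorem epsKer_le (hF : IsWeight s c F) (hs : 0 < s) (hν : 0 < ν₀) (hε : 0 < ε) (w : Space n) :
    epsKer s ν₀ F ε w
      ≤ c * ν₀ ^ 2 * (ν₀ ^ (-1 - 2 * s) * Real.Gamma (2 * s + 1)) * homKer s w := by
  have := setIntegral_mono_on (integrableOn_epsDensity hF hs hν hε w)
    ((integrableOn_rpow_mul_exp hν (by linarith : 0 ≤ 2 * s)).const_mul
      (c * ν₀ ^ 2 * homKer s w)) measurableSet_Ioi (fun z hz => epsDensity_le hF hε hz w)
  rw [integral_const_mul, integral_rpow_mul_exp hν hs] at this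
  refine this.trans (le_of_eq ?_)
  ring

/-- Invariance of the weight holds only almost everywhere; dilation by `(εz)⁻¹` preserves null sets
for each `z`, and Fubini exchanges `z` and `w`. -/
theorem epsKer_symm (hF : IsWeight s c F) (e : Space n ≃ₗᵢ[ℝ] Space n) (hε : 0 < ε) :
    ∀ᵐ w, epsKer s ν₀ F ε (e w) = epsKer s ν₀ F ε w := by
  have he : Measurable fun q : Space n × ℝ => e q.1 := e.continuous.measurable.comp measurable_fst
  have hse : Measurable fun q : Space n × ℝ => (ε * q.2)⁻¹ • e q.1 := by fun_prop
  have hS : MeasurableSet {q : Space n × ℝ | F ((ε * q.2)⁻¹ • e q.1) = F ((ε * q.2)⁻¹ • q.1)} :=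
    measurableSet_eq_fun (hF.meas.comp hse) (hF.meas.comp (by fun_prop))
  have h1 : ∀ᵐ w : Space n, ∀ᵐ z ∂(volume.restrict (Ioi (0 : ℝ))),
      F ((ε * z)⁻¹ • e w) = F ((ε * z)⁻¹ • w) := by
    rw [Measure.ae_ae_comm hS]
    filter_upwards [ae_restrict_mem measurableSet_Ioi] with z hz
    have hq : Measure.QuasiMeasurePreserving (fun w : Space n => (ε * z)⁻¹ • w) volume volume :=
      Measure.quasiMeasurePreserving_smul volume (inv_ne_zero (mul_pos hε hz).ne')
    filter_upwards [hq.ae (hF.symm e)] with w hw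
    rw [← hw, map_smul]
  filter_upwards [h1] with w hw
  refine integral_congr_ae ?_
  filter_upwards [hw] with z hz
  simp only [epsDensity, hz]

/-- The weight of `(v, z)` in `𝓛^ε`. -/
noncomputable def velWeight (s ν₀ : ℝ) (F : Space n → ℝ) (ε : ℝ) (q : Space n × ℝ) : ℝ :=
  F q.1 * (ν₀ ^ 2 * Real.exp (-ν₀ * q.2) * ε ^ (-2 * s))

theorem measurable_velWeight (hF : IsWeight s c F) : Measurable (velWeight s ν₀ F ε) := by
  unfold velWeight
  have := hF.meas
  fun_prop

theorem velWeight_nonneg (hF : IsWeight s c F) (hε : 0 < ε) (q : Space n × ℝ) :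
    0 ≤ velWeight s ν₀ F ε q := by
  have := hF.nonneg q.1
  unfold velWeight; positivity

theorem lintegral_velWeight (hF : IsWeight s c F) (hs : 0 < s) (hν : 0 < ν₀) (hε : 0 < ε)
    {f : Space n → ℝ≥0∞} (hf : Measurable f) :
    ∫⁻ q, ENNReal.ofReal (velWeight s ν₀ F ε q) * f ((ε * q.2) • q.1)
        ∂((volume : Measure (Space n)).prod (volume.restrict (Ioi (0 : ℝ))))
      = ∫⁻ w, ENNReal.ofReal (epsKer s ν₀ F ε w) * f w := by
  have hm1 : Measurable fun q : Space n × ℝ =>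
      ENNReal.ofReal (velWeight s ν₀ F ε q) * f ((ε * q.2) • q.1) :=
    (measurable_velWeight hF).ennreal_ofReal.mul (hf.comp (by fun_prop))
  have hm2 : Measurable fun q : Space n × ℝ =>
      ENNReal.ofReal (epsDensity s ν₀ F ε q.1 q.2) * f q.1 :=
    (measurable_epsDensity hF).ennreal_ofReal.mul (hf.comp measurable_fst)
  rw [lintegral_prod_symm _ hm1.aemeasurable]
  have h1 : ∀ z ∈ Ioi (0 : ℝ),
      ∫⁻ v, ENNReal.ofReal (velWeight s ν₀ F ε (v, z)) * f ((ε * z) • v)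
        = ∫⁻ w, ENNReal.ofReal (epsDensity s ν₀ F ε w z) * f w := by
    intro z hz
    have hz0 : (0 : ℝ) < z := hz
    have hεz := mul_pos hε hz0
    have hmap := Measure.map_addHaar_smul (volume : Measure (Space n)) hεz.ne'
    set H : Space n → ℝ≥0∞ := fun w =>
      ENNReal.ofReal (velWeight s ν₀ F ε ((ε * z)⁻¹ • w, z)) * f w with hH
    have hHm : Measurable H :=
      ((measurable_velWeight hF).comp (by fun_prop)).ennreal_ofReal.mul hf
    have e1 : ∀ v, ENNReal.ofReal (velWeight s ν₀ F ε (v, z)) * f ((ε * z) • v)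
        = H ((ε * z) • v) := fun v => by
      simp only [hH]
      rw [inv_smul_smul₀ hεz.ne']
    simp only [e1]
    rw [← lintegral_map hHm (measurable_const_smul _), hmap, lintegral_smul_measure, smul_eq_mul,
      ← lintegral_const_mul _ hHm]
    refine lintegral_congr fun w => ?_
    simp only [hH]
    rw [← mul_assoc, ← ENNReal.ofReal_mul (abs_nonneg _)]
    congr 2
    rw [abs_of_pos (by positivity)]
    simp only [velWeight, epsDensity, finrank_euclideanSpace, Fintype.card_fin]
    ring
  rw [setLIntegral_congr_fun measurableSet_Ioi h1, ← lintegral_lintegral_swap hm2.aemeasurable]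
  refine lintegral_congr fun w => ?_
  have hmd : Measurable fun z => ENNReal.ofReal (epsDensity s ν₀ F ε w z) :=
    ((measurable_epsDensity hF).comp measurable_prodMk_left).ennreal_ofReal
  rw [lintegral_mul_const _ hmd, epsKer,
    ofReal_integral_eq_lintegral_ofReal (integrableOn_epsDensity hF hs hν hε w)]
  filter_upwards [ae_restrict_mem measurableSet_Ioi] with z hz using epsDensity_nonneg hF hε hz w

/-- The substitution `w = εzv` as an image of measures, so that integrability and the value of
signed integrals transfer together. -/
theorem map_velWeight (hF : IsWeight s c F) (hs : 0 < s) (hν : 0 < ν₀) (hε : 0 < ε) :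
    (((volume : Measure (Space n)).prod (volume.restrict (Ioi (0 : ℝ)))).withDensity
      fun q => ENNReal.ofReal (velWeight s ν₀ F ε q)).map (fun q => (ε * q.2) • q.1)
      = volume.withDensity fun w => ENNReal.ofReal (epsKer s ν₀ F ε w) := by
  refine Measure.ext_of_lintegral _ fun f hf => ?_
  have hm : Measurable fun q : Space n × ℝ => (ε * q.2) • q.1 := by fun_prop
  have hfm : Measurable fun q : Space n × ℝ => f ((ε * q.2) • q.1) := hf.comp hm
  rw [lintegral_map hf hm, lintegral_withDensity_eq_lintegral_mul _
    (measurable_velWeight hF).ennreal_ofReal hfm,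
    lintegral_withDensity_eq_lintegral_mul _ (measurable_epsKer hF).ennreal_ofReal hf]
  exact lintegral_velWeight hF hs hν hε hf

theorem integrable_velWeight (hF : IsWeight s c F) (hs : 0 < s) (hν : 0 < ν₀) (hε : 0 < ε)
    {f : Space n → ℝ} (hf : Measurable f) (hi : Integrable fun w => epsKer s ν₀ F ε w * f w) :
    Integrable (fun q : Space n × ℝ => velWeight s ν₀ F ε q * f ((ε * q.2) • q.1))
      ((volume : Measure (Space n)).prod (volume.restrict (Ioi (0 : ℝ)))) ∧
    ∫ q, velWeight s ν₀ F ε q * f ((ε * q.2) • q.1)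
      ∂((volume : Measure (Space n)).prod (volume.restrict (Ioi (0 : ℝ))))
      = ∫ w, epsKer s ν₀ F ε w * f w := by
  have hm : Measurable fun q : Space n × ℝ => (ε * q.2) • q.1 := by fun_prop
  have hv : ∀ q : Space n × ℝ, (ENNReal.ofReal (velWeight s ν₀ F ε q)).toReal
      = velWeight s ν₀ F ε q := fun q => ENNReal.toReal_ofReal (velWeight_nonneg hF hε q)
  have hk : ∀ w : Space n, (ENNReal.ofReal (epsKer s ν₀ F ε w)).toReal
      = epsKer s ν₀ F ε w := fun w => ENNReal.toReal_ofReal (epsKer_nonneg hF hε w)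
  have h1 := integrable_withDensity_iff_integrable_smul' (μ := (volume : Measure (Space n)))
    (f := fun w => ENNReal.ofReal (epsKer s ν₀ F ε w)) (measurable_epsKer hF).ennreal_ofReal
    (ae_of_all _ fun w => ENNReal.ofReal_lt_top) (g := f)
  have h2 := integrable_withDensity_iff_integrable_smul'
    (μ := (volume : Measure (Space n)).prod (volume.restrict (Ioi (0 : ℝ))))
    (f := fun q => ENNReal.ofReal (velWeight s ν₀ F ε q)) (measurable_velWeight hF).ennreal_ofReal
    (ae_of_all _ fun w => ENNReal.ofReal_lt_top) (g := fun q => f ((ε * q.2) • q.1))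
  simp only [hv, hk, smul_eq_mul] at h1 h2
  have h3 := h1.2 hi
  rw [← map_velWeight hF hs hν hε] at h3
  refine ⟨h2.1 (h3.comp_measurable hm), ?_⟩
  have h4 := integral_map (f := f) hm.aemeasurable
    (μ := ((volume : Measure (Space n)).prod (volume.restrict (Ioi (0 : ℝ)))).withDensity
      fun q => ENNReal.ofReal (velWeight s ν₀ F ε q)) hf.aestronglyMeasurable
  rw [map_velWeight hF hs hν hε, integral_withDensity_eq_integral_toReal_smul
    (measurable_epsKer hF).ennreal_ofReal (ae_of_all _ fun _ => ENNReal.ofReal_lt_top),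
    integral_withDensity_eq_integral_toReal_smul
    (measurable_velWeight hF).ennreal_ofReal (ae_of_all _ fun _ => ENNReal.ofReal_lt_top)] at h4
  simp only [hv, hk, smul_eq_mul] at h4
  exact h4.symm

theorem integrable_epsKer (hF : IsWeight s c F) (hs : 0 < s) (hν : 0 < ν₀) (hε : 0 < ε) :
    Integrable (epsKer s ν₀ F ε) := by
  have h1 := lintegral_velWeight hF hs hν hε (f := fun _ => 1) measurable_const
  simp only [mul_one] at h1
  have h2 : Integrable (velWeight s ν₀ F ε)
      ((volume : Measure (Space n)).prod (volume.restrict (Ioi (0 : ℝ)))) := by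
    refine hF.integrable.mul_prod (f := F)
      (g := fun z => ν₀ ^ 2 * Real.exp (-ν₀ * z) * ε ^ (-2 * s)) ?_
    have := integrableOn_rpow_mul_exp hν le_rfl
    simp only [Real.rpow_zero, one_mul] at this
    exact (this.const_mul _).mul_const _
  refine ⟨(measurable_epsKer hF).aestronglyMeasurable, ?_⟩
  rw [hasFiniteIntegral_iff_ofReal (ae_of_all _ fun w => epsKer_nonneg hF hε w), ← h1]
  exact (hasFiniteIntegral_iff_ofReal (ae_of_all _ fun q => velWeight_nonneg hF hε q)).1 h2.2

theorem isRadialKernel_epsKer (hF : IsWeight s c F) (hs : 0 < s) (hν : 0 < ν₀) (hε : 0 < ε) :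
    IsRadialKernel (epsKer s ν₀ F ε) where
  meas := measurable_epsKer hF
  nonneg := epsKer_nonneg hF hε
  symm e := epsKer_symm hF e hε
  moment := by
    refine Integrable.mono' (integrable_epsKer hF hs hν hε).integrableOn
      ((measurable_epsKer hF).mul measurable_norm).aestronglyMeasurable ?_
    filter_upwards [ae_restrict_mem (measurableSet_unitBall n)] with w hw
    rw [Real.norm_of_nonneg (mul_nonneg (epsKer_nonneg hF hε w) (norm_nonneg _))]
    exact mul_le_of_le_one_right (epsKer_nonneg hF hε w) hw

/-- For fixed `w ≠ 0` and `z`, the velocity `w/(εz)` tends to infinity, where `F` is `γ|v|^{-N-2s}`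
up to a relative error `O(|v|^{-2s})`. The remaining integral in `z` is the Gamma integral that
yields the constant of `𝓛`. -/
theorem tendsto_epsKer {γ C : ℝ} (hF : IsWeight s c F) (hs : 0 < s) (hν : 0 < ν₀)
    (htail : ∀ v, 1 ≤ ‖v‖ → |F v - γ * homKer s v| ≤ C * (homKer s v * ‖v‖ ^ (-2 * s)))
    {w : Space n} (hw : w ≠ 0) :
    Tendsto (fun ε => epsKer s ν₀ F ε w) (𝓝[>] 0)
      (𝓝 (γ * ν₀ ^ (1 - 2 * s) * Real.Gamma (2 * s + 1) * homKer s w)) := by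
  have hw0 : 0 < ‖w‖ := norm_pos_iff.2 hw
  have hlim : γ * ν₀ ^ (1 - 2 * s) * Real.Gamma (2 * s + 1) * homKer s w
      = ∫ z in Ioi (0 : ℝ), γ * ν₀ ^ 2 * homKer s w * (z ^ (2 * s) * Real.exp (-ν₀ * z)) := by
    rw [integral_const_mul, integral_rpow_mul_exp hν hs,
      show (1 : ℝ) - 2 * s = 2 + (-1 - 2 * s) by ring, Real.rpow_add hν, Real.rpow_two]
    ring
  rw [hlim]
  refine tendsto_integral_filter_of_dominated_convergence
    (fun z => c * ν₀ ^ 2 * homKer s w * (z ^ (2 * s) * Real.exp (-ν₀ * z))) ?_ ?_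
    ((integrableOn_rpow_mul_exp hν (by linarith)).const_mul _) ?_
  · exact Eventually.of_forall fun ε => ((measurable_epsDensity hF).comp
      measurable_prodMk_left).aestronglyMeasurable
  · filter_upwards [self_mem_nhdsWithin] with ε hε
    filter_upwards [ae_restrict_mem measurableSet_Ioi] with z hz
    rw [Real.norm_of_nonneg (epsDensity_nonneg hF hε hz w)]
    exact epsDensity_le hF hε hz w
  · filter_upwards [ae_restrict_mem measurableSet_Ioi] with z hz
    have hz0 : (0 : ℝ) < z := hz
    rw [tendsto_iff_norm_sub_tendsto_zero]
    have hb : Tendsto (fun ε : ℝ => ν₀ ^ 2 * Real.exp (-ν₀ * z) *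
        (C * (z ^ (2 * s) * homKer s w) * (‖w‖ ^ (-2 * s) * (ε * z) ^ (2 * s))))
        (𝓝[>] 0) (𝓝 0) := by
      have h1 : ContinuousAt (fun ε : ℝ => ν₀ ^ 2 * Real.exp (-ν₀ * z) *
        (C * (z ^ (2 * s) * homKer s w) * (‖w‖ ^ (-2 * s) * (ε * z) ^ (2 * s)))) 0 := by
        have h2 : ContinuousAt (fun ε : ℝ => (ε * z) ^ (2 * s)) 0 :=
          ContinuousAt.rpow_const (by fun_prop) (Or.inr (by linarith))
        fun_prop
      have h3 := h1.tendsto.mono_left (nhdsWithin_le_nhds (s := Ioi (0 : ℝ)))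
      simpa [Real.zero_rpow (by linarith : 2 * s ≠ 0)] using h3
    refine squeeze_zero' (Eventually.of_forall fun _ => norm_nonneg _) ?_ hb
    -- The range `ε < ‖w‖ / z` puts `(εz)⁻¹ w` outside the unit ball, where the tail estimate is
    -- available.
    filter_upwards [Ioo_mem_nhdsGT (show (0 : ℝ) < ‖w‖ / z by positivity)] with ε hε
    have hε0 : 0 < ε := hε.1
    have hεz := mul_pos hε0 hz0
    have hn : ‖(ε * z)⁻¹ • w‖ = (ε * z)⁻¹ * ‖w‖ := by
      rw [norm_smul, Real.norm_of_nonneg (by positivity)]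
    have h1 : 1 ≤ ‖(ε * z)⁻¹ • w‖ := by
      rw [hn, ← div_eq_inv_mul, one_le_div hεz]
      exact ((lt_div_iff₀ hz0).1 hε.2).le
    have h2 := htail _ h1
    have h3 : ‖(ε * z)⁻¹ • w‖ ^ (-2 * s) = ‖w‖ ^ (-2 * s) * (ε * z) ^ (2 * s) := by
      rw [hn, Real.mul_rpow (by positivity) hw0.le, Real.inv_rpow hεz.le, neg_mul,
        Real.rpow_neg hεz.le, inv_inv, mul_comm]
    rw [h3] at h2
    have h4 : epsDensity s ν₀ F ε w z
          - γ * ν₀ ^ 2 * homKer s w * (z ^ (2 * s) * Real.exp (-ν₀ * z))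
        = ν₀ ^ 2 * Real.exp (-ν₀ * z) * (ε ^ (-2 * s) * ((ε * z) ^ (n + 1))⁻¹ *
          (F ((ε * z)⁻¹ • w) - γ * homKer s ((ε * z)⁻¹ • w))) := by
      have h5 := scaling_identity (s := s) hε0 hz0 w
      rw [epsDensity]
      linear_combination (γ * ν₀ ^ 2 * Real.exp (-ν₀ * z)) * h5
    rw [h4, norm_mul, Real.norm_of_nonneg (show 0 ≤ ν₀ ^ 2 * Real.exp (-ν₀ * z) by positivity),
      norm_mul, Real.norm_of_nonneg (show 0 ≤ ε ^ (-2 * s) * ((ε * z) ^ (n + 1))⁻¹ by positivity),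
      Real.norm_eq_abs]
    refine mul_le_mul_of_nonneg_left ?_ (by positivity)
    calc _ ≤ ε ^ (-2 * s) * ((ε * z) ^ (n + 1))⁻¹ * (C * (homKer s ((ε * z)⁻¹ • w) *
          (‖w‖ ^ (-2 * s) * (ε * z) ^ (2 * s)))) :=
          mul_le_mul_of_nonneg_left h2 (by positivity)
      _ = C * (ε ^ (-2 * s) * ((ε * z) ^ (n + 1))⁻¹ * homKer s ((ε * z)⁻¹ • w)) *
          (‖w‖ ^ (-2 * s) * (ε * z) ^ (2 * s)) := by ring
      _ = _ := by rw [scaling_identity hε0 hz0]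

end kernel

/-! ### Space-time null sets and the remainder part -/

instance sFinite_volTime (n : ℕ) (I : Set ℝ) : SFinite (volTime n I) := by
  unfold volTime; infer_instance

theorem ae_mem_upperHalf (n : ℕ) (I : Set ℝ) : ∀ᵐ p ∂(volTime n I), p.2 ∈ upperHalf n := by
  have h : ∀ᵐ x ∂(volHalf n), x ∈ upperHalf n := ae_restrict_mem (measurableSet_upperHalf n)
  exact Measure.quasiMeasurePreserving_snd.ae h

theorem volTime_mono {n : ℕ} {I J : Set ℝ} (h : I ⊆ J) : volTime n I ≤ volTime n J := by
  unfold volTime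
  exact Measure.prod_mono (Measure.restrict_mono h le_rfl) le_rfl

theorem volTime_eq_restrict (n : ℕ) (I : Set ℝ) :
    volTime n I = ((volume : Measure ℝ).prod (volHalf n)).restrict (I ×ˢ univ) := by
  rw [← Measure.prod_restrict, Measure.restrict_univ, volTime]

/-- The `L^∞` bound in time gives `L²` estimates on bounded time intervals only; countably many of
them exhaust `(0,∞)`. -/
theorem ae_volTime_of_forall {n : ℕ} {P : ℝ × Space n → Prop}
    (h : ∀ T : ℝ, 0 < T → ∀ᵐ p ∂(volTime n (Ioo 0 T)), P p) : ∀ᵐ p ∂(volTime n (Ioi 0)), P p := by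
  have e : Ioi (0 : ℝ) ×ˢ (univ : Set (Space n))
      = ⋃ k : ℕ, Ioo (0 : ℝ) ((k : ℝ) + 1) ×ˢ (univ : Set (Space n)) := by
    ext q
    simp only [mem_prod, mem_Ioi, mem_univ, and_true, mem_iUnion, mem_Ioo]
    refine ⟨fun hq => ?_, fun ⟨k, hk⟩ => hk.1⟩
    obtain ⟨k, hk⟩ := exists_nat_gt q.1
    exact ⟨k, hq, hk.trans (lt_add_one _)⟩
  rw [volTime_eq_restrict, e, ae_restrict_iUnion_iff]
  intro k
  rw [← volTime_eq_restrict]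
  exact h _ (by positivity)

section remainder

variable {n : ℕ} {ψ : ℝ → Space n → ℝ} {U : ℝ × Space n → ℝ} {g : ℝ × Space n → Space n}
  {C : ℝ≥0} {s : ℝ}

theorem measurable_growth : Measurable (growth (n := n)) := by
  unfold growth; fun_prop

theorem measurable_lineRem_right (hg : Measurable g) (p : ℝ × Space n) :
    Measurable (lineRem g p) :=
  (measurable_lineRem hg).of_uncurry_left (f := lineRem g)

/-- Minkowski in `w`. Stated for an arbitrary signed `D`, so that it covers each kernel and also
their difference. -/
theorem IsGradRep.lintegral_sq_lintegral_lineRem_le (h : IsGradRep ψ U g C) {T : ℝ} (hT : 0 < T)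
    {D : Space n → ℝ} (hD : Measurable D) :
    ∫⁻ p, (∫⁻ w, ‖D w * lineRem g p w‖ₑ) ^ 2 ∂(volTime n (Ioo 0 T))
      ≤ ((∫⁻ w, ‖D w * growth w‖ₑ) * (C * ENNReal.ofReal √T)) ^ 2 := by
  refine lintegral_lintegral_sq_le (volTime n (Ioo 0 T)) volume
    (f := fun p w => ‖D w * lineRem g p w‖ₑ) (m := fun w => ‖D w * growth w‖ₑ) ?_
    (hD.mul measurable_growth).enorm (ae_of_all _ fun w => ?_)
  · have := (hD.comp measurable_snd).mul (measurable_lineRem h.meas_grad)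
    exact this.enorm
  · have hm : Measurable fun p : ℝ × Space n => ‖lineRem g p w‖ₑ ^ 2 :=
      (((measurable_lineRem h.meas_grad).comp measurable_prodMk_right).enorm.pow_const 2)
    simp only [enorm_mul, mul_pow]
    rw [lintegral_const_mul _ hm]
    refine (mul_le_mul_right (h.lintegral_lineRem_sq_le hT w) _).trans (le_of_eq ?_)
    rw [Real.enorm_of_nonneg (growth_nonneg w)]
    ring

theorem IsGradRep.ae_integrable_lineRem (h : IsGradRep ψ U g C) {D : Space n → ℝ}
    (hD : Measurable D) (hi : Integrable fun w => D w * growth w) :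
    ∀ᵐ p ∂(volTime n (Ioi 0)), Integrable fun w => D w * lineRem g p w := by
  refine ae_volTime_of_forall fun T hT => ?_
  have h1 := h.lintegral_sq_lintegral_lineRem_le hT hD
  have hm : Measurable fun p : ℝ × Space n => ∫⁻ w, ‖D w * lineRem g p w‖ₑ :=
    Measurable.lintegral_prod_right
      ((hD.comp measurable_snd).mul (measurable_lineRem h.meas_grad)).enorm
  have h2 : ((∫⁻ w, ‖D w * growth w‖ₑ) * (C * ENNReal.ofReal √T)) ^ 2 < ⊤ := by
    have := hi.2
    rw [hasFiniteIntegral_iff_enorm] at this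
    exact ENNReal.pow_lt_top (ENNReal.mul_lt_top this
      (ENNReal.mul_lt_top ENNReal.coe_lt_top ENNReal.ofReal_lt_top))
  filter_upwards [ae_lt_top (hm.pow_const 2) (h1.trans_lt h2).ne] with p hp
  refine ⟨(hD.mul (measurable_lineRem_right h.meas_grad p)).aestronglyMeasurable, ?_⟩
  rw [hasFiniteIntegral_iff_enorm]
  exact (ENNReal.pow_lt_top_iff.1 hp).resolve_right two_ne_zero

/-- The part of the nonlocal operators coming from the remainders. -/
noncomputable def remPart (g : ℝ × Space n → Space n) (D : Space n → ℝ) (p : ℝ × Space n) : ℝ :=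
  ∫ w, D w * lineRem g p w

theorem measurable_remPart (hg : Measurable g) {D : Space n → ℝ} (hD : Measurable D) :
    Measurable (remPart g D) :=
  (((hD.comp measurable_snd).mul (measurable_lineRem hg)).stronglyMeasurable.integral_prod_right'
    (ν := (volume : Measure (Space n)))).measurable

theorem IsGradRep.eLpNorm_remPart_le (h : IsGradRep ψ U g C) {T : ℝ} (hT : 0 < T)
    {D : Space n → ℝ} (hD : Measurable D) :
    eLpNorm (remPart g D) 2 (volTime n (Ioo 0 T))
      ≤ (∫⁻ w, ‖D w * growth w‖ₑ) * (C * ENNReal.ofReal √T) := by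
  refine (ENNReal.pow_right_strictMono two_ne_zero).le_iff_le.1 ?_
  rw [eLpNorm_two_sq]
  refine (lintegral_mono fun p => ?_).trans (h.lintegral_sq_lintegral_lineRem_le hT hD)
  exact pow_le_pow_left₀ (zero_le) (enorm_integral_le_lintegral_enorm _) 2

theorem IsGradRep.memLp_remPart (h : IsGradRep ψ U g C) {T : ℝ} (hT : 0 < T)
    {D : Space n → ℝ} (hD : Measurable D) (hi : Integrable fun w => D w * growth w) :
    MemLp (remPart g D) 2 (volTime n (Ioo 0 T)) := by
  refine ⟨(measurable_remPart h.meas_grad hD).aestronglyMeasurable,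
    (h.eLpNorm_remPart_le hT hD).trans_lt ?_⟩
  have := hi.2
  rw [hasFiniteIntegral_iff_enorm] at this
  exact ENNReal.mul_lt_top this (ENNReal.mul_lt_top ENNReal.coe_lt_top ENNReal.ofReal_lt_top)

theorem integrable_mul_of_le {K₁ K₂ f : Space n → ℝ} (hK : Measurable K₁) (hf : Measurable f)
    {c : ℝ} (hle : ∀ w, |K₁ w| ≤ c * K₂ w) (hi : Integrable fun w => K₂ w * f w)
    (h2 : ∀ w, 0 ≤ K₂ w) : Integrable fun w => K₁ w * f w := by
  refine Integrable.mono' (hi.norm.const_mul c) (hK.mul hf).aestronglyMeasurable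
    (ae_of_all _ fun w => ?_)
  rw [norm_mul, norm_mul, ← mul_assoc, Real.norm_of_nonneg (h2 w)]
  exact mul_le_mul_of_nonneg_right (hle w) (norm_nonneg _)

end remainder

/-! ### Estimates for the boundary coefficient -/

section boundary

variable {n : ℕ} {s : ℝ}

/-- The factor `(-h-w_N)₊` vanishes for `‖w‖ < h`, away from which the kernel is bounded. -/
theorem integrableOn_homKer_mul_max (s : ℝ) (hs : 0 < s) {h : ℝ} (hh : 0 < h) :
    IntegrableOn (fun w : Space n => homKer s w * max 0 (-h - w (Fin.last n))) {w | ‖w‖ ≤ 1} := by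
  have hfin : volume {w : Space n | ‖w‖ ≤ 1} ≠ ⊤ := by
    have : {w : Space n | ‖w‖ ≤ 1} = Metric.closedBall 0 1 := by ext w; simp
    rw [this]
    exact measure_closedBall_lt_top.ne
  refine Integrable.mono' (integrableOn_const hfin (C := (h ^ ((n : ℝ) + 1 + 2 * s))⁻¹))
    ((measurable_homKer s).mul (by fun_prop)).aestronglyMeasurable ?_
  filter_upwards [ae_restrict_mem (measurableSet_unitBall n)] with w hw
  have h1 := abs_max_sub_le hh w
  rw [norm_mul, Real.norm_of_nonneg (homKer_nonneg s w), Real.norm_eq_abs]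
  by_cases hwh : h ≤ ‖w‖
  · rw [← mul_one (_⁻¹)]
    refine mul_le_mul ?_ (h1.trans (by rw [one_mul]; exact hw)) (abs_nonneg _) (by positivity)
    unfold homKer
    gcongr
  · have h2 := (abs_le.1 (abs_coord_le_norm w (Fin.last n))).1
    rw [max_eq_left (by linarith), abs_zero, mul_zero]
    positivity

theorem bdCoeff_nonneg {K : Space n → ℝ} (hK : ∀ w, 0 ≤ K w) (h : ℝ) : 0 ≤ bdCoeff K h :=
  integral_nonneg fun w => mul_nonneg (hK w) (le_max_left _ _)

theorem bdCoeff_le {K : Space n → ℝ} (hK : ∀ w, 0 ≤ K w) {c : ℝ}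
    (hle : ∀ w, K w ≤ c * homKer s w) (hs : 0 < s) {h : ℝ} (hh : 0 < h) :
    bdCoeff K h ≤ c * bdCoeff (homKer s : Space n → ℝ) h := by
  unfold bdCoeff
  rw [← integral_const_mul]
  refine integral_mono_of_nonneg (ae_of_all _ fun w => mul_nonneg (hK w) (le_max_left _ _))
    ((integrableOn_homKer_mul_max s hs hh).const_mul c) (ae_of_all _ fun w => ?_)
  dsimp only
  rw [← mul_assoc]
  exact mul_le_mul_of_nonneg_right (hle w) (le_max_left _ _)

theorem measurable_bdCoeff {K : Space n → ℝ} (hK : Measurable K) : Measurable (bdCoeff K) := by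
  have : Measurable fun q : ℝ × Space n => K q.2 * max 0 (-q.1 - q.2 (Fin.last n)) :=
    (hK.comp measurable_snd).mul (by fun_prop)
  exact (this.stronglyMeasurable.integral_prod_right'
    (ν := volume.restrict {w : Space n | ‖w‖ ≤ 1})).measurable

end boundary

/-! ### Existence and value of the principal value -/

section principalValue

variable {n : ℕ} {s : ℝ}

/-- The homogeneous kernel restricted to the complement of a ball. -/
noncomputable def truncKer (s δ : ℝ) : Space n → ℝ := {w | δ < ‖w‖}.indicator (homKer s)

theorem measurableSet_lt_norm (δ : ℝ) : MeasurableSet {w : Space n | δ < ‖w‖} :=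
  measurableSet_lt measurable_const measurable_norm

theorem measurable_truncKer (s δ : ℝ) : Measurable (truncKer (n := n) s δ) :=
  (measurable_homKer s).indicator (measurableSet_lt_norm δ)

theorem truncKer_nonneg (s δ : ℝ) (w : Space n) : 0 ≤ truncKer s δ w :=
  indicator_nonneg (fun w _ => homKer_nonneg s w) w

theorem truncKer_le (s δ : ℝ) (w : Space n) : truncKer s δ w ≤ homKer s w :=
  indicator_le_self' (fun w _ => homKer_nonneg s w) w

theorem integrable_truncKer (hs : 1 / 2 < s) (hs' : s < 1) {δ : ℝ} (hδ : 0 < δ) :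
    Integrable (truncKer (n := n) s δ) := by
  have hm : 0 < min δ (δ ^ 2) := lt_min hδ (by positivity)
  refine Integrable.mono' ((integrable_homKer_mul_growth (n := n) hs hs').const_mul
    (min δ (δ ^ 2))⁻¹) (measurable_truncKer s δ).aestronglyMeasurable (ae_of_all _ fun w => ?_)
  rw [Real.norm_of_nonneg (truncKer_nonneg s δ w)]
  by_cases hw : δ < ‖w‖
  · rw [truncKer, indicator_of_mem (by exact hw), inv_mul_eq_div, le_div_iff₀ hm]
    refine mul_le_mul_of_nonneg_left ?_ (homKer_nonneg s w)
    unfold growth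
    gcongr
  · rw [truncKer, indicator_of_notMem (by exact hw)]
    have := homKer_nonneg s w
    have := growth_nonneg w
    positivity

theorem homKer_map (e : Space n ≃ₗᵢ[ℝ] Space n) (w : Space n) : homKer s (e w) = homKer s w := by
  simp [homKer]

/-- The full kernel has infinite first moment at the origin because `s > 1/2`; only its truncations
qualify, which is why the symmetry argument is applied before the limit `δ → 0`. -/
theorem isRadialKernel_truncKer (hs : 1 / 2 < s) (hs' : s < 1) {δ : ℝ} (hδ : 0 < δ) :
    IsRadialKernel (truncKer (n := n) s δ) where
  meas := measurable_truncKer s δ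
  nonneg := truncKer_nonneg s δ
  symm e := ae_of_all _ fun w => by
    simp [truncKer, indicator, homKer_map]
  moment := by
    refine Integrable.mono' (integrable_truncKer (n := n) hs hs' hδ).integrableOn
      ((measurable_truncKer s δ).mul measurable_norm).aestronglyMeasurable ?_
    filter_upwards [ae_restrict_mem (measurableSet_unitBall n)] with w hw
    rw [Real.norm_of_nonneg (mul_nonneg (truncKer_nonneg s δ w) (norm_nonneg _))]
    exact mul_le_of_le_one_right (truncKer_nonneg s δ w) hw

/-- The integrand vanishes on the removed ball, so the boundary term is already at its limit once `δ
< h`. -/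
theorem bdCoeff_truncKer {δ h : ℝ} (hδ : δ < h) :
    bdCoeff (truncKer (n := n) s δ) h = bdCoeff (homKer s : Space n → ℝ) h := by
  unfold bdCoeff
  congr 1
  ext w
  by_cases hw : δ < ‖w‖
  · rw [truncKer, indicator_of_mem (by exact hw)]
  · have h2 := (abs_le.1 (abs_coord_le_norm w (Fin.last n))).1
    rw [max_eq_left (by linarith), mul_zero, mul_zero]

theorem tendsto_truncKer (hs : 0 < s) (w : Space n) :
    Tendsto (fun δ => truncKer s δ w) (𝓝[>] 0) (𝓝 (homKer s w)) := by
  rcases eq_or_ne w 0 with rfl | hw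
  · have h0 : homKer s (0 : Space n) = 0 := by
      rw [homKer, norm_zero, Real.zero_rpow (by positivity), inv_zero]
    have : ∀ δ, truncKer s δ (0 : Space n) = 0 := fun δ => by
      simp [truncKer, indicator, h0]
    simp only [this, h0]
    exact tendsto_const_nhds
  · refine tendsto_const_nhds.congr' ?_
    filter_upwards [Ioo_mem_nhdsGT (norm_pos_iff.2 hw)] with δ hδ
    rw [truncKer, indicator_of_mem (by exact hδ.2)]

/-- The part of the nonlocal operators coming from the boundary. -/
noncomputable def bdPart (g : ℝ × Space n → Space n) (K : Space n → ℝ) (p : ℝ × Space n) : ℝ :=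
  g p (Fin.last n) * bdCoeff K (p.2 (Fin.last n))

theorem truncIntegral_limKernel (hs : 1 / 2 < s) (hs' : s < 1) {u : Space n → ℝ}
    {g : ℝ × Space n → Space n} (hg : Measurable g) {p : ℝ × Space n} (hp : p.2 ∈ upperHalf n)
    (hu : ∀ᵐ w, ext u (p.2 + w) w - u p.2 = lineInt g p w)
    (hr : Integrable fun w => homKer s w * lineRem g p w) {δ : ℝ} (hδ : 0 < δ) :
    IntegrableOn (limKernel s u p.2) (Metric.closedBall p.2 δ)ᶜ ∧
      truncIntegral (limKernel s u p.2) p.2 δ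
        = remPart g (truncKer s δ) p + bdPart g (truncKer s δ) p := by
  have hr' : Integrable fun w => truncKer s δ w * lineRem g p w :=
    integrable_mul_of_le (c := 1) (measurable_truncKer s δ) (measurable_lineRem_right hg p)
      (fun w => by
        rw [abs_of_nonneg (truncKer_nonneg s δ w), one_mul]; exact truncKer_le s δ w) hr
      (homKer_nonneg s)
  obtain ⟨h1, h2⟩ := (isRadialKernel_truncKer hs hs' hδ).integral_lineInt hp hr'
  have hms : MeasurableSet (Metric.closedBall p.2 δ)ᶜ := Metric.isClosed_closedBall.measurableSet.compl
  have h3 : (fun w => (Metric.closedBall p.2 δ)ᶜ.indicator (limKernel s u p.2) (p.2 + w))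
      =ᵐ[volume] fun w => truncKer s δ w * lineInt g p w := by
    filter_upwards [hu] with w hw
    by_cases hwδ : δ < ‖w‖
    · rw [truncKer, indicator_of_mem (by simpa using hwδ), indicator_of_mem (by exact hwδ),
        limKernel, add_sub_cancel_left, hw, homKer, div_eq_inv_mul]
    · rw [truncKer, indicator_of_notMem (by simpa using hwδ), indicator_of_notMem (by exact hwδ),
        zero_mul]
  have h4 : Integrable fun w =>
      (Metric.closedBall p.2 δ)ᶜ.indicator (limKernel s u p.2) (p.2 + w) := h1.congr h3.symm
  constructor
  · rw [← integrable_indicator_iff hms]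
    have := h4.comp_add_left (-p.2)
    simpa using this
  · rw [truncIntegral, ← integral_indicator hms, ← integral_add_left_eq_self _ p.2,
      integral_congr_ae h3, h2]
    rfl

theorem hasPrincipalValue_limKernel (hs : 1 / 2 < s) (hs' : s < 1) {u : Space n → ℝ}
    {g : ℝ × Space n → Space n} (hg : Measurable g) {p : ℝ × Space n} (hp : p.2 ∈ upperHalf n)
    (hu : ∀ᵐ w, ext u (p.2 + w) w - u p.2 = lineInt g p w)
    (hr : Integrable fun w => homKer s w * lineRem g p w) :
    HasPrincipalValue (limKernel s u p.2) p.2 ∧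
      principalValue (limKernel s u p.2) p.2
        = remPart g (homKer s) p + bdPart g (homKer s) p := by
  have hlim : Tendsto (truncIntegral (limKernel s u p.2) p.2) (𝓝[>] 0)
      (𝓝 (remPart g (homKer s) p + bdPart g (homKer s) p)) := by
    have h1 : Tendsto (fun δ => remPart g (truncKer s δ) p) (𝓝[>] 0)
        (𝓝 (remPart g (homKer s) p)) := by
      refine tendsto_integral_filter_of_dominated_convergence
        (fun w => ‖homKer s w * lineRem g p w‖) (Eventually.of_forall fun δ =>
          ((measurable_truncKer s δ).mul (measurable_lineRem_right hg p)).aestronglyMeasurable)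
        (Eventually.of_forall fun δ => ae_of_all _ fun w => ?_) hr.norm
        (ae_of_all _ fun w => (tendsto_truncKer (by linarith) w).mul_const _)
      rw [norm_mul, norm_mul, Real.norm_of_nonneg (truncKer_nonneg s δ w),
        Real.norm_of_nonneg (homKer_nonneg s w)]
      exact mul_le_mul_of_nonneg_right (truncKer_le s δ w) (norm_nonneg _)
    refine (h1.add_const (bdPart g (homKer s) p)).congr' ?_
    have hp0 : 0 < p.2 (Fin.last n) := hp
    filter_upwards [Ioo_mem_nhdsGT hp0] with δ hδ
    rw [(truncIntegral_limKernel hs hs' hg hp hu hr hδ.1).2, bdPart, bdPart,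
      bdCoeff_truncKer hδ.2]
  have hpv : principalValue (limKernel s u p.2) p.2
      = remPart g (homKer s) p + bdPart g (homKer s) p := hlim.limUnder_eq
  refine ⟨⟨fun δ hδ => (truncIntegral_limKernel hs hs' hg hp hu hr hδ).1, ?_⟩, hpv⟩
  rw [hpv]
  exact hlim

end principalValue

/-! ### Return to the velocity variable -/

section velocity

variable {n : ℕ} {s c ν₀ ε : ℝ} {F : Space n → ℝ}

/-- Only the direction of `v` matters; this identifies the extension with velocity `v` in `𝓛^ε` with
the one with velocity `w = εzv`. -/
theorem ext_smul_right (u : Space n → ℝ) (y v : Space n) {r : ℝ} (hr : 0 < r) :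
    ext u y (r • v) = ext u y v := by
  have h1 : (r • v) (Fin.last n) = r * v (Fin.last n) := by simp
  have h2 : r * v (Fin.last n) < 0 ↔ v (Fin.last n) < 0 :=
    ⟨fun h => by by_contra h'; nlinarith [mul_nonneg hr.le (not_lt.1 h')],
      fun h => mul_neg_of_pos_of_neg hr h⟩
  unfold ext
  rw [h1, smul_smul]
  simp only [h2]
  congr 5
  rw [mul_comm r, ← div_div, div_mul_cancel₀ _ hr.ne']

theorem quasiMeasurePreserving_velocity (hε : 0 < ε) :
    Measure.QuasiMeasurePreserving (fun q : Space n × ℝ => (ε * q.2) • q.1)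
      ((volume : Measure (Space n)).prod (volume.restrict (Ioi (0 : ℝ)))) volume := by
  refine QuasiMeasurePreserving.prod_of_left (by fun_prop) ?_
  filter_upwards [ae_restrict_mem measurableSet_Ioi] with z hz
  exact Measure.quasiMeasurePreserving_smul volume (mul_pos hε hz).ne'

theorem integrableOn_exp_mul (hν : 0 < ν₀) :
    IntegrableOn (fun z : ℝ => Real.exp (-ν₀ * z)) (Ioi 0) := by
  have := integrableOn_rpow_mul_exp hν le_rfl
  simpa only [Real.rpow_zero, one_mul] using this

theorem integral_exp_mul (hν : 0 < ν₀) :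
    ∫ z in Ioi (0 : ℝ), Real.exp (-ν₀ * z) * ν₀ = 1 := by
  rw [integral_mul_const, integral_exp_mul_Ioi (by linarith)]
  simp [hν.ne']

theorem ae_phiIntegrand_eq (hε : 0 < ε) {u : Space n → ℝ} {g : ℝ × Space n → Space n}
    {p : ℝ × Space n} (hu : ∀ᵐ w, ext u (p.2 + w) w - u p.2 = lineInt g p w) :
    ∀ᵐ v : Space n, ∀ᵐ z ∂(volume.restrict (Ioi (0 : ℝ))),
      phiIntegrand ν₀ ε u p.2 v z
        = Real.exp (-ν₀ * z) * ν₀ * (lineInt g p ((ε * z) • v) + u p.2) := by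
  have h1 := (quasiMeasurePreserving_velocity (n := n) hε).ae hu
  filter_upwards [Measure.ae_ae_of_ae_prod h1] with v hv
  filter_upwards [hv, ae_restrict_mem measurableSet_Ioi] with z hz hz0
  rw [phiIntegrand, ← hz, ext_smul_right _ _ _ (mul_pos hε hz0), sub_add_cancel]

/-- Fubini gives integrability in `z` of the weighted integrand; the factor `F v` can be divided out
only where it is nonzero. -/
theorem integrable_phiIntegrand (hF : IsWeight s c F) (hs : 0 < s) (hν : 0 < ν₀) (hε : 0 < ε)
    {u : Space n → ℝ} {g : ℝ × Space n → Space n} (hg : Measurable g) {p : ℝ × Space n}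
    (hu : ∀ᵐ w, ext u (p.2 + w) w - u p.2 = lineInt g p w)
    (hi : Integrable fun w => epsKer s ν₀ F ε w * lineInt g p w) :
    ∀ᵐ v : Space n, F v ≠ 0 → IntegrableOn (phiIntegrand ν₀ ε u p.2 v) (Ioi 0) ∧
      ν₀ * (phiEps ν₀ ε u p.2 v - u p.2)
        = ∫ z in Ioi (0 : ℝ), ν₀ ^ 2 * Real.exp (-ν₀ * z) * lineInt g p ((ε * z) • v) := by
  have hl : Measurable (lineInt g p) := measurable_lineInt hg measurable_const measurable_id
  obtain ⟨h1, -⟩ := integrable_velWeight hF hs hν hε hl hi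
  filter_upwards [h1.prod_right_ae, ae_phiIntegrand_eq (ν₀ := ν₀) hε hu] with v hv1 hv2 hF0
  have hεs : 0 < ε ^ (-2 * s) := Real.rpow_pos_of_pos hε _
  have h2 : IntegrableOn (fun z => Real.exp (-ν₀ * z) * ν₀ * lineInt g p ((ε * z) • v)) (Ioi 0) := by
    refine (hv1.const_mul (F v * ν₀ * ε ^ (-2 * s))⁻¹).congr (ae_of_all _ fun z => ?_)
    simp only [velWeight]
    field_simp
  have h3 : IntegrableOn (fun z => Real.exp (-ν₀ * z) * ν₀ * u p.2) (Ioi 0) :=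
    ((integrableOn_exp_mul hν).mul_const ν₀).mul_const _
  have h4 : (fun z => phiIntegrand ν₀ ε u p.2 v z) =ᵐ[volume.restrict (Ioi (0 : ℝ))]
      fun z => Real.exp (-ν₀ * z) * ν₀ * lineInt g p ((ε * z) • v)
        + Real.exp (-ν₀ * z) * ν₀ * u p.2 := by
    filter_upwards [hv2] with z hz
    rw [hz, mul_add]
  refine ⟨(h2.add h3).congr h4.symm, ?_⟩
  rw [phiEps, integral_congr_ae h4, integral_add h2 h3, integral_mul_const, integral_exp_mul hν,
    one_mul, add_sub_cancel_right, ← integral_const_mul]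
  congr 1
  ext z
  ring

theorem integrable_opEps (hF : IsWeight s c F) (hs : 0 < s) (hν : 0 < ν₀) (hε : 0 < ε)
    {u : Space n → ℝ} {g : ℝ × Space n → Space n} (hg : Measurable g) {p : ℝ × Space n}
    (hu : ∀ᵐ w, ext u (p.2 + w) w - u p.2 = lineInt g p w)
    (hi : Integrable fun w => epsKer s ν₀ F ε w * lineInt g p w) :
    Integrable (fun v => ν₀ * F v * (phiEps ν₀ ε u p.2 v - u p.2)) ∧
      opEps s ν₀ F ε u p.2 = ∫ w, epsKer s ν₀ F ε w * lineInt g p w := by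
  have hl : Measurable (lineInt g p) := measurable_lineInt hg measurable_const measurable_id
  obtain ⟨h1, h2⟩ := integrable_velWeight hF hs hν hε hl hi
  have hεs : 0 < ε ^ (-2 * s) := Real.rpow_pos_of_pos hε _
  have h3 : (fun v => ν₀ * F v * (phiEps ν₀ ε u p.2 v - u p.2)) =ᵐ[volume]
      fun v => (ε ^ (-2 * s))⁻¹ * ∫ z in Ioi (0 : ℝ),
        velWeight s ν₀ F ε (v, z) * lineInt g p ((ε * z) • v) := by
    filter_upwards [integrable_phiIntegrand hF hs hν hε hg hu hi] with v hv
    rw [← integral_const_mul]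
    by_cases hF0 : F v = 0
    · simp [velWeight, hF0]
    · rw [mul_right_comm, (hv hF0).2, ← integral_mul_const]
      congr 1
      ext z
      simp only [velWeight]
      field_simp
  refine ⟨(h1.integral_prod_left.const_mul (ε ^ (-2 * s))⁻¹).congr h3.symm, ?_⟩
  rw [opEps, integral_congr_ae h3, integral_const_mul, mul_inv_cancel_left₀ hεs.ne', ← h2,
    integral_prod _ h1]

/-- An integrable radial weight, positive away from the origin. -/
noncomputable def refWeight (s : ℝ) (v : Space n) : ℝ :=
  min (homKer s v) ((1 + ‖v‖) ^ (-((n : ℝ) + 1 + 2 * s)))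

theorem isWeight_refWeight (hs : 0 < s) : IsWeight s 1 (refWeight (n := n) s) where
  meas := (measurable_homKer s).min (by fun_prop)
  nonneg v := le_min (homKer_nonneg s v) (by positivity)
  le v := by rw [one_mul]; exact min_le_left _ _
  integrable := by
    have hr : (Module.finrank ℝ (Space n) : ℝ) < (n : ℝ) + 1 + 2 * s := by simp; exact hs
    refine Integrable.mono' (integrable_one_add_norm (μ := (volume : Measure (Space n))) hr)
      ((measurable_homKer s).min (by fun_prop)).aestronglyMeasurable (ae_of_all _ fun v => ?_)
    rw [refWeight, Real.norm_of_nonneg (le_min (homKer_nonneg s v) (by positivity))]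
    exact min_le_right _ _
  symm e := ae_of_all _ fun v => by simp [refWeight, homKer_map]

theorem homKer_pos (s : ℝ) {v : Space n} (hv : v ≠ 0) : 0 < homKer s v := by
  have := norm_pos_iff.2 hv
  unfold homKer; positivity

theorem refWeight_pos (s : ℝ) {v : Space n} (hv : v ≠ 0) : 0 < refWeight s v :=
  lt_min (homKer_pos s hv) (Real.rpow_pos_of_pos (by positivity) _)

/-- A bounded radial weight with heavy tail agrees almost everywhere with one that is measurable
and dominated by the homogeneous kernel everywhere. -/
theorem IsEquilibrium.exists_isWeight {γ : ℝ} (hs : 0 < s) (hγ : 0 < γ) (hF : IsEquilibrium s γ F) :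
    ∃ (F' : Space n → ℝ) (c C : ℝ), F =ᵐ[volume] F' ∧ IsWeight s c F' ∧
      ∀ v, 1 ≤ ‖v‖ → |F' v - γ * homKer s v| ≤ C * (homKer s v * ‖v‖ ^ (-2 * s)) := by
  obtain ⟨C, hC⟩ := hF.tail
  set M : ℝ := (eLpNorm F ⊤ volume).toReal with hM
  have hM0 : 0 ≤ M := ENNReal.toReal_nonneg
  have hFM : ∀ᵐ v, F v ≤ M := by
    filter_upwards [ae_le_eLpNormEssSup (f := F) (μ := volume)] with v hv
    rw [← eLpNorm_exponent_top] at hv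
    have := ENNReal.toReal_mono hF.bounded.2.ne hv
    rw [toReal_enorm, Real.norm_of_nonneg (hF.nonneg v)] at this
    exact this
  -- Inside the unit ball `homKer ≥ 1` and the bound `M` suffices; outside, the tail gives `γ +
  -- |C|`.
  set c : ℝ := M + γ + |C| with hc
  have hhom : ∀ v : Space n, 1 ≤ ‖v‖ → C / ‖v‖ ^ ((n : ℝ) + 1 + 4 * s)
      ≤ |C| * (homKer s v * ‖v‖ ^ (-2 * s)) := by
    intro v hv
    have hv0 : 0 < ‖v‖ := one_pos.trans_le hv
    have e : homKer s v * ‖v‖ ^ (-2 * s) = (‖v‖ ^ ((n : ℝ) + 1 + 4 * s))⁻¹ := by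
      rw [homKer, ← Real.rpow_neg hv0.le, ← Real.rpow_neg hv0.le, ← Real.rpow_add hv0]
      congr 1; ring
    rw [e, div_eq_mul_inv]
    exact mul_le_mul_of_nonneg_right (le_abs_self C) (by positivity)
  set G : Space n → ℝ := hF.integrable.1.mk F with hG
  have hGm : Measurable G := hF.integrable.1.stronglyMeasurable_mk.measurable
  set S : Set (Space n) := ({v | 0 ≤ G v} ∩ {v | G v ≤ c * homKer s v}) ∩
    ({v | ‖v‖ < 1} ∪ {v | |G v - γ * homKer s v| ≤ |C| * (homKer s v * ‖v‖ ^ (-2 * s))}) with hS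
  have hh := measurable_homKer (n := n) s
  have hSm : MeasurableSet S :=
    ((measurableSet_le measurable_const hGm).inter
      (measurableSet_le hGm (hh.const_mul c))).inter
      ((measurableSet_lt measurable_norm measurable_const).union
        (measurableSet_le (hGm.sub (hh.const_mul γ)).abs
          ((hh.mul (by fun_prop)).const_mul |C|)))
  have hSae : ∀ᵐ v, v ∈ S ∧ F v = G v := by
    filter_upwards [hF.integrable.1.ae_eq_mk, hFM, Measure.ae_ne volume (0 : Space n)]
      with v h1 h2 h3
    have hv0 : 0 < ‖v‖ := norm_pos_iff.2 h3
    have h4 : G v = F v := h1.symm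
    have h5 := homKer_nonneg s v
    refine ⟨⟨⟨by simpa [h4] using hF.nonneg v, ?_⟩, ?_⟩, h1⟩
    · simp only [mem_ofPred_eq, h4]
      by_cases hv : 1 ≤ ‖v‖
      · have h6 := (abs_le.1 ((hC v hv).trans (hhom v hv))).2
        have h7 : ‖v‖ ^ (-2 * s) ≤ 1 := Real.rpow_le_one_of_one_le_of_nonpos hv (by linarith)
        have h8 : |C| * (homKer s v * ‖v‖ ^ (-2 * s)) ≤ |C| * homKer s v :=
          mul_le_mul_of_nonneg_left (mul_le_of_le_one_right h5 h7) (abs_nonneg C)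
        have h9 : γ / ‖v‖ ^ ((n : ℝ) + 1 + 2 * s) = γ * homKer s v := div_eq_mul_inv _ _
        rw [h9] at h6
        have : 0 ≤ M * homKer s v := mul_nonneg hM0 h5
        rw [hc]
        linarith
      · have h6 : 1 ≤ homKer s v := by
          rw [homKer, one_le_inv₀ (by positivity)]
          exact Real.rpow_le_one hv0.le (not_le.1 hv).le (by positivity)
        have h7 : M ≤ c := by rw [hc]; linarith [abs_nonneg C]
        nlinarith
    · by_cases hv : 1 ≤ ‖v‖
      · refine Or.inr ?_
        have h6 := (hC v hv).trans (hhom v hv)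
        have h9 : γ / ‖v‖ ^ ((n : ℝ) + 1 + 2 * s) = γ * homKer s v := div_eq_mul_inv _ _
        rw [h9] at h6
        simpa only [mem_ofPred_eq, h4] using h6
      · exact Or.inl (not_le.1 hv)
  classical
  -- On the exceptional null set the replacement is the exact tail outside the unit ball and zero
  -- inside, so that both pointwise bounds hold everywhere.
  set F' : Space n → ℝ := S.piecewise G ({v | 1 ≤ ‖v‖}.indicator fun v => γ * homKer s v) with hF'
  have hFF' : F =ᵐ[volume] F' := by
    filter_upwards [hSae] with v hv
    rw [hF', piecewise_eq_of_mem _ _ _ hv.1, hv.2]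
  have hγc : γ ≤ c := by rw [hc]; linarith [abs_nonneg C]
  refine ⟨F', c, |C|, hFF', ⟨?_, fun v => ?_, fun v => ?_, hF.integrable.congr hFF',
    fun e => ?_⟩, fun v hv => ?_⟩
  · exact Measurable.piecewise hSm hGm
      ((hh.const_mul γ).indicator (measurableSet_le measurable_const measurable_norm))
  · by_cases hv : v ∈ S
    · rw [hF', piecewise_eq_of_mem _ _ _ hv]; exact hv.1.1
    · rw [hF', piecewise_eq_of_notMem _ _ _ hv]
      exact indicator_nonneg (fun v _ => mul_nonneg hγ.le (homKer_nonneg s v)) v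
  · by_cases hv : v ∈ S
    · rw [hF', piecewise_eq_of_mem _ _ _ hv]; exact hv.1.2
    · rw [hF', piecewise_eq_of_notMem _ _ _ hv]
      exact (indicator_le_self' (fun v _ => mul_nonneg hγ.le (homKer_nonneg s v)) v).trans
        (mul_le_mul_of_nonneg_right hγc (homKer_nonneg s v))
  · obtain ⟨f, hf⟩ := hF.radial
    filter_upwards [e.measurePreserving.quasiMeasurePreserving.ae hFF', hFF'] with v h1 h2
    rw [← h1, ← h2, hf, hf, e.norm_map]
  · by_cases hvS : v ∈ S
    · rw [hF', piecewise_eq_of_mem _ _ _ hvS]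
      rcases hvS.2 with h | h
      · exact absurd hv (not_le.2 h)
      · exact h
    · rw [hF', piecewise_eq_of_notMem _ _ _ hvS, indicator_of_mem (by exact hv), sub_self, abs_zero]
      have := homKer_nonneg s v
      positivity

end velocity

/-! ### Convergence in `L²` -/

section convergence

variable {n : ℕ} {s c ν₀ ε γ : ℝ} {F : Space n → ℝ} {ψ : ℝ → Space n → ℝ} {U : ℝ × Space n → ℝ}
  {g : ℝ × Space n → Space n} {C : ℝ≥0}

/-- A point at which the increments of the extension are line integrals, with integrable
remainders. -/
structure IsRegularPoint (s : ℝ) (ψ : ℝ → Space n → ℝ) (g : ℝ × Space n → Space n)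
    (p : ℝ × Space n) : Prop where
  mem : p.2 ∈ upperHalf n
  ext_sub : ∀ᵐ w, ext (ψ p.1) (p.2 + w) w - ψ p.1 p.2 = lineInt g p w
  integrable : Integrable fun w => homKer s w * lineRem g p w

theorem IsGradRep.ae_isRegularPoint (h : IsGradRep ψ U g C) (hs : 1 / 2 < s) (hs' : s < 1) :
    ∀ᵐ p ∂(volTime n (Ioi 0)), IsRegularPoint s ψ g p := by
  filter_upwards [ae_mem_upperHalf n (Ioi 0), h.ext_sub_ae,
    h.ae_integrable_lineRem (measurable_homKer s) (integrable_homKer_mul_growth hs hs')]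
    with p h1 h2 h3 using ⟨h1, h2, h3⟩

theorem ae_volTime_Ioo {P : ℝ × Space n → Prop} (h : ∀ᵐ p ∂(volTime n (Ioi 0)), P p) (T : ℝ) :
    ∀ᵐ p ∂(volTime n (Ioo 0 T)), P p :=
  ae_mono (volTime_mono Ioo_subset_Ioi_self) h

/-- The constant comparing the kernel of `𝓛^ε` with the homogeneous kernel. -/
noncomputable def kerConst (s ν₀ c : ℝ) : ℝ :=
  c * ν₀ ^ 2 * (ν₀ ^ (-1 - 2 * s) * Real.Gamma (2 * s + 1))

theorem abs_epsKer_le (hF : IsWeight s c F) (hs : 0 < s) (hν : 0 < ν₀) (hε : 0 < ε) (w : Space n) :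
    |epsKer s ν₀ F ε w| ≤ kerConst s ν₀ c * homKer s w := by
  rw [abs_of_nonneg (epsKer_nonneg hF hε w)]
  exact epsKer_le hF hs hν hε w

theorem IsRegularPoint.integrable_epsKer_lineRem {p : ℝ × Space n} (hp : IsRegularPoint s ψ g p)
    (hF : IsWeight s c F) (hs : 0 < s) (hν : 0 < ν₀) (hε : 0 < ε) (hg : Measurable g) :
    Integrable fun w => epsKer s ν₀ F ε w * lineRem g p w :=
  integrable_mul_of_le (measurable_epsKer hF) (measurable_lineRem_right hg p)
    (abs_epsKer_le hF hs hν hε) hp.integrable (homKer_nonneg s)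

theorem IsRegularPoint.integral_epsKer {p : ℝ × Space n} (hp : IsRegularPoint s ψ g p)
    (hF : IsWeight s c F) (hs : 0 < s) (hν : 0 < ν₀) (hε : 0 < ε) (hg : Measurable g) :
    Integrable (fun w => epsKer s ν₀ F ε w * lineInt g p w) ∧
      ∫ w, epsKer s ν₀ F ε w * lineInt g p w
        = remPart g (epsKer s ν₀ F ε) p + bdPart g (epsKer s ν₀ F ε) p :=
  (isRadialKernel_epsKer hF hs hν hε).integral_lineInt hp.mem
    (hp.integrable_epsKer_lineRem hF hs hν hε hg)

theorem IsRegularPoint.opEps_eq {p : ℝ × Space n} (hp : IsRegularPoint s ψ g p)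
    (hF : IsWeight s c F) (hs : 0 < s) (hν : 0 < ν₀) (hε : 0 < ε) (hg : Measurable g) :
    opEps s ν₀ F ε (ψ p.1) p.2
      = remPart g (epsKer s ν₀ F ε) p + bdPart g (epsKer s ν₀ F ε) p := by
  obtain ⟨h1, h2⟩ := hp.integral_epsKer hF hs hν hε hg
  rw [(integrable_opEps hF hs hν hε hg hp.ext_sub h1).2, h2]

theorem IsRegularPoint.opLim_eq {p : ℝ × Space n} (hp : IsRegularPoint s ψ g p) (hs : 1 / 2 < s)
    (hs' : s < 1) (hg : Measurable g) :
    opLim s γ ν₀ (ψ p.1) p.2 = γ * ν₀ ^ (1 - 2 * s) * Real.Gamma (2 * s + 1) *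
      (remPart g (homKer s) p + bdPart g (homKer s) p) := by
  rw [opLim, (hasPrincipalValue_limKernel hs hs' hg hp.mem hp.ext_sub hp.integrable).2]

theorem measurable_bdPart (hg : Measurable g) {K : Space n → ℝ} (hK : Measurable K) :
    Measurable (bdPart g K) := by
  have h1 : Measurable fun p : ℝ × Space n => g p (Fin.last n) :=
    (continuous_coord (Fin.last n)).measurable.comp hg
  have h2 : Measurable fun p : ℝ × Space n => bdCoeff K (p.2 (Fin.last n)) :=
    (measurable_bdCoeff hK).comp ((continuous_coord (Fin.last n)).measurable.comp measurable_snd)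
  exact h1.mul h2

/-- The sign of `bdCoeff` turns domination of kernels into domination of boundary terms, with a
constant independent of `ε`. -/
theorem abs_bdPart_le (hF : IsWeight s c F) (hs : 0 < s) (hν : 0 < ν₀) (hε : 0 < ε)
    {p : ℝ × Space n} (hp : p.2 ∈ upperHalf n) :
    |bdPart g (epsKer s ν₀ F ε) p| ≤ kerConst s ν₀ c * |bdPart g (homKer s) p| := by
  have h := bdCoeff_le (epsKer_nonneg hF hε) (epsKer_le hF hs hν hε) hs (h := p.2 (Fin.last n)) hp
  rw [bdPart, bdPart, abs_mul, abs_mul, abs_of_nonneg (bdCoeff_nonneg (epsKer_nonneg hF hε) _),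
    abs_of_nonneg (bdCoeff_nonneg (homKer_nonneg s) _), mul_left_comm]
  exact mul_le_mul_of_nonneg_left h (abs_nonneg _)

theorem tendsto_bdPart {κ : ℝ} (hF : IsWeight s c F) (hs : 0 < s) (hν : 0 < ν₀)
    (hlim : ∀ w : Space n, w ≠ 0 →
      Tendsto (fun ε => epsKer s ν₀ F ε w) (𝓝[>] 0) (𝓝 (κ * homKer s w)))
    {p : ℝ × Space n} (hp : p.2 ∈ upperHalf n) :
    Tendsto (fun ε => bdPart g (epsKer s ν₀ F ε) p) (𝓝[>] 0) (𝓝 (κ * bdPart g (homKer s) p)) := by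
  unfold bdPart
  rw [mul_left_comm]
  refine Tendsto.const_mul _ ?_
  unfold bdCoeff
  rw [← integral_const_mul]
  refine tendsto_integral_filter_of_dominated_convergence
    (fun w => kerConst s ν₀ c * (homKer s w * max 0 (-p.2 (Fin.last n) - w (Fin.last n))))
    (Eventually.of_forall fun ε =>
      ((measurable_epsKer hF).mul (by fun_prop)).aestronglyMeasurable) ?_
    ((integrableOn_homKer_mul_max s hs hp).const_mul _) ?_
  · filter_upwards [self_mem_nhdsWithin] with ε hε
    refine ae_of_all _ fun w => ?_
    rw [norm_mul, Real.norm_eq_abs, Real.norm_of_nonneg (le_max_left _ _), ← mul_assoc]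
    exact mul_le_mul_of_nonneg_right (abs_epsKer_le hF hs hν hε w) (le_max_left _ _)
  · filter_upwards [ae_restrict_of_ae (Measure.ae_ne volume (0 : Space n))] with w hw
    rw [← mul_assoc]
    exact (hlim w hw).mul_const _

theorem tendsto_lintegral_epsKer_sub {κ : ℝ} (hF : IsWeight s c F) (hs : 1 / 2 < s) (hs' : s < 1)
    (hν : 0 < ν₀)
    (hlim : ∀ w : Space n, w ≠ 0 →
      Tendsto (fun ε => epsKer s ν₀ F ε w) (𝓝[>] 0) (𝓝 (κ * homKer s w))) :
    Tendsto (fun ε => ∫⁻ w : Space n, ‖(epsKer s ν₀ F ε w - κ * homKer s w) * growth w‖ₑ)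
      (𝓝[>] 0) (𝓝 0) := by
  have hs0 : 0 < s := by linarith
  have hi := (integrable_homKer_mul_growth (n := n) hs hs').const_mul (kerConst s ν₀ c + |κ|)
  rw [← lintegral_zero (α := Space n) (μ := volume)]
  refine tendsto_lintegral_filter_of_dominated_convergence
    (fun w => ‖(kerConst s ν₀ c + |κ|) * (homKer s w * growth w)‖ₑ)
    (Eventually.of_forall fun ε => ?_) ?_ ?_ ?_
  · exact (((measurable_epsKer hF).sub ((measurable_homKer s).const_mul κ)).mul
      measurable_growth).enorm
  · filter_upwards [self_mem_nhdsWithin] with ε hε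
    refine ae_of_all _ fun w => ?_
    rw [enorm_le_iff_norm_le, norm_mul, Real.norm_of_nonneg (growth_nonneg w)]
    refine le_trans ?_ (Real.le_norm_self _)
    rw [← mul_assoc]
    refine mul_le_mul_of_nonneg_right ?_ (growth_nonneg w)
    rw [Real.norm_eq_abs, add_mul]
    refine (abs_sub _ _).trans (add_le_add (abs_epsKer_le hF hs0 hν hε w) ?_)
    rw [abs_mul, abs_of_nonneg (homKer_nonneg s w)]
  · have := hi.2
    rw [hasFiniteIntegral_iff_enorm] at this
    exact this.ne
  · filter_upwards [Measure.ae_ne volume (0 : Space n)] with w hw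
    have h1 : Tendsto (fun ε => (epsKer s ν₀ F ε w - κ * homKer s w) * growth w) (𝓝[>] 0)
        (𝓝 0) := by
      have := ((hlim w hw).sub_const (κ * homKer s w)).mul_const (growth w)
      simpa using this
    have := h1.enorm
    simpa using this

/-- Dominated convergence in `L²`. -/
theorem tendsto_eLpNorm_two_of_dominated {α : Type*} [MeasurableSpace α] {μ : Measure α}
    {f : ℝ → α → ℝ} {b : α → ℝ} {l : Filter ℝ} [l.IsCountablyGenerated]
    (hf : ∀ᶠ ε in l, Measurable (f ε)) (hb : MemLp b 2 μ)
    (hle : ∀ᶠ ε in l, ∀ᵐ x ∂μ, |f ε x| ≤ |b x|)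
    (hlim : ∀ᵐ x ∂μ, Tendsto (fun ε => f ε x) l (𝓝 0)) :
    Tendsto (fun ε => eLpNorm (f ε) 2 μ) l (𝓝 0) := by
  have h1 : Tendsto (fun ε => ∫⁻ x, ‖f ε x‖ₑ ^ 2 ∂μ) l (𝓝 0) := by
    rw [← lintegral_zero (α := α) (μ := μ)]
    refine tendsto_lintegral_filter_of_dominated_convergence (fun x => ‖b x‖ₑ ^ 2) ?_ ?_ ?_ ?_
    · filter_upwards [hf] with ε hε using hε.enorm.pow_const 2
    · filter_upwards [hle] with ε hε
      filter_upwards [hε] with x hx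
      exact pow_le_pow_left₀ (zero_le) (enorm_le_iff_norm_le.2 hx) 2
    · rw [← eLpNorm_two_sq]
      exact (ENNReal.pow_lt_top hb.2).ne
    · filter_upwards [hlim] with x hx
      have := (ENNReal.continuous_pow 2).tendsto 0 |>.comp (by simpa using hx.enorm)
      simpa [Function.comp_def] using this
  have h2 := (ENNReal.continuous_rpow_const (y := 1 / 2)).tendsto 0 |>.comp h1
  have h3 : ∀ ε, (∫⁻ x, ‖f ε x‖ₑ ^ 2 ∂μ) ^ (1 / 2 : ℝ) = eLpNorm (f ε) 2 μ := fun ε => by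
    rw [← eLpNorm_two_sq, ← ENNReal.rpow_natCast, ← ENNReal.rpow_mul]
    norm_num
  simpa only [Function.comp_def, h3, ENNReal.zero_rpow_of_pos one_half_pos] using h2

/-- `𝓛[ψ]` is a nonzero constant times the sum of the remainder part, always in `L²((0,T)×Ω)`, and
this boundary part. Hence the hypothesis on `𝓛[ψ]` is exactly what controls the latter. -/
theorem IsGradRep.memLp_bdPart_homKer (h : IsGradRep ψ U g C) (hs : 1 / 2 < s) (hs' : s < 1)
    (hγ : 0 < γ) (hν : 0 < ν₀)
    (hL : MemLp (fun p : ℝ × Space n => opLim s γ ν₀ (ψ p.1) p.2) 2 (volTime n (Ioi 0)))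
    {T : ℝ} (hT : 0 < T) : MemLp (bdPart g (homKer s)) 2 (volTime n (Ioo 0 T)) := by
  have hκ : 0 < γ * ν₀ ^ (1 - 2 * s) * Real.Gamma (2 * s + 1) :=
    mul_pos (mul_pos hγ (Real.rpow_pos_of_pos hν _)) (Real.Gamma_pos_of_pos (by linarith))
  have h1 := (hL.mono_measure (volTime_mono (Ioo_subset_Ioi_self : Ioo 0 T ⊆ Ioi 0))).const_mul
    (γ * ν₀ ^ (1 - 2 * s) * Real.Gamma (2 * s + 1))⁻¹
  refine (h1.sub (h.memLp_remPart hT (measurable_homKer s)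
    (integrable_homKer_mul_growth hs hs'))).ae_eq ?_
  filter_upwards [ae_volTime_Ioo (h.ae_isRegularPoint hs hs') T] with p hp
  rw [Pi.sub_apply, hp.opLim_eq hs hs' h.meas_grad, inv_mul_cancel_left₀ hκ.ne',
    add_sub_cancel_left]

theorem IsGradRep.memLp_opEps (h : IsGradRep ψ U g C) (hF : IsWeight s c F) (hs : 1 / 2 < s)
    (hs' : s < 1) (hν : 0 < ν₀) (hε : 0 < ε) {T : ℝ} (hT : 0 < T)
    (hB : MemLp (bdPart g (homKer s)) 2 (volTime n (Ioo 0 T))) :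
    MemLp (fun p : ℝ × Space n => opEps s ν₀ F ε (ψ p.1) p.2) 2 (volTime n (Ioo 0 T)) := by
  have hs0 : 0 < s := by linarith
  have h1 : MemLp (remPart g (epsKer s ν₀ F ε)) 2 (volTime n (Ioo 0 T)) :=
    h.memLp_remPart hT (measurable_epsKer hF)
      (integrable_mul_of_le (measurable_epsKer hF) measurable_growth (abs_epsKer_le hF hs0 hν hε)
        (integrable_homKer_mul_growth hs hs') (homKer_nonneg s))
  have h2 : MemLp (bdPart g (epsKer s ν₀ F ε)) 2 (volTime n (Ioo 0 T)) := by
    refine hB.of_le_mul (c := kerConst s ν₀ c)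
      (measurable_bdPart h.meas_grad (measurable_epsKer hF)).aestronglyMeasurable ?_
    filter_upwards [ae_mem_upperHalf n (Ioo 0 T)] with p hp
    exact abs_bdPart_le hF hs0 hν hε hp
  refine (h1.add h2).ae_eq ?_
  filter_upwards [ae_volTime_Ioo (h.ae_isRegularPoint hs hs') T] with p hp
  rw [hp.opEps_eq hF hs0 hν hε h.meas_grad, Pi.add_apply]

theorem IsGradRep.tendsto_opEps (h : IsGradRep ψ U g C) (hF : IsWeight s c F) (hs : 1 / 2 < s)
    (hs' : s < 1) (hν : 0 < ν₀) {T : ℝ} (hT : 0 < T)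
    (hB : MemLp (bdPart g (homKer s)) 2 (volTime n (Ioo 0 T)))
    (hlim : ∀ w : Space n, w ≠ 0 → Tendsto (fun ε => epsKer s ν₀ F ε w) (𝓝[>] 0)
      (𝓝 (γ * ν₀ ^ (1 - 2 * s) * Real.Gamma (2 * s + 1) * homKer s w))) :
    Tendsto (fun ε : ℝ => eLpNorm (fun p : ℝ × Space n =>
        opEps s ν₀ F ε (ψ p.1) p.2 - opLim s γ ν₀ (ψ p.1) p.2) 2 (volTime n (Ioo 0 T)))
      (𝓝[>] 0) (𝓝 0) := by
  have hs0 : 0 < s := by linarith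
  set κ := γ * ν₀ ^ (1 - 2 * s) * Real.Gamma (2 * s + 1) with hκ
  set D : ℝ → Space n → ℝ := fun ε w => epsKer s ν₀ F ε w - κ * homKer s w with hD
  have hDm : ∀ ε, Measurable (D ε) := fun ε =>
    (measurable_epsKer hF).sub ((measurable_homKer s).const_mul κ)
  set B : ℝ → ℝ × Space n → ℝ := fun ε p =>
    bdPart g (epsKer s ν₀ F ε) p - κ * bdPart g (homKer s) p with hBdef
  have hBm : ∀ ε, Measurable (B ε) := fun ε =>
    (measurable_bdPart h.meas_grad (measurable_epsKer hF)).sub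
      ((measurable_bdPart h.meas_grad (measurable_homKer s)).const_mul κ)
  have h1 : Tendsto (fun ε => (∫⁻ w, ‖D ε w * growth w‖ₑ) * (C * ENNReal.ofReal √T))
      (𝓝[>] 0) (𝓝 0) := by
    have := ENNReal.Tendsto.mul_const (b := C * ENNReal.ofReal √T)
      (tendsto_lintegral_epsKer_sub hF hs hs' hν hlim)
      (Or.inr (ENNReal.mul_lt_top ENNReal.coe_lt_top ENNReal.ofReal_lt_top).ne)
    rwa [zero_mul] at this
  have h2 : Tendsto (fun ε => eLpNorm (B ε) 2 (volTime n (Ioo 0 T))) (𝓝[>] 0) (𝓝 0) := by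
    refine tendsto_eLpNorm_two_of_dominated (Eventually.of_forall hBm)
      (hB.const_mul (kerConst s ν₀ c + |κ|)) ?_ ?_
    · filter_upwards [self_mem_nhdsWithin] with ε hε
      filter_upwards [ae_mem_upperHalf n (Ioo 0 T)] with p hp
      have h3 := abs_bdPart_le (g := g) hF hs0 hν hε hp
      calc |B ε p| ≤ |bdPart g (epsKer s ν₀ F ε) p| + |κ * bdPart g (homKer s) p| := abs_sub _ _
        _ ≤ kerConst s ν₀ c * |bdPart g (homKer s) p| + |κ| * |bdPart g (homKer s) p| := by
          rw [abs_mul]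
          exact add_le_add_left h3 _
        _ = (kerConst s ν₀ c + |κ|) * |bdPart g (homKer s) p| := by ring
        _ ≤ |(kerConst s ν₀ c + |κ|)| * |bdPart g (homKer s) p| :=
          mul_le_mul_of_nonneg_right (le_abs_self _) (abs_nonneg _)
        _ = _ := (abs_mul _ _).symm
    · filter_upwards [ae_mem_upperHalf n (Ioo 0 T)] with p hp
      have := (tendsto_bdPart (g := g) hF hs0 hν hlim hp).sub_const (κ * bdPart g (homKer s) p)
      simpa using this
  have h12 := h1.add h2
  rw [add_zero] at h12
  refine tendsto_of_tendsto_of_tendsto_of_le_of_le' tendsto_const_nhds h12 (Eventually.of_forall fun _ => zero_le) ?_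
  filter_upwards [self_mem_nhdsWithin] with ε hε
  -- The remainders combine linearly into one for the difference kernel `D ε`, to which the
  -- Minkowski bound applies; the boundary terms are compared in `B ε`.
  have h3 : (fun p : ℝ × Space n => opEps s ν₀ F ε (ψ p.1) p.2 - opLim s γ ν₀ (ψ p.1) p.2)
      =ᵐ[volTime n (Ioo 0 T)] remPart g (D ε) + B ε := by
    filter_upwards [ae_volTime_Ioo (h.ae_isRegularPoint hs hs') T] with p hp
    have h4 : remPart g (D ε) p = remPart g (epsKer s ν₀ F ε) p - κ * remPart g (homKer s) p := by
      unfold remPart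
      rw [← integral_const_mul, ← integral_sub
        (hp.integrable_epsKer_lineRem hF hs0 hν hε h.meas_grad) (hp.integrable.const_mul κ)]
      congr 1
      ext w
      simp only [hD]
      ring
    rw [hp.opEps_eq hF hs0 hν hε h.meas_grad, hp.opLim_eq hs hs' h.meas_grad, Pi.add_apply, h4]
    simp only [hBdef]
    ring
  rw [eLpNorm_congr_ae h3]
  refine (eLpNorm_add_le (measurable_remPart h.meas_grad (hDm ε)).aestronglyMeasurable
    (hBm ε).aestronglyMeasurable one_le_two).trans ?_
  refine add_le_add_left ?_ _
  exact h.eLpNorm_remPart_le hT (hDm ε)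

theorem opEps_congr {F' : Space n → ℝ} (hF : F =ᵐ[volume] F') (u : Space n → ℝ) (x : Space n) :
    opEps s ν₀ F ε u x = opEps s ν₀ F' ε u x := by
  unfold opEps
  congr 1
  refine integral_congr_ae ?_
  filter_upwards [hF] with v hv
  rw [hv]

end convergence

end FracDiff

theorem mainTheorem6 (n : ℕ) (s γ ν₀ : ℝ) (hs : 1 / 2 < s) (hs' : s < 1) (hγ : 0 < γ)
    (hν₀ : 0 < ν₀) (F : FracDiff.Space n → ℝ) (hF : FracDiff.IsEquilibrium s γ F)
    (ψ : ℝ → FracDiff.Space n → ℝ) (hψ : FracDiff.MemLinftyH2 ψ)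
    (hL : MemLp (fun p : ℝ × FracDiff.Space n => FracDiff.opLim s γ ν₀ (ψ p.1) p.2) 2
      (FracDiff.volTime n (Ioi 0))) :
    -- the principal value in `𝓛[ψ](t, x)` exists for almost every `(t, x)`
    (∀ᵐ p ∂(FracDiff.volTime n (Ioi 0)),
      FracDiff.HasPrincipalValue (FracDiff.limKernel s (ψ p.1) p.2) p.2) ∧
    -- the integrals in `𝓛^ε[ψ](t, x)` converge absolutely for almost every `(t, x)`
    (∀ ε : ℝ, 0 < ε → ∀ᵐ p ∂(FracDiff.volTime n (Ioi 0)),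
      (∀ᵐ v : FracDiff.Space n,
        IntegrableOn (FracDiff.phiIntegrand ν₀ ε (ψ p.1) p.2 v) (Ioi 0)) ∧
      Integrable (fun v : FracDiff.Space n =>
        ν₀ * F v * (FracDiff.phiEps ν₀ ε (ψ p.1) p.2 v - ψ p.1 p.2))) ∧
    -- `𝓛^ε[ψ] → 𝓛[ψ]` strongly in `L²((0,T) × Ω)`
    (∀ T : ℝ, 0 < T →
      (∀ ε : ℝ, 0 < ε →
        MemLp (fun p : ℝ × FracDiff.Space n => FracDiff.opEps s ν₀ F ε (ψ p.1) p.2) 2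
          (FracDiff.volTime n (Ioo 0 T))) ∧
      Tendsto (fun ε : ℝ => eLpNorm (fun p : ℝ × FracDiff.Space n =>
          FracDiff.opEps s ν₀ F ε (ψ p.1) p.2 - FracDiff.opLim s γ ν₀ (ψ p.1) p.2) 2
          (FracDiff.volTime n (Ioo 0 T)))
        (𝓝[>] 0) (𝓝 0)) := by
  have hs0 : 0 < s := by linarith
  obtain ⟨U, g, C, h⟩ := FracDiff.exists_isGradRep hψ
  obtain ⟨F', c, C', hFF', hW, htail⟩ := hF.exists_isWeight hs0 hγ
  have hreg := h.ae_isRegularPoint hs hs'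
  refine ⟨?_, fun ε hε => ?_, fun T hT => ?_⟩
  · filter_upwards [hreg] with p hp
    exact (FracDiff.hasPrincipalValue_limKernel hs hs' h.meas_grad hp.mem hp.ext_sub
      hp.integrable).1
  · filter_upwards [hreg] with p hp
    constructor
    -- Convergence of the integral defining `φ^ε` does not involve `F`. Using a weight that is
    -- positive off the origin covers the velocities at which `F` vanishes.
    · have hR := FracDiff.isWeight_refWeight (n := n) hs0
      filter_upwards [FracDiff.integrable_phiIntegrand hR hs0 hν₀ hε h.meas_grad hp.ext_sub
        (hp.integral_epsKer hR hs0 hν₀ hε h.meas_grad).1,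
        Measure.ae_ne volume (0 : FracDiff.Space n)] with v hv hv0
      exact (hv (FracDiff.refWeight_pos s hv0).ne').1
    · refine (FracDiff.integrable_opEps hW hs0 hν₀ hε h.meas_grad hp.ext_sub
        (hp.integral_epsKer hW hs0 hν₀ hε h.meas_grad).1).1.congr ?_
      filter_upwards [hFF'] with v hv
      rw [hv]
  · have hB := h.memLp_bdPart_homKer hs hs' hγ hν₀ hL hT
    simp only [FracDiff.opEps_congr hFF']
    exact ⟨fun ε hε => h.memLp_opEps hW hs hs' hν₀ hε hT hB,
      h.tendsto_opEps hW hs hs' hν₀ hT hB fun w hw => FracDiff.tendsto_epsKer hW hs0 hν₀ htail hw⟩
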